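/- **Setting.** Let $q\in[2,\infty)$, $r\in[1,\infty]$, $T>0$, let $(\Omega,\mathcal F,(\mathcal F_t)_{t\in[0,T]},\mathbb P)$ be a filtered probability space and $E$ a finite-dimensional Banach space. Write $\mathbb E_s[\cdot]=\mathbb E[\cdot\,|\,\mathcal F_s]$ and $\|Y\|_{q,r,s}=\big\|\mathbb E_s[|Y|^q]\big\|_{L^r}^{1/q}\in[0,\infty]$. A *control* is a function $w:\{0\le s\le t\le T\}\to[0,\infty)$ with $w(s,u)+w(u,t)\le w(s,t)$ for all $s\le u\le t$; put $w(s,t-)=\lim_{u\nearrow t}w(s,u)$ for $s<t$ and $w(t,t-)=0$. It is right-continuous in its first (second) argument if $\lim_{u\searrow s}w(u,t)=w(s,t)$ for all $s<t$ (respectively $\lim_{u\searrow t}w(s,u)=w(s,t)$ for all $s\le t<T$). For $\Xi=(\Xi_{s,t})_{0\le s\le t\le T}$ with values in $E$, put $\delta\Xi_{s,u,t}=\Xi_{s,t}-\Xi_{s,u}-\Xi_{u,t}$. A partition $\mathcal P$ of $[s,t]$ is a finite set $\{s=t_0<\dots<t_n=t\}$, $[u,v]\in\mathcal P$ means that $u<v$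 are consecutive points of $\mathcal P$, and $|\mathcal P|$ is the mesh size. Assume that $\Xi_{s,t}$ is $\mathcal F_t$-measurable for all $0\le s\le t\le T$, and that for all $0\le s\le u\le t\le T$ $$\big\|\mathbb E_s[\delta\Xi_{s,u,t}]\big\|_{L^{qr}}\le\sum_{i=1}^N w_{1,i}(s,u)^{\alpha_{1,i}}w_{2,i}(u,t)^{\alpha_{2,i}},\qquad \|\delta\Xi_{s,u,t}\|_{q,r,s}\le\sum_{j=1}^M\bar w_{1,j}(s,u)^{\beta_{1,j}}\bar w_{2,j}(u,t)^{\beta_{2,j}},$$ where $w_{1,i},w_{2,i},\bar w_{1,j},\bar w_{2,j}$ are controls which are right-continuous in their first argument, and $\alpha_{1,i},\alpha_{2,i},\beta_{1,j},\beta_{2,j}>0$ satisfy $\alpha_{1,i}+\alpha_{2,i}>1$ and $\beta_{1,j}+\beta_{2,j}>\frac12$. **The sewn process.** Write $A(s,t)=\sum_i w_{1,i}(s,t-)^{\alpha_{1,i}}w_{2,i}(s,t)^{\alpha_{2,i}}$ and $B(s,t)=\sum_j\bar w_{1,j}(s,t-)^{\beta_{1,j}}\bar w_{2,j}(s,t)^{\beta_{2,j}}$.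 The sewn process is the adapted process $\mathcal I=(\mathcal I_t)_{t\in[0,T]}$ with $\mathcal I_0=0$ such that, for some constant $C$, $$\big\|\mathbb E_s[\mathcal I_t-\mathcal I_s-\Xi_{s,t}]\big\|_{L^{qr}}\le C\,A(s,t),\qquad \|\mathcal I_t-\mathcal I_s-\Xi_{s,t}\|_{q,r,s}\le C\,\big(A(s,t)+B(s,t)\big)\qquad(0\le s\le t\le T);$$ it exists, is unique up to modification, and satisfies $\lim_{|\mathcal P|\to0}\big\|\mathcal I_t-\mathcal I_s-\sum_{[u,v]\in\mathcal P}\Xi_{u,v}\big\|_{q,r,s}=0$ along partitions $\mathcal P$ of $[s,t]$, for all $0\le s\le t\le T$. **Theorem.** In addition, suppose that the filtration is complete (each $\mathcal F_t$ contains all subsets of $\mathbb P$-null sets); that almost surely $\Xi_{t,t}=0$ for all $t\in[0,T]$; that, for every $s\in[0,T)$, almost surely $t\mapsto\Xi_{s,t}$ is càdlàg on $[s,T]$; that, for all $i$ and $j$, at least one of $w_{1,i},w_{2,i}$ and at least one of $\bar w_{1,j},\bar w_{2,j}$ is right-continuous in its second argument; and that $$\Big\|\sup_{v\in[u,t]}|\delta\Xi_{s,u,v}|\Big\|_{q,r,s}\le\sum_{k=1}^K\hat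 w_{1,k}(s,u)^{\gamma_{1,k}}\hat w_{2,k}(u,t)^{\gamma_{2,k}}\qquad(0\le s\le u\le t\le T),$$ where $\hat w_{1,k},\hat w_{2,k}$ are controls which are right-continuous in their first argument and $\gamma_{1,k},\gamma_{2,k}>0$ satisfy $\gamma_{1,k}+\gamma_{2,k}>\frac1q$. Then the sewn process $\mathcal I$ exists as described above, and it has a version $\widetilde{\mathcal I}$, adapted, with càdlàg sample paths. Moreover, there exist $\eta>0$ and a nested sequence of partitions $(\mathcal P^h)_{h\in\mathbb N}$ of $[0,T]$ (indexed from $h=0$), with $\mathcal P^0=\{0,T\}$ and $|\mathcal P^h|\to0$, such that for every $h\in\mathbb N$, with $\Xi^{\mathcal P}_t=\sum_{[u,v]\in\mathcal P}\Xi_{u\wedge t,v\wedge t}$, $$\Big\|\sup_{t\in[0,T]}\big|\widetilde{\mathcal I}_t-\Xi^{\mathcal P^h}_t\big|\Big\|_{q,r,0}\le C\,2^{-\eta h}\Big(A(0,T)+B(0,T)+\sum_{k=1}^K\hat w_{1,k}(0,T-)^{\gamma_{1,k}}\hat w_{2,k}(0,T)^{\gamma_{2,k}}\Big).$$ Here $\eta$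 depends only on $q,N,M,K$ and the exponents $\alpha_{1,i},\alpha_{2,i},\beta_{1,j},\beta_{2,j},\gamma_{1,k},\gamma_{2,k}$, and $C$ (which may also be taken in the two estimates for $\mathcal I$) depends only on these quantities and on the space $E$. -/

import Mathlib

open MeasureTheory Filter Topology
open scoped ENNReal NNReal

noncomputable section

namespace StochSewing

/-! Time runs through `[0,T]`. Functions of time are written as functions on `ℝ`; only their values
at times in `[0,T]` are ever used. -/

/-- `w` is a control on `{(s,t) : 0 ≤ s ≤ t ≤ T}`: nonnegative and superadditive. -/
structure IsControl (T : ℝ) (w : ℝ → ℝ → ℝ) : Prop where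
  nonneg : ∀ s t, 0 ≤ s → s ≤ t → t ≤ T → 0 ≤ w s t
  superadd : ∀ s u t, 0 ≤ s → s ≤ u → u ≤ t → t ≤ T → w s u + w u t ≤ w s t

/-- Right-continuity of a control in its first argument, `w(s+,t) = w(s,t)`.
(For `s = t` there is nothing to require.) -/
def RightContFst (T : ℝ) (w : ℝ → ℝ → ℝ) : Prop :=
  ∀ s t, 0 ≤ s → s < t → t ≤ T → Tendsto (fun u => w u t) (𝓝[>] s) (𝓝 (w s t))

/-- Right-continuity of a control in its second argument, `w(s,t+) = w(s,t)`.
(For `t = T` there is nothing to require.) -/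
def RightContSnd (T : ℝ) (w : ℝ → ℝ → ℝ) : Prop :=
  ∀ s t, 0 ≤ s → s ≤ t → t < T → Tendsto (fun u => w s u) (𝓝[>] t) (𝓝 (w s t))

/-- `w(s,t-)`: the left limit of `w(s,·)` at `t` if `s < t`, and `0` if `s = t`. For a control this
limit exists by monotonicity. -/
def leftValue (w : ℝ → ℝ → ℝ) (s t : ℝ) : ℝ :=
  if s < t then Function.leftLim (w s) t else 0

/-- `∑ i, w₁ᵢ(s,u)^aᵢ * w₂ᵢ(u,t)^bᵢ`. -/
def controlSum {n : ℕ} (w₁ w₂ : Fin n → ℝ → ℝ → ℝ) (a b : Fin n → ℝ) (s u t : ℝ) : ℝ :=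
  ∑ i, w₁ i s u ^ a i * w₂ i u t ^ b i

/-- `∑ i, w₁ᵢ(s,t-)^aᵢ * w₂ᵢ(s,t)^bᵢ`. -/
def controlSumLeft {n : ℕ} (w₁ w₂ : Fin n → ℝ → ℝ → ℝ) (a b : Fin n → ℝ) (s t : ℝ) : ℝ :=
  ∑ i, leftValue (w₁ i) s t ^ a i * w₂ i s t ^ b i

/-- The finite set `P` is a partition `{s = t₀ < t₁ < ⋯ < tₙ = t}` of `[s,t]`. -/
def IsPartition (P : Finset ℝ) (s t : ℝ) : Prop :=
  s ∈ P ∧ t ∈ P ∧ ∀ x ∈ P, s ≤ x ∧ x ≤ t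

/-- The pairs `(u,v)` of consecutive points `u < v` of `P`. -/
def intervals (P : Finset ℝ) : Finset (ℝ × ℝ) :=
  (P ×ˢ P).filter fun p => p.1 < p.2 ∧ ∀ x ∈ P, x ≤ p.1 ∨ p.2 ≤ x

/-- The mesh size of `P` (zero if `P` has no interval). -/
def mesh (P : Finset ℝ) : ℝ≥0 :=
  (intervals P).sup fun p => nndist p.1 p.2

/-- The path `f` restricted to `[a,b]` is càdlàg. -/
def IsCadlagOn {E : Type*} [TopologicalSpace E] (f : ℝ → E) (a b : ℝ) : Prop :=
  (∀ t, a ≤ t → t < b → Tendsto f (𝓝[>] t) (𝓝 (f t))) ∧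
    ∀ t, a < t → t ≤ b → ∃ l, Tendsto f (𝓝[<] t) (𝓝 l)

/-- The norm `‖Y‖_{q,r,s} = ‖𝔼[|Y|^q | m]‖_{L^r}^{1/q}` with `m = ℱ_s`, as a function of the
`[0,∞]`-valued random variable `|Y|`; it may be infinite. The conditional expectation is the one of
`[0,∞]`-valued random variables, so no integrability is needed. -/
def condNorm {Ω : Type*} {mΩ : MeasurableSpace Ω} (q : ℝ) (r : ℝ≥0∞) (m : MeasurableSpace Ω)
    (P : Measure[mΩ] Ω) (absY : Ω → ℝ≥0∞) : ℝ≥0∞ :=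
  eLpNorm (condLExp m P fun ω => absY ω ^ q) r P ^ (1 / q)

/-- Every `ℱ_t`, `0 ≤ t ≤ T`, contains all subsets of `P`-null sets. -/
def IsCompleteFiltration {Ω : Type*} {mΩ : MeasurableSpace Ω} (T : ℝ) (ℱ : Filtration ℝ mΩ)
    (P : Measure Ω) : Prop :=
  ∀ t, 0 ≤ t → t ≤ T → ∀ A : Set Ω, P A = 0 → MeasurableSet[ℱ t] A

section Processes

variable {Ω E : Type*} [NormedAddCommGroup E]

/-- `δΞ_{s,u,t} = Ξ_{s,t} - Ξ_{s,u} - Ξ_{u,t}`. -/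
def delta (Ξ : ℝ → ℝ → Ω → E) (s u t : ℝ) (ω : Ω) : E :=
  Ξ s t ω - Ξ s u ω - Ξ u t ω

/-- The Riemann sum `∑_{[u,v] ∈ P} Ξ_{u,v}`. -/
def riemannSum (Ξ : ℝ → ℝ → Ω → E) (P : Finset ℝ) (ω : Ω) : E :=
  ∑ p ∈ intervals P, Ξ p.1 p.2 ω

/-- The process `Ξ^P_t = ∑_{[u,v] ∈ P} Ξ_{u ∧ t, v ∧ t}`. -/
def stoppedSum (Ξ : ℝ → ℝ → Ω → E) (P : Finset ℝ) (t : ℝ) (ω : Ω) : E :=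
  ∑ p ∈ intervals P, Ξ (min p.1 t) (min p.2 t) ω

/-- `I` is adapted, `I₀ = 0`, and the two sewing estimates hold with constant `C`:
`‖𝔼_s[δI_{s,t} - Ξ_{s,t}]‖_{L^{qr}} ≤ C A(s,t)` and
`‖δI_{s,t} - Ξ_{s,t}‖_{q,r,s} ≤ C (A(s,t) + B(s,t))` for all `0 ≤ s ≤ t ≤ T`. -/
structure IsSewing {mΩ : MeasurableSpace Ω} [NormedSpace ℝ E] (q : ℝ) (r : ℝ≥0∞) (T : ℝ)
    (ℱ : Filtration ℝ mΩ) (P : Measure Ω) (Ξ : ℝ → ℝ → Ω → E) (A B : ℝ → ℝ → ℝ) (C : ℝ)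
    (I : ℝ → Ω → E) : Prop where
  adapted : ∀ t, 0 ≤ t → t ≤ T → StronglyMeasurable[ℱ t] (I t)
  zero : ∀ᵐ ω ∂P, I 0 ω = 0
  condExp_le : ∀ s t, 0 ≤ s → s ≤ t → t ≤ T →
    eLpNorm (condExp (ℱ s) P fun ω => I t ω - I s ω - Ξ s t ω) (ENNReal.ofReal q * r) P
      ≤ ENNReal.ofReal (C * A s t)
  condNorm_le : ∀ s t, 0 ≤ s → s ≤ t → t ≤ T →
    condNorm q r (ℱ s) P (fun ω => ‖I t ω - I s ω - Ξ s t ω‖ₑ)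
      ≤ ENNReal.ofReal (C * (A s t + B s t))

end Processes

end StochSewing

end

open StochSewing

/-!
The conditional norm `‖Y‖_{q,r,s}` is the supremum of the `L^q` norms of `Y` with respect to the
measures `g P`, where `g` runs through the bounded `ℱ_s`-measurable densities in the unit ball of
the dual of `L^r` (`condNorm_le_iff`, `eLpNorm_condExp_le_iff`). Such a density does not change
conditional expectations given `ℱ_u` for `u ≥ s`. All estimates can therefore be proved for plain
`L^q` norms with respect to one finite measure.

For such norms, partial sums of adapted variables satisfy a maximal inequality
(`exists_eLpNorm_maxPartialSum_adapted_le`): the conditional means are summed in `ℓ¹`, and the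
remaining martingale differences in `ℓ²`. It follows from a pathwise form of Doob's inequality and
a second order Taylor estimate for `|x|^q`, coordinate by coordinate.

Fineness of a partition is measured by a single function `W`, the normalized sum of the first
controls with left limits in the second argument, together with the length. The exponents of the
bounds for the conditional means, for the increments and for the suprema of the increments exceed
`1`, `1/2` and `1/q` in total, so by Young's inequality the corresponding `ℓ¹`, `ℓ²` and `ℓ^q` sums
over intervals with `W ≤ Lδ` are at most a multiple of `δ^η` (`exists_isGauge`). The function `W`
is left-continuous in its second argument and right-continuous in its first. Hence any interval can
be cut so that both pieces carry at most half of `W`, and repeated cutting yields a refining chain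
whose `h`-th level has intervals with `W ≤ L 2^(-h)` (`IsLeftControl.exists_isRefiningChain`). The
same works if only points of a given partition may be used, except that an interval between two
consecutive points of it remains uncut.

Summing the geometrically decaying differences between consecutive levels
(`IsRefiningChain.level_bounds`) bounds Riemann sums along arbitrary partitions uniformly
(`IsLqGerm.riemannSum_bounds`). For the chain of `[0,T]`, the change from one level to the next is
also bounded uniformly in the time `t` at which the sums are stopped: up to time `t` the complete
intervals form a partial sum, to which the maximal inequality applies, and the interval which is cut
off at `t` is covered by the bound for `sup_v |δΞ_{s,u,v}|` (`enorm_stoppedSum_sub_le`,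
`eLpNorm_levelOsc_le`). So the stopped Riemann sums converge uniformly in `t` with geometric rate,
the limit is càdlàg and, since the filtration is complete, adapted (`exists_cadlag_limit`). The
sewing estimates for Riemann sums pass to the limit (`IsSewable.isSewing`).

Two sewn processes differ by sums of local errors along arbitrarily fine partitions, and the maximal
inequality makes these vanish (`IsSewing.ae_eq`). For convergence along all partitions of small
mesh, a partition is compared with its union with a fixed fine level of a chain: inserting
finitely many points changes little, and the union is close to the sewn process by the sewing
estimates (`IsSewable.exists_mesh`).
-/

/-! ### Elementary inequalities -/

/-- The tangent of `x ↦ x ^ p` at `1 + t` lies below the graph at `1`. -/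
theorem one_add_rpow_le {p t : ℝ} (hp : 1 ≤ p) (ht : -1 < t) :
    (1 + t) ^ p ≤ 1 + p * t * (1 + t) ^ (p - 1) := by
  have h0 : 0 < 1 + t := by linarith
  have h1 := one_add_mul_self_le_rpow_one_add (s := -t / (1 + t)) (p := p)
    (by rw [le_div_iff₀ h0]; linarith) hp
  have h2 : 1 + -t / (1 + t) = (1 + t)⁻¹ := by field_simp; ring
  rw [h2, Real.inv_rpow h0.le] at h1
  have h3 : 0 < (1 + t) ^ p := Real.rpow_pos_of_pos h0 p
  have h4 := mul_le_mul_of_nonneg_left h1 h3.le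
  rw [mul_inv_cancel₀ h3.ne'] at h4
  rw [Real.rpow_sub_one h0.ne']
  have : (1 + t) ^ p * (1 + p * (-t / (1 + t)))
      = (1 + t) ^ p - p * t * ((1 + t) ^ p / (1 + t)) := by field_simp; ring
  linarith

/-- A second order bound for `x ↦ x ^ q` at `1`, by using convexity twice. -/
theorem one_add_rpow_le_quadratic {q t : ℝ} (hq : 2 ≤ q) (ht : -1 < t) (ht1 : t ≤ 1) :
    (1 + t) ^ q ≤ 1 + q * t + q * (q - 1) * 2 ^ q * t ^ 2 := by
  have h1 := one_add_rpow_le (p := q) (by linarith) ht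
  have h2q : (1 : ℝ) ≤ 2 ^ q := Real.one_le_rpow (by norm_num) (by linarith)
  have hqq : 0 ≤ q * (q - 1) := by nlinarith
  rcases le_total 0 t with h0 | h0
  · have h2 := one_add_rpow_le (p := q - 1) (by linarith) ht
    have h3 : (1 + t) ^ (q - 1 - 1) ≤ 2 ^ q :=
      (Real.rpow_le_rpow (by linarith) (by linarith) (by linarith)).trans
        (Real.rpow_le_rpow_of_exponent_le (by norm_num : (1:ℝ) ≤ 2) (by linarith))
    have h4 : (q - 1) * t * (1 + t) ^ (q - 1 - 1) ≤ (q - 1) * t * 2 ^ q :=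
      mul_le_mul_of_nonneg_left h3 (mul_nonneg (by linarith) h0)
    have h5 : q * t * (1 + t) ^ (q - 1) ≤ q * t * (1 + (q - 1) * t * 2 ^ q) :=
      mul_le_mul_of_nonneg_left (h2.trans (by linarith)) (by positivity)
    nlinarith
  · have h2 := one_add_mul_self_le_rpow_one_add (s := t) (p := q - 1) ht.le (by linarith)
    have h5 : q * t * (1 + t) ^ (q - 1) ≤ q * t * (1 + (q - 1) * t) :=
      mul_le_mul_of_nonpos_left h2 (mul_nonpos_of_nonneg_of_nonpos (by linarith) h0)
    have h6 : q * (q - 1) * t ^ 2 * 1 ≤ q * (q - 1) * t ^ 2 * 2 ^ q :=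
      mul_le_mul_of_nonneg_left h2q (by positivity)
    nlinarith

/-- Second order Taylor estimate for `x ↦ |x| ^ q`, `q ≥ 2`. -/
theorem exists_abs_add_rpow_le {q : ℝ} (hq : 2 ≤ q) : ∃ C : ℝ, 0 < C ∧ ∀ x y : ℝ,
    |x + y| ^ q ≤ |x| ^ q + q * (|x| ^ (q - 2) * x * y)
      + C * (|x| ^ (q - 2) * |y| ^ (2 : ℝ) + |y| ^ q) := by
  have hqq : 0 ≤ q * (q - 1) := by nlinarith
  have h2q : (0 : ℝ) < 2 ^ q := by positivity
  refine ⟨2 ^ q + q + q * (q - 1) * 2 ^ q, by positivity, fun x y => ?_⟩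
  have hx2 : 0 ≤ |x| ^ (q - 2) := by positivity
  have hy2 : 0 ≤ |y| ^ (2 : ℝ) := by positivity
  have hyq : 0 ≤ |y| ^ q := by positivity
  -- for `|x| ≤ |y|` all terms are at most a multiple of `|y| ^ q`; otherwise expand in `y / x`
  rcases le_or_gt |x| |y| with h | h
  · have h1 : |x + y| ^ q ≤ 2 ^ q * |y| ^ q := by
      rw [← Real.mul_rpow (by norm_num) (abs_nonneg _)]
      exact Real.rpow_le_rpow (abs_nonneg _) (by linarith [abs_add_le x y]) (by linarith)
    have h2 : -(|y| ^ q) ≤ |x| ^ (q - 2) * x * y := by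
      have h3 : |(|x| ^ (q - 2) * x * y)| ≤ |y| ^ q := by
        rw [abs_mul, abs_mul, abs_of_nonneg hx2]
        rcases eq_or_lt_of_le (abs_nonneg y) with hy | hy
        · rw [← hy]; simp; positivity
        calc |x| ^ (q - 2) * |x| * |y| ≤ |y| ^ (q - 2) * |y| * |y| := by
              gcongr
          _ = |y| ^ q := by
              rw [Real.rpow_sub hy, Real.rpow_two]; field_simp
      exact neg_le_of_abs_le h3
    have h4 : 0 ≤ |x| ^ q := by positivity
    have h5 := mul_le_mul_of_nonneg_left h2 (by linarith : 0 ≤ q)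
    have h6 : 0 ≤ (2 ^ q + q + q * (q - 1) * 2 ^ q) * (|x| ^ (q - 2) * |y| ^ (2 : ℝ)) := by
      positivity
    have h7 : 0 ≤ q * (q - 1) * 2 ^ q * |y| ^ q := by positivity
    nlinarith
  · have hx : 0 < |x| := (abs_nonneg y).trans_lt h
    have hx0 : x ≠ 0 := abs_pos.1 hx
    have ht : |y / x| < 1 := by rw [abs_div, div_lt_one hx]; exact h
    obtain ⟨ht1, ht2⟩ := abs_lt.1 ht
    have h1 := one_add_rpow_le_quadratic hq ht1 ht2.le
    have h2 : |x + y| = |x| * (1 + y / x) := by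
      have : x + y = x * (1 + y / x) := by field_simp
      rw [this, abs_mul, abs_of_pos (show 0 < 1 + y / x by linarith)]
    have h3 : |x| ^ q = |x| ^ (q - 2) * x ^ 2 := by
      rw [Real.rpow_sub hx, Real.rpow_two, sq_abs]; field_simp
    rw [h2, Real.mul_rpow hx.le (by linarith), h3, Real.rpow_two, sq_abs]
    calc |x| ^ (q - 2) * x ^ 2 * (1 + y / x) ^ q
        ≤ |x| ^ (q - 2) * x ^ 2 * (1 + q * (y / x) + q * (q - 1) * 2 ^ q * (y / x) ^ 2) := by
          gcongr
      _ = |x| ^ (q - 2) * x ^ 2 + q * (|x| ^ (q - 2) * x * y)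
          + q * (q - 1) * 2 ^ q * (|x| ^ (q - 2) * y ^ 2) := by field_simp
      _ ≤ _ := by
          have : 0 ≤ |x| ^ (q - 2) * y ^ 2 := by positivity
          nlinarith [mul_nonneg h2q.le this, mul_nonneg (by linarith : 0 ≤ q) this,
            mul_nonneg (mul_nonneg hqq h2q.le) hyq, mul_nonneg h2q.le hyq,
            mul_nonneg (by linarith : 0 ≤ q) hyq]

/-- The tangent of `x ↦ x ^ p` at `S` together with the remainder `y ^ p`: the induction step of
`integral_abs_sum_rpow_le`. -/
theorem rpow_add_mul_le_rpow_add {p S y : ℝ} (hp : 1 ≤ p) (hS : 0 ≤ S) (hy : 0 ≤ y) :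
    S ^ p + p * S ^ (p - 1) * y + y ^ p ≤ (S + 2 * y) ^ p := by
  have h1 : (S + y) ^ p + y ^ p ≤ (S + y + y) ^ p :=
    Real.add_rpow_le_rpow_add (by linarith) hy hp
  have h2 : S ^ p + p * S ^ (p - 1) * y ≤ (S + y) ^ p := by
    rcases eq_or_lt_of_le hS with rfl | hS
    · rcases eq_or_lt_of_le hp with rfl | hp
      · simp
      · rw [Real.zero_rpow (by linarith), Real.zero_rpow (by linarith)]
        simp; positivity
    · have h3 := one_add_mul_self_le_rpow_one_add (s := y / S) (p := p)
        (by have : 0 ≤ y / S := by positivity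
            linarith) hp
      have h4 : S + y = S * (1 + y / S) := by field_simp
      rw [h4, Real.mul_rpow hS.le (by positivity)]
      calc S ^ p + p * S ^ (p - 1) * y = S ^ p * (1 + p * (y / S)) := by
            rw [Real.rpow_sub_one hS.ne']; field_simp
        _ ≤ _ := by gcongr
  have : S + 2 * y = S + y + y := by ring
  rw [this]; linarith

section

variable {Ω : Type*} {mΩ : MeasurableSpace Ω} {μ : Measure Ω}

/-- Hölder's inequality for nonnegative integrable functions, in the form with two weights. -/
theorem integral_rpow_mul_rpow_le {f g : Ω → ℝ} (hf : Integrable f μ) (hg : Integrable g μ)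
    (hf0 : ∀ ω, 0 ≤ f ω) (hg0 : ∀ ω, 0 ≤ g ω) {a b : ℝ} (ha : 0 ≤ a) (hb : 0 ≤ b)
    (hab : a + b = 1) :
    Integrable (fun ω => f ω ^ a * g ω ^ b) μ ∧
      ∫ ω, f ω ^ a * g ω ^ b ∂μ ≤ (∫ ω, f ω ∂μ) ^ a * (∫ ω, g ω ∂μ) ^ b := by
  have hint : Integrable (fun ω => f ω ^ a * g ω ^ b) μ := by
    refine ((hf.const_mul a).add (hg.const_mul b)).mono'
      (((hf.aemeasurable.pow_const a).mul (hg.aemeasurable.pow_const b)).aestronglyMeasurable)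
      (Eventually.of_forall fun ω => ?_)
    rw [Real.norm_of_nonneg (mul_nonneg (Real.rpow_nonneg (hf0 ω) a) (Real.rpow_nonneg (hg0 ω) b))]
    exact Real.geom_mean_le_arith_mean2_weighted ha hb (hf0 ω) (hg0 ω) hab
  refine ⟨hint, ?_⟩
  have h := ENNReal.lintegral_mul_norm_pow_le (μ := μ) (f := fun ω => ENNReal.ofReal (f ω))
    (g := fun ω => ENNReal.ofReal (g ω)) hf.aemeasurable.ennreal_ofReal
    hg.aemeasurable.ennreal_ofReal ha hb hab
  have hpos : 0 ≤ᵐ[μ] fun ω => f ω ^ a * g ω ^ b := Eventually.of_forall fun ω =>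
    mul_nonneg (Real.rpow_nonneg (hf0 ω) a) (Real.rpow_nonneg (hg0 ω) b)
  rw [← ofReal_integral_eq_lintegral_ofReal hf (Eventually.of_forall hf0),
    ← ofReal_integral_eq_lintegral_ofReal hg (Eventually.of_forall hg0),
    ENNReal.ofReal_rpow_of_nonneg (integral_nonneg hf0) ha,
    ENNReal.ofReal_rpow_of_nonneg (integral_nonneg hg0) hb,
    ← ENNReal.ofReal_mul (Real.rpow_nonneg (integral_nonneg hf0) a)] at h
  have h2 : ∀ ω, ENNReal.ofReal (f ω) ^ a * ENNReal.ofReal (g ω) ^ b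
      = ENNReal.ofReal (f ω ^ a * g ω ^ b) := fun ω => by
    rw [ENNReal.ofReal_rpow_of_nonneg (hf0 ω) ha, ENNReal.ofReal_rpow_of_nonneg (hg0 ω) hb,
      ← ENNReal.ofReal_mul (Real.rpow_nonneg (hf0 ω) a)]
  simp_rw [h2] at h
  rw [← ofReal_integral_eq_lintegral_ofReal hint hpos] at h
  exact (ENNReal.ofReal_le_ofReal_iff (mul_nonneg (Real.rpow_nonneg (integral_nonneg hf0) a)
    (Real.rpow_nonneg (integral_nonneg hg0) b))).1 h

/-- A variable with vanishing conditional expectation is orthogonal to the past. -/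
theorem integral_mul_eq_zero_of_condExp_eq_zero [IsFiniteMeasure μ] {m : MeasurableSpace Ω}
    (hm : m ≤ mΩ) {X D : Ω → ℝ} (hX : StronglyMeasurable[m] X) (hD : Integrable D μ)
    (hXD : Integrable (fun ω => X ω * D ω) μ) (h0 : μ[D|m] =ᵐ[μ] 0) :
    ∫ ω, X ω * D ω ∂μ = 0 := by
  have h1 := condExp_mul_of_stronglyMeasurable_left (μ := μ) (m := m) hX hXD hD
  have h2 : μ[fun ω => X ω * D ω|m] =ᵐ[μ] 0 := by
    refine h1.trans ?_
    filter_upwards [h0] with ω hω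
    simp [hω]
  rw [← integral_condExp hm, integral_congr_ae h2]; simp

end

/-! ### The maximal inequality for scalar martingales -/

/-- The running maximum `max_{k ≤ m} |a k|`. -/
noncomputable def runMax (a : ℕ → ℝ) : ℕ → ℝ
  | 0 => |a 0|
  | m + 1 => max (runMax a m) |a (m + 1)|

theorem runMax_nonneg (a : ℕ → ℝ) (m : ℕ) : 0 ≤ runMax a m := by
  cases m with
  | zero => exact abs_nonneg _
  | succ m => exact (abs_nonneg _).trans (le_max_right _ _)

theorem abs_le_runMax (a : ℕ → ℝ) {k m : ℕ} (h : k ≤ m) : |a k| ≤ runMax a m := by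
  induction m with
  | zero => obtain rfl : k = 0 := by omega
            exact le_rfl
  | succ m ih =>
    rcases Nat.lt_or_ge k (m + 1) with hk | hk
    · exact (ih (by omega)).trans (le_max_left _ _)
    · obtain rfl : k = m + 1 := by omega
      exact le_max_right _ _

theorem runMax_rpow_le_sum (a : ℕ → ℝ) (q : ℝ) (m : ℕ) :
    runMax a m ^ q ≤ ∑ k ∈ Finset.range (m + 1), |a k| ^ q := by
  induction m with
  | zero => simp [runMax]
  | succ m ih =>
    rw [Finset.sum_range_succ]
    have h1 : 0 ≤ |a (m + 1)| ^ q := by positivity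
    have h2 : 0 ≤ ∑ k ∈ Finset.range (m + 1), |a k| ^ q :=
      Finset.sum_nonneg fun _ _ => by positivity
    rw [runMax]
    rcases max_choice (runMax a m) |a (m + 1)| with h | h <;> rw [h] <;> linarith

/-- `x ↦ |x|` lies above its supporting line at `a` with this slope. -/
noncomputable def unitSign (x : ℝ) : ℝ := if 0 ≤ x then 1 else -1

theorem abs_unitSign (x : ℝ) : |unitSign x| = 1 := by
  unfold unitSign; split_ifs <;> simp

theorem measurable_unitSign : Measurable unitSign :=
  Measurable.ite measurableSet_Ici measurable_const measurable_const

theorem unitSign_mul_le (x y : ℝ) : unitSign x * (y - x) ≤ |y| - |x| := by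
  unfold unitSign
  split_ifs with h
  · rw [abs_of_nonneg h]; linarith [le_abs_self y]
  · rw [abs_of_neg (not_le.1 h)]; linarith [neg_abs_le y]

/-- Pathwise form of Doob's maximal inequality: the sum on the right is a discrete stochastic
integral, which has mean zero when `a` is a path of a martingale. -/
theorem runMax_rpow_le {q : ℝ} (hq : 1 < q) (a : ℕ → ℝ) (n : ℕ) :
    (q - 1) / q * runMax a n ^ q ≤ runMax a n ^ (q - 1) * |a n|
      - ∑ i ∈ Finset.range n, runMax a i ^ (q - 1) * unitSign (a i) * (a (i + 1) - a i) := by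
  have hq0 : 0 < q := by linarith
  induction n with
  | zero =>
    simp only [runMax, Finset.range_zero, Finset.sum_empty, sub_zero]
    have h1 : |a 0| ^ (q - 1) * |a 0| = |a 0| ^ q := by
      rw [← Real.rpow_add_one' (abs_nonneg _) (by linarith)]; ring_nf
    rw [h1]
    have h2 : (q - 1) / q ≤ 1 := by rw [div_le_one hq0]; linarith
    have h3 : 0 ≤ |a 0| ^ q := by positivity
    nlinarith
  | succ n ih =>
    rw [Finset.sum_range_succ]
    set R := runMax a n
    have hR : 0 ≤ R := runMax_nonneg a n
    have hs := mul_le_mul_of_nonneg_left (unitSign_mul_le (a n) (a (n + 1)))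
      (Real.rpow_nonneg hR (q - 1))
    -- summation by parts: where the maximum increases, its new value is `|a (n + 1)|`
    have key : (q - 1) / q * (runMax a (n + 1) ^ q - R ^ q)
        ≤ (runMax a (n + 1) ^ (q - 1) - R ^ (q - 1)) * |a (n + 1)| := by
      have hdef : runMax a (n + 1) = max R |a (n + 1)| := rfl
      rw [hdef]
      rcases le_total |a (n + 1)| R with h | h
      · rw [max_eq_left h]; simp
      · rw [max_eq_right h]
        set x := |a (n + 1)|
        have hx : 0 ≤ x := abs_nonneg _
        have h1 : x ^ (q - 1) * x = x ^ q := by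
          rw [← Real.rpow_add_one' hx (by linarith)]; ring_nf
        have h2 := Real.geom_mean_le_arith_mean2_weighted (w₁ := (q - 1) / q) (w₂ := 1 / q)
          (p₁ := R ^ q) (p₂ := x ^ q) (by apply div_nonneg <;> linarith) (by positivity)
          (by positivity) (by positivity) (by field_simp; ring)
        rw [← Real.rpow_mul hR, ← Real.rpow_mul hx, mul_one_div_cancel hq0.ne', Real.rpow_one,
          mul_div_cancel₀ _ hq0.ne'] at h2
        have h3 : 1 / q = 1 - (q - 1) / q := by field_simp; ring
        rw [h3] at h2
        nlinarith
    nlinarith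

section

variable {Ω : Type*} {mΩ : MeasurableSpace Ω} {μ : Measure Ω}

theorem measurable_runMax {m : MeasurableSpace Ω} {M : ℕ → Ω → ℝ} {n : ℕ}
    (hM : ∀ k ≤ n, Measurable[m] (M k)) : Measurable[m] fun ω => runMax (fun k => M k ω) n := by
  induction n with
  | zero => exact continuous_abs.measurable.comp (hM 0 le_rfl)
  | succ n ih =>
    exact (ih fun k hk => hM k (by omega)).max (continuous_abs.measurable.comp (hM (n + 1) le_rfl))

theorem integrable_abs_rpow {f : Ω → ℝ} {q : ℝ} (hq : 0 < q)
    (hf : MemLp f (ENNReal.ofReal q) μ) : Integrable (fun ω => |f ω| ^ q) μ := by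
  have := hf.integrable_norm_rpow (by simpa using hq) ENNReal.ofReal_ne_top
  simpa [ENNReal.toReal_ofReal hq.le] using this

/-- Integrability by Hölder's inequality with two weights. -/
theorem integrable_of_bound_rpow_mul_rpow {f g h : Ω → ℝ} (hf : Integrable f μ)
    (hg : Integrable g μ) (hf0 : ∀ ω, 0 ≤ f ω) (hg0 : ∀ ω, 0 ≤ g ω) {a b : ℝ} (ha : 0 ≤ a)
    (hb : 0 ≤ b) (hab : a + b = 1) (hh : AEStronglyMeasurable h μ)
    (hle : ∀ ω, |h ω| ≤ f ω ^ a * g ω ^ b) : Integrable h μ :=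
  (integral_rpow_mul_rpow_le hf hg hf0 hg0 ha hb hab).1.mono' hh (Eventually.of_forall hle)

theorem rpow_rpow_div {x q a : ℝ} (hx : 0 ≤ x) (hq : 0 < q) : (x ^ q) ^ (a / q) = x ^ a := by
  rw [← Real.rpow_mul hx, mul_div_cancel₀ _ hq.ne']

variable [IsFiniteMeasure μ] {q : ℝ} {𝒢 : Filtration ℕ mΩ} {D : ℕ → Ω → ℝ}

/-- The scalar square function estimate for sums of martingale differences, with the `ℓ²` sum
outside of the `L^q` norm. -/
theorem integral_abs_sum_rpow_le {C : ℝ} (hq : 2 ≤ q) (hC : 0 < C)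
    (hTaylor : ∀ x y : ℝ, |x + y| ^ q ≤ |x| ^ q + q * (|x| ^ (q - 2) * x * y)
      + C * (|x| ^ (q - 2) * |y| ^ (2 : ℝ) + |y| ^ q))
    (hD : ∀ k, StronglyMeasurable[𝒢 (k + 1)] (D k)) (hDp : ∀ k, MemLp (D k) (ENNReal.ofReal q) μ)
    (h0 : ∀ k, μ[D k|𝒢 k] =ᵐ[μ] 0) {b : ℕ → ℝ} (hb : ∀ k, 0 ≤ b k)
    (hDb : ∀ k, ∫ ω, |D k ω| ^ q ∂μ ≤ b k ^ q) (n : ℕ) :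
    ∫ ω, |∑ k ∈ Finset.range n, D k ω| ^ q ∂μ
      ≤ (2 * (C + 1) * ∑ k ∈ Finset.range n, b k ^ 2) ^ (q / 2) := by
  have hq0 : 0 < q := by linarith
  induction n with
  | zero =>
    simp [Real.zero_rpow hq0.ne', Real.zero_rpow (show q / 2 ≠ 0 by positivity)]
  | succ n ih =>
    set X : Ω → ℝ := fun ω => ∑ k ∈ Finset.range n, D k ω with hXdef
    have hXm : StronglyMeasurable[𝒢 n] X :=
      Finset.stronglyMeasurable_fun_sum _ fun k hk =>
        (hD k).mono (𝒢.mono (by have := Finset.mem_range.1 hk; omega))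
    have hXp : MemLp X (ENNReal.ofReal q) μ := memLp_finsetSum _ fun k _ => hDp k
    have hXi := integrable_abs_rpow hq0 hXp
    have hDi := integrable_abs_rpow hq0 (hDp n)
    have hX0 : ∀ ω, 0 ≤ |X ω| ^ q := fun ω => by positivity
    have hD0 : ∀ ω, 0 ≤ |D n ω| ^ q := fun ω => by positivity
    have hXm' : StronglyMeasurable X := hXm.mono (𝒢.le n)
    have hDm' : StronglyMeasurable (D n) := (hD n).mono (𝒢.le _)
    have hw : StronglyMeasurable[𝒢 n] fun ω => |X ω| ^ (q - 2) * X ω :=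
      (((continuous_abs.measurable.comp hXm.measurable).pow_const (q - 2)).mul
        hXm.measurable).stronglyMeasurable
    have hcross : Integrable (fun ω => |X ω| ^ (q - 2) * X ω * D n ω) μ := by
      refine integrable_of_bound_rpow_mul_rpow (a := (q - 1) / q) (b := 1 / q) hXi hDi hX0 hD0
        (by apply div_nonneg <;> linarith) (by positivity) (by field_simp; ring)
        ((hw.mono (𝒢.le n)).mul hDm').aestronglyMeasurable fun ω => ?_
      rw [rpow_rpow_div (abs_nonneg _) hq0, rpow_rpow_div (abs_nonneg _) hq0, Real.rpow_one, abs_mul,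
        abs_mul, abs_of_nonneg (show 0 ≤ |X ω| ^ (q - 2) by positivity),
        ← Real.rpow_add_one' (abs_nonneg _) (by linarith), show q - 2 + 1 = q - 1 by ring]
    -- the first order term has mean zero, since `D n` has conditional mean zero
    have hcross0 : ∫ ω, |X ω| ^ (q - 2) * X ω * D n ω ∂μ = 0 :=
      integral_mul_eq_zero_of_condExp_eq_zero (𝒢.le n) hw
        ((hDp n).integrable (by
          rw [← ENNReal.ofReal_one]; exact ENNReal.ofReal_le_ofReal (by linarith))) hcross (h0 n)
    -- the second order term is bounded by Hölder's inequality and the induction hypothesis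
    have hsq := integral_rpow_mul_rpow_le (a := (q - 2) / q) (b := 2 / q) hXi hDi hX0 hD0
      (by apply div_nonneg <;> linarith) (by positivity) (by field_simp; ring)
    simp only [rpow_rpow_div (abs_nonneg _) hq0] at hsq
    set S := 2 * (C + 1) * ∑ k ∈ Finset.range n, b k ^ 2 with hS
    have hS0 : 0 ≤ S := mul_nonneg (by positivity) (Finset.sum_nonneg fun k _ => sq_nonneg _)
    have hsq2 : ∫ ω, |X ω| ^ (q - 2) * |D n ω| ^ (2 : ℝ) ∂μ ≤ S ^ (q / 2 - 1) * b n ^ 2 := by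
      refine hsq.2.trans ?_
      have e1 : (S ^ (q / 2)) ^ ((q - 2) / q) = S ^ (q / 2 - 1) := by
        rw [← Real.rpow_mul hS0]; congr 1; field_simp
      have e2 : (b n ^ q) ^ (2 / q) = b n ^ 2 := by
        rw [rpow_rpow_div (hb n) hq0, Real.rpow_two]
      rw [← e1, ← e2]
      exact mul_le_mul
        (Real.rpow_le_rpow (integral_nonneg hX0) ih (by apply div_nonneg <;> linarith))
        (Real.rpow_le_rpow (integral_nonneg hD0) (hDb n) (by positivity))
        (Real.rpow_nonneg (integral_nonneg hD0) _) (by positivity)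
    have hI1 : Integrable (fun ω => |X ω| ^ q + q * (|X ω| ^ (q - 2) * X ω * D n ω)) μ :=
      hXi.add (hcross.const_mul q)
    have hI2 : Integrable (fun ω => C * (|X ω| ^ (q - 2) * |D n ω| ^ (2 : ℝ) + |D n ω| ^ q)) μ :=
      (hsq.1.add hDi).const_mul C
    have hle : ∫ ω, |X ω + D n ω| ^ q ∂μ
        ≤ ∫ ω, (|X ω| ^ q + q * (|X ω| ^ (q - 2) * X ω * D n ω)
          + C * (|X ω| ^ (q - 2) * |D n ω| ^ (2 : ℝ) + |D n ω| ^ q)) ∂μ :=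
      integral_mono (integrable_abs_rpow hq0 (hXp.add (hDp n)))
        (hI1.add hI2)
        fun ω => hTaylor (X ω) (D n ω)
    rw [integral_add hI1 hI2,
      integral_add hXi (hcross.const_mul q), integral_const_mul, integral_const_mul, hcross0,
      integral_add hsq.1 hDi, mul_zero, add_zero] at hle
    simp_rw [Finset.sum_range_succ]
    refine hle.trans ?_
    have hfin := rpow_add_mul_le_rpow_add (p := q / 2) (S := S) (y := (C + 1) * b n ^ 2)
      (by linarith) hS0 (by positivity)
    have e3 : S + 2 * ((C + 1) * b n ^ 2)
        = 2 * (C + 1) * (∑ k ∈ Finset.range n, b k ^ 2 + b n ^ 2) := by rw [hS]; ring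
    rw [e3] at hfin
    refine le_trans ?_ hfin
    have e4 : b n ^ q = (b n ^ 2) ^ (q / 2) := by
      rw [← Real.rpow_two, ← Real.rpow_mul (hb n)]; congr 1; ring
    have e5 : C * b n ^ q ≤ ((C + 1) * b n ^ 2) ^ (q / 2) := by
      rw [Real.mul_rpow (by positivity) (by positivity), ← e4]
      gcongr
      · exact Real.rpow_nonneg (hb n) q
      · calc C ≤ C + 1 := by linarith
          _ = (C + 1) ^ (1 : ℝ) := (Real.rpow_one _).symm
          _ ≤ _ := Real.rpow_le_rpow_of_exponent_le (by linarith) (by linarith)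
    have e6 : C * (S ^ (q / 2 - 1) * b n ^ 2) ≤ q / 2 * S ^ (q / 2 - 1) * ((C + 1) * b n ^ 2) := by
      have : 0 ≤ S ^ (q / 2 - 1) * b n ^ 2 := by positivity
      have h2 : 0 ≤ (q / 2 - 1) * ((C + 1) * (S ^ (q / 2 - 1) * b n ^ 2)) :=
        mul_nonneg (by linarith) (by positivity)
      nlinarith
    have e7 := mul_le_mul_of_nonneg_left hsq2 hC.le
    have e8 := mul_le_mul_of_nonneg_left (hDb n) hC.le
    linarith

/-- Doob's `L^q` inequality for a scalar martingale given by its differences. -/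
theorem integral_runMax_rpow_le (hq : 2 ≤ q)
    (hD : ∀ k, StronglyMeasurable[𝒢 (k + 1)] (D k)) (hDp : ∀ k, MemLp (D k) (ENNReal.ofReal q) μ)
    (h0 : ∀ k, μ[D k|𝒢 k] =ᵐ[μ] 0) (n : ℕ) :
    Integrable (fun ω => runMax (fun m => ∑ k ∈ Finset.range m, D k ω) n ^ q) μ ∧
    ∫ ω, runMax (fun m => ∑ k ∈ Finset.range m, D k ω) n ^ q ∂μ
      ≤ (2 : ℝ) ^ q * ∫ ω, |∑ k ∈ Finset.range n, D k ω| ^ q ∂μ := by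
  have hq0 : 0 < q := by linarith
  set M : ℕ → Ω → ℝ := fun m ω => ∑ k ∈ Finset.range m, D k ω with hM
  have hMm : ∀ m, StronglyMeasurable[𝒢 m] (M m) := fun m =>
    Finset.stronglyMeasurable_fun_sum _ fun k hk =>
      (hD k).mono (𝒢.mono (by have := Finset.mem_range.1 hk; omega))
  have hMp : ∀ m, MemLp (M m) (ENNReal.ofReal q) μ := fun m => memLp_finsetSum _ fun k _ => hDp k
  set R : ℕ → Ω → ℝ := fun m ω => runMax (fun k => M k ω) m with hR
  have hRm : ∀ m, Measurable[𝒢 m] (R m) := fun m =>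
    measurable_runMax fun k hk => (hMm k).measurable.mono (𝒢.mono hk) le_rfl
  have hR0 : ∀ m ω, 0 ≤ R m ω := fun m ω => runMax_nonneg _ _
  have hRi : ∀ m, Integrable (fun ω => R m ω ^ q) μ := fun m => by
    refine (integrable_finsetSum (Finset.range (m + 1))
      fun k _ => integrable_abs_rpow hq0 (hMp k)).mono'
      (((hRm m).mono (𝒢.le m) le_rfl).pow_const q).aestronglyMeasurable
      (Eventually.of_forall fun ω => ?_)
    rw [Real.norm_of_nonneg (Real.rpow_nonneg (hR0 m ω) q)]
    exact runMax_rpow_le_sum _ q m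
  have hMi := integrable_abs_rpow hq0 (hMp n)
  have hRq0 : ∀ m ω, 0 ≤ R m ω ^ q := fun m ω => Real.rpow_nonneg (hR0 m ω) q
  refine ⟨hRi n, ?_⟩
  have hexp : 0 ≤ (q - 1) / q := by apply div_nonneg <;> linarith
  have hsum1 : (q - 1) / q + 1 / q = 1 := by field_simp; ring
  have hw : ∀ i, StronglyMeasurable[𝒢 i] fun ω => R i ω ^ (q - 1) * unitSign (M i ω) := fun i =>
    (((hRm i).pow_const (q - 1)).mul
      (measurable_unitSign.comp (hMm i).measurable)).stronglyMeasurable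
  have hterm : ∀ i, Integrable (fun ω => R i ω ^ (q - 1) * unitSign (M i ω) * D i ω) μ := fun i => by
    refine integrable_of_bound_rpow_mul_rpow (a := (q - 1) / q) (b := 1 / q) (hRi i)
      (integrable_abs_rpow hq0 (hDp i)) (hRq0 i) (fun ω => by positivity) hexp (by positivity) hsum1
      (((hw i).mono (𝒢.le i)).mul ((hD i).mono (𝒢.le _))).aestronglyMeasurable fun ω => ?_
    rw [rpow_rpow_div (hR0 i ω) hq0, rpow_rpow_div (abs_nonneg _) hq0, Real.rpow_one, abs_mul,
      abs_mul, abs_unitSign, mul_one, abs_of_nonneg (Real.rpow_nonneg (hR0 i ω) _)]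
  -- the discrete stochastic integral in the pathwise inequality has mean zero
  have hterm0 : ∀ i, ∫ ω, R i ω ^ (q - 1) * unitSign (M i ω) * D i ω ∂μ = 0 := fun i =>
    integral_mul_eq_zero_of_condExp_eq_zero (𝒢.le i) (hw i)
      ((hDp i).integrable (by
        rw [← ENNReal.ofReal_one]; exact ENNReal.ofReal_le_ofReal (by linarith))) (hterm i) (h0 i)
  have hlast := integral_rpow_mul_rpow_le (hRi n) hMi (hRq0 n) (fun ω => by positivity) hexp
    (by positivity : 0 ≤ 1 / q) hsum1
  have hsimp : ∀ ω, (R n ω ^ q) ^ ((q - 1) / q) * (|M n ω| ^ q) ^ (1 / q)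
      = R n ω ^ (q - 1) * |M n ω| := fun ω => by
    rw [rpow_rpow_div (hR0 n ω) hq0, rpow_rpow_div (abs_nonneg _) hq0, Real.rpow_one]
  simp_rw [hsimp] at hlast
  have hpath : ∀ ω, (q - 1) / q * R n ω ^ q ≤ R n ω ^ (q - 1) * |M n ω|
      - ∑ i ∈ Finset.range n, R i ω ^ (q - 1) * unitSign (M i ω) * D i ω := fun ω => by
    refine (runMax_rpow_le (by linarith) (fun m => M m ω) n).trans_eq ?_
    congr 1
    refine Finset.sum_congr rfl fun i _ => ?_
    simp [hR, hM, Finset.sum_range_succ]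
  have hsumi := integrable_finsetSum (Finset.range n) fun i _ => hterm i
  have hint := integral_mono ((hRi n).const_mul _) (hlast.1.sub hsumi) hpath
  simp only [Pi.sub_apply] at hint
  rw [integral_const_mul, integral_sub hlast.1 hsumi, integral_finsetSum _ fun i _ => hterm i,
    Finset.sum_eq_zero fun i _ => hterm0 i, sub_zero] at hint
  -- `r` and `x` are the `q`-th moments of the maximum and of the final value
  set r := ∫ ω, R n ω ^ q ∂μ
  set x := ∫ ω, |M n ω| ^ q ∂μ
  have hr : 0 ≤ r := integral_nonneg (hRq0 n)
  have hx : 0 ≤ x := integral_nonneg fun ω => by positivity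
  rcases eq_or_lt_of_le hr with h | hr'
  · rw [← h]; positivity
  have h1 : (q - 1) / q * r ≤ r ^ ((q - 1) / q) * x ^ (1 / q) := hint.trans hlast.2
  have h2 : r = r ^ ((q - 1) / q) * r ^ (1 / q) := by
    rw [← Real.rpow_add hr', hsum1, Real.rpow_one]
  have h3 : 1 / 2 * r ≤ r ^ ((q - 1) / q) * x ^ (1 / q) := by
    refine le_trans (mul_le_mul_of_nonneg_right ?_ hr) h1
    rw [div_le_div_iff₀ (by norm_num) hq0]; linarith
  have h4 : r ^ (1 / q) ≤ 2 * x ^ (1 / q) := by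
    have h5 : 0 < r ^ ((q - 1) / q) := Real.rpow_pos_of_pos hr' _
    have h6 : r ^ ((q - 1) / q) * r ^ (1 / q) ≤ r ^ ((q - 1) / q) * (2 * x ^ (1 / q)) := by
      rw [← h2]; linarith
    exact le_of_mul_le_mul_left h6 h5
  have h5 := Real.rpow_le_rpow (by positivity) h4 hq0.le
  rwa [Real.mul_rpow (by norm_num) (by positivity), ← Real.rpow_mul hr, ← Real.rpow_mul hx,
    one_div_mul_cancel hq0.ne', Real.rpow_one, Real.rpow_one] at h5

end

/-! ### The maximal inequality for adapted sums in finite-dimensional spaces -/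

section

variable {Ω : Type*} {mΩ : MeasurableSpace Ω} {μ : Measure Ω}
variable {E : Type*} [NormedAddCommGroup E]

/-- The maximal function `max_{m ≤ n} ‖∑_{k < m} Z k‖` of the partial sums of `Z`. -/
noncomputable def maxPartialSum (Z : ℕ → Ω → E) (n : ℕ) (ω : Ω) : ℝ≥0∞ :=
  (Finset.range (n + 1)).sup fun m => ‖∑ k ∈ Finset.range m, Z k ω‖ₑ

theorem enorm_sum_le_maxPartialSum (Z : ℕ → Ω → E) {m n : ℕ} (h : m ≤ n) (ω : Ω) :
    ‖∑ k ∈ Finset.range m, Z k ω‖ₑ ≤ maxPartialSum Z n ω :=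
  Finset.le_sup (f := fun m => ‖∑ k ∈ Finset.range m, Z k ω‖ₑ)
    (Finset.mem_range.2 (Nat.lt_succ_of_le h))

theorem aemeasurable_maxPartialSum {Z : ℕ → Ω → E} {n : ℕ}
    (hZ : ∀ k < n, AEStronglyMeasurable (Z k) μ) : AEMeasurable (maxPartialSum Z n) μ := by
  have h : maxPartialSum Z n = fun ω =>
      ⨆ m ∈ Finset.range (n + 1), ‖∑ k ∈ Finset.range m, Z k ω‖ₑ := by
    funext ω; rw [maxPartialSum, Finset.sup_eq_iSup]
  rw [h]
  refine AEMeasurable.iSup fun m => AEMeasurable.iSup fun hm => ?_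
  refine AEStronglyMeasurable.enorm ?_
  refine Finset.aestronglyMeasurable_fun_sum _ fun k hk => hZ k ?_
  have := Finset.mem_range.1 hm
  have := Finset.mem_range.1 hk
  omega

/-- Passage between the `L^q` norm and the `q`-th moment. -/
theorem eLpNorm_le_ofReal_iff {F : Type*} [NormedAddCommGroup F] {f : Ω → F} {q b : ℝ} (hq : 0 < q)
    (hb : 0 ≤ b) (hf : MemLp f (ENNReal.ofReal q) μ) :
    eLpNorm f (ENNReal.ofReal q) μ ≤ ENNReal.ofReal b ↔ ∫ ω, ‖f ω‖ ^ q ∂μ ≤ b ^ q := by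
  have hI : 0 ≤ ∫ ω, ‖f ω‖ ^ q ∂μ := integral_nonneg fun ω => by positivity
  rw [hf.eLpNorm_eq_integral_rpow_norm (by simpa using hq) ENNReal.ofReal_ne_top,
    ENNReal.toReal_ofReal hq.le, ENNReal.ofReal_le_ofReal_iff hb]
  exact Real.rpow_inv_le_iff_of_pos hI hb hq

theorem one_le_ofReal_of_two_le {q : ℝ} (hq : 2 ≤ q) : (1 : ℝ≥0∞) ≤ ENNReal.ofReal q := by
  rw [← ENNReal.ofReal_one]; exact ENNReal.ofReal_le_ofReal (by linarith)

theorem memLp_of_eLpNorm_le {F : Type*} [NormedAddCommGroup F] {f : Ω → F} {p : ℝ≥0∞} {b : ℝ}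
    (hf : AEStronglyMeasurable f μ) (h : eLpNorm f p μ ≤ ENNReal.ofReal b) : MemLp f p μ :=
  ⟨hf, h.trans_lt ENNReal.ofReal_lt_top⟩

/-- The scalar case of the maximal inequality for martingale differences. -/
theorem exists_eLpNorm_maxPartialSum_real_le {q : ℝ} (hq : 2 ≤ q) : ∃ C : ℝ, 0 < C ∧
    ∀ {Ω : Type*} {mΩ : MeasurableSpace Ω} (μ : Measure Ω) [IsFiniteMeasure μ]
      (𝒢 : Filtration ℕ mΩ) (D : ℕ → Ω → ℝ) (b : ℕ → ℝ) (n : ℕ),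
      (∀ k, StronglyMeasurable[𝒢 (k + 1)] (D k)) → (∀ k, μ[D k|𝒢 k] =ᵐ[μ] 0) →
      (∀ k, 0 ≤ b k) → (∀ k, eLpNorm (D k) (ENNReal.ofReal q) μ ≤ ENNReal.ofReal (b k)) →
      eLpNorm (maxPartialSum D n) (ENNReal.ofReal q) μ
        ≤ ENNReal.ofReal (C * √(∑ k ∈ Finset.range n, b k ^ 2)) := by
  obtain ⟨C, hC, hT⟩ := exists_abs_add_rpow_le hq
  refine ⟨2 * √(2 * (C + 1)), by positivity, ?_⟩
  intro Ω mΩ μ _ 𝒢 D b n hD h0 hb hDb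
  have hq0 : 0 < q := by linarith
  have hDp : ∀ k, MemLp (D k) (ENNReal.ofReal q) μ := fun k =>
    memLp_of_eLpNorm_le ((hD k).mono (𝒢.le _)).aestronglyMeasurable (hDb k)
  have h1 := integral_abs_sum_rpow_le hq hC hT hD hDp h0 hb
    (fun k => (eLpNorm_le_ofReal_iff hq0 (hb k) (hDp k)).1 (hDb k)) n
  obtain ⟨hRi, h2⟩ := integral_runMax_rpow_le hq hD hDp h0 n
  set R : Ω → ℝ := fun ω => runMax (fun m => ∑ k ∈ Finset.range m, D k ω) n
  have hR0 : ∀ ω, 0 ≤ R ω := fun ω => runMax_nonneg _ _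
  have hRm : AEStronglyMeasurable R μ := by
    refine (measurable_runMax (m := mΩ) fun k _ => ?_).aestronglyMeasurable
    exact Finset.measurable_fun_sum _ fun j _ => ((hD j).mono (𝒢.le _)).measurable
  have hRp : MemLp R (ENNReal.ofReal q) μ := by
    refine (integrable_norm_rpow_iff hRm (by simpa using hq0) ENNReal.ofReal_ne_top).1 ?_
    rw [ENNReal.toReal_ofReal hq0.le]
    exact hRi.congr (Eventually.of_forall fun ω => by simp only [Real.norm_of_nonneg (hR0 ω)]; rfl)
  have h3 : eLpNorm (maxPartialSum D n) (ENNReal.ofReal q) μ ≤ eLpNorm R (ENNReal.ofReal q) μ := by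
    refine eLpNorm_mono_enorm fun ω => ?_
    rw [enorm_eq_self, maxPartialSum, Finset.sup_le_iff]
    intro m hm
    rw [Real.enorm_eq_ofReal_abs, Real.enorm_eq_ofReal (hR0 ω)]
    exact ENNReal.ofReal_le_ofReal (abs_le_runMax (fun m => ∑ k ∈ Finset.range m, D k ω)
      (Nat.lt_succ_iff.1 (Finset.mem_range.1 hm)))
  refine h3.trans ((eLpNorm_le_ofReal_iff hq0 (by positivity) hRp).2 ?_)
  have h4 : (2 * √(2 * (C + 1)) * √(∑ k ∈ Finset.range n, b k ^ 2)) ^ q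
      = 2 ^ q * (2 * (C + 1) * ∑ k ∈ Finset.range n, b k ^ 2) ^ (q / 2) := by
    rw [mul_assoc, ← Real.sqrt_mul (by positivity), Real.mul_rpow (by norm_num) (by positivity),
      Real.sqrt_eq_rpow, ← Real.rpow_mul (mul_nonneg (by positivity)
        (Finset.sum_nonneg fun _ _ => sq_nonneg _))]
    ring_nf
  rw [h4]
  simp_rw [Real.norm_of_nonneg (hR0 _)]
  exact h2.trans (by gcongr)

/-- Conditional expectations are contractions on `L^q`. -/
theorem eLpNorm_condExp_le_of_memLp [NormedSpace ℝ E] [CompleteSpace E] [IsFiniteMeasure μ]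
    {m : MeasurableSpace Ω} (hm : m ≤ mΩ) {q : ℝ} (hq : 1 ≤ q) {f : Ω → E}
    (hf : MemLp f (ENNReal.ofReal q) μ) :
    eLpNorm (μ[f|m]) (ENNReal.ofReal q) μ ≤ eLpNorm f (ENNReal.ofReal q) μ := by
  have hq0 : 0 < q := by linarith
  have hi : Integrable (fun ω => ‖f ω‖ ^ q) μ := by
    simpa [ENNReal.toReal_ofReal hq0.le] using
      hf.integrable_norm_rpow (by simpa using hq0) ENNReal.ofReal_ne_top
  have h1 := Integrable.norm_condExp_rpow_le (m := m) hq hi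
  have h2 : Integrable (fun ω => ‖(μ[f|m]) ω‖ ^ q) μ := by
    refine (integrable_condExp (μ := μ) (m := m) (f := fun ω => ‖f ω‖ ^ q)).mono'
      ((stronglyMeasurable_condExp.mono hm).norm.measurable.pow_const q).aestronglyMeasurable ?_
    filter_upwards [h1] with ω hω
    rwa [Real.norm_of_nonneg (by positivity)]
  have hm' : AEStronglyMeasurable[mΩ] (μ[f|m]) μ :=
    (stronglyMeasurable_condExp.mono hm).aestronglyMeasurable
  have h3 : MemLp (μ[f|m]) (ENNReal.ofReal q) μ := by
    refine (integrable_norm_rpow_iff hm' (by simpa using hq0) ENNReal.ofReal_ne_top).1 ?_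
    rwa [ENNReal.toReal_ofReal hq0.le]
  rw [h3.eLpNorm_eq_integral_rpow_norm (by simpa using hq0) ENNReal.ofReal_ne_top,
    hf.eLpNorm_eq_integral_rpow_norm (by simpa using hq0) ENNReal.ofReal_ne_top,
    ENNReal.toReal_ofReal hq0.le]
  refine ENNReal.ofReal_le_ofReal (Real.rpow_le_rpow (integral_nonneg fun ω => by positivity) ?_
    (by positivity))
  calc ∫ ω, ‖(μ[f|m]) ω‖ ^ q ∂μ ≤ ∫ ω, (μ[fun ω => ‖f ω‖ ^ q|m]) ω ∂μ :=
        integral_mono_ae h2 integrable_condExp h1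
    _ = _ := integral_condExp hm

end

/-- The maximal inequality for martingale differences with values in a finite-dimensional space,
obtained coordinatewise. -/
theorem exists_eLpNorm_maxPartialSum_le {q : ℝ} (hq : 2 ≤ q) (E : Type*) [NormedAddCommGroup E]
    [NormedSpace ℝ E] [FiniteDimensional ℝ E] : ∃ C : ℝ, 0 < C ∧
    ∀ {Ω : Type*} {mΩ : MeasurableSpace Ω} (μ : Measure Ω) [IsFiniteMeasure μ]
      (𝒢 : Filtration ℕ mΩ) (D : ℕ → Ω → E) (b : ℕ → ℝ) (n : ℕ),
      (∀ k, StronglyMeasurable[𝒢 (k + 1)] (D k)) → (∀ k, μ[D k|𝒢 k] =ᵐ[μ] 0) →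
      (∀ k, 0 ≤ b k) → (∀ k, eLpNorm (D k) (ENNReal.ofReal q) μ ≤ ENNReal.ofReal (b k)) →
      eLpNorm (maxPartialSum D n) (ENNReal.ofReal q) μ
        ≤ ENNReal.ofReal (C * √(∑ k ∈ Finset.range n, b k ^ 2)) := by
  obtain ⟨C, hC, hmax⟩ := exists_eLpNorm_maxPartialSum_real_le hq
  let e := Module.finBasis ℝ E
  let φ : Fin (Module.finrank ℝ E) → E →L[ℝ] ℝ := fun i => (e.coord i).toContinuousLinearMap
  refine ⟨∑ i, ‖e i‖ * (C * ‖φ i‖) + 1, by positivity, ?_⟩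
  intro Ω mΩ μ _ 𝒢 D b n hD h0 hb hDb
  have hq1 := one_le_ofReal_of_two_le hq
  have hDp : ∀ k, MemLp (D k) (ENNReal.ofReal q) μ := fun k =>
    memLp_of_eLpNorm_le ((hD k).mono (𝒢.le _)).aestronglyMeasurable (hDb k)
  set S := √(∑ k ∈ Finset.range n, b k ^ 2)
  have hcoord : ∀ i, eLpNorm (maxPartialSum (fun k ω => φ i (D k ω)) n) (ENNReal.ofReal q) μ
      ≤ ENNReal.ofReal (C * (‖φ i‖ * S)) := fun i => by
    have h1 := hmax μ 𝒢 (fun k ω => φ i (D k ω)) (fun k => ‖φ i‖ * b k) n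
      (fun k => (φ i).continuous.comp_stronglyMeasurable (hD k)) (fun k => ?_)
      (fun k => mul_nonneg (norm_nonneg _) (hb k)) (fun k => ?_)
    · refine h1.trans (le_of_eq ?_)
      simp_rw [mul_pow, ← Finset.mul_sum]
      rw [Real.sqrt_mul (by positivity), Real.sqrt_sq (norm_nonneg _)]
    · have h2 := (φ i).comp_condExp_comm (m := 𝒢 k) ((hDp k).integrable hq1)
      refine h2.symm.trans ?_
      filter_upwards [h0 k] with ω hω
      simp [hω]
    · have h3 := eLpNorm_le_nnreal_smul_eLpNorm_of_ae_le_mul (μ := μ) (f := fun ω => φ i (D k ω))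
        (g := D k) (c := ‖φ i‖₊) (Eventually.of_forall fun ω => (φ i).le_opNNNorm _)
        (ENNReal.ofReal q)
      refine h3.trans ?_
      rw [ENNReal.ofReal_mul (norm_nonneg _), ENNReal.smul_def, smul_eq_mul, ofReal_norm]
      exact mul_le_mul_right (hDb k) _
  have hpt : ∀ ω, maxPartialSum D n ω
      ≤ ∑ i, ‖e i‖ₑ * maxPartialSum (fun k ω => φ i (D k ω)) n ω := fun ω => by
    rw [maxPartialSum, Finset.sup_le_iff]
    intro m hm
    set x := ∑ k ∈ Finset.range m, D k ω with hx
    have hxe : x = ∑ i, φ i x • e i := (e.sum_repr x).symm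
    calc ‖x‖ₑ = ‖∑ i, φ i x • e i‖ₑ := by rw [← hxe]
      _ ≤ ∑ i, ‖φ i x • e i‖ₑ := enorm_sum_le _ _
      _ ≤ _ := Finset.sum_le_sum fun i _ => by
        rw [enorm_smul, mul_comm, hx, map_sum]
        gcongr
        exact enorm_sum_le_maxPartialSum (fun k ω => φ i (D k ω))
          (Nat.lt_succ_iff.1 (Finset.mem_range.1 hm)) ω
  have hmeas : ∀ i, AEMeasurable (maxPartialSum (fun k ω => φ i (D k ω)) n) μ := fun i =>
    aemeasurable_maxPartialSum fun k _ =>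
      (φ i).continuous.comp_aestronglyMeasurable (hDp k).aestronglyMeasurable
  calc eLpNorm (maxPartialSum D n) (ENNReal.ofReal q) μ
      ≤ eLpNorm (∑ i, fun ω => ‖e i‖ₑ * maxPartialSum (fun k ω => φ i (D k ω)) n ω)
          (ENNReal.ofReal q) μ := by
        refine eLpNorm_mono_enorm fun ω => ?_
        simp only [enorm_eq_self, Finset.sum_apply]
        exact hpt ω
    _ ≤ ∑ i, eLpNorm (fun ω => ‖e i‖ₑ * maxPartialSum (fun k ω => φ i (D k ω)) n ω)
          (ENNReal.ofReal q) μ :=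
        eLpNorm_sum_le (fun i _ => ((hmeas i).const_mul _).aestronglyMeasurable) hq1
    _ ≤ ∑ i, ENNReal.ofReal (‖e i‖ * (C * (‖φ i‖ * S))) := Finset.sum_le_sum fun i _ => by
        have h4 : eLpNorm (fun ω => ‖e i‖ₑ * maxPartialSum (fun k ω => φ i (D k ω)) n ω)
            (ENNReal.ofReal q) μ
            = ‖e i‖ₑ * eLpNorm (maxPartialSum (fun k ω => φ i (D k ω)) n) (ENNReal.ofReal q) μ := by
          have hq0 : 0 < q := by linarith
          rw [eLpNorm_eq_lintegral_rpow_enorm_toReal (by simpa using hq0) ENNReal.ofReal_ne_top,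
            eLpNorm_eq_lintegral_rpow_enorm_toReal (by simpa using hq0) ENNReal.ofReal_ne_top,
            ENNReal.toReal_ofReal hq0.le]
          simp_rw [enorm_eq_self, ENNReal.mul_rpow_of_nonneg _ _ hq0.le]
          rw [lintegral_const_mul' _ _ (by simp [hq0.le]),
            ENNReal.mul_rpow_of_nonneg _ _ (by positivity), ← ENNReal.rpow_mul,
            mul_one_div_cancel hq0.ne', ENNReal.rpow_one]
        rw [h4, ENNReal.ofReal_mul (norm_nonneg _), ofReal_norm]
        exact mul_le_mul_right (hcoord i) _
    _ = ENNReal.ofReal (∑ i, ‖e i‖ * (C * (‖φ i‖ * S))) :=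
        (ENNReal.ofReal_sum_of_nonneg fun i _ => by positivity).symm
    _ ≤ _ := by
        refine ENNReal.ofReal_le_ofReal ?_
        rw [add_mul, Finset.sum_mul, one_mul]
        have : ∑ i, ‖e i‖ * (C * (‖φ i‖ * S)) = ∑ i, ‖e i‖ * (C * ‖φ i‖) * S :=
          Finset.sum_congr rfl fun i _ => by ring
        rw [this]
        linarith [Real.sqrt_nonneg (∑ k ∈ Finset.range n, b k ^ 2)]

/-- `L^q` maximal estimate for sums of adapted random variables: the conditional means are summed
in `ℓ¹`, and what remains is a martingale, whose increments are summed in `ℓ²`. -/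
theorem exists_eLpNorm_maxPartialSum_adapted_le {q : ℝ} (hq : 2 ≤ q) (E : Type*)
    [NormedAddCommGroup E] [NormedSpace ℝ E] [FiniteDimensional ℝ E] : ∃ C : ℝ, 0 < C ∧
    ∀ {Ω : Type*} {mΩ : MeasurableSpace Ω} (μ : Measure Ω) [IsFiniteMeasure μ]
      (𝒢 : Filtration ℕ mΩ) (Z : ℕ → Ω → E) (a b : ℕ → ℝ) (n : ℕ),
      (∀ k < n, StronglyMeasurable[𝒢 (k + 1)] (Z k)) → (∀ k < n, 0 ≤ a k) → (∀ k < n, 0 ≤ b k) →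
      (∀ k < n, eLpNorm (μ[Z k|𝒢 k]) (ENNReal.ofReal q) μ ≤ ENNReal.ofReal (a k)) →
      (∀ k < n, eLpNorm (Z k) (ENNReal.ofReal q) μ ≤ ENNReal.ofReal (b k)) →
      eLpNorm (maxPartialSum Z n) (ENNReal.ofReal q) μ
        ≤ ENNReal.ofReal (∑ k ∈ Finset.range n, a k
          + C * √(∑ k ∈ Finset.range n, b k ^ 2)) := by
  obtain ⟨C, hC, hmax⟩ := exists_eLpNorm_maxPartialSum_le hq E
  refine ⟨C * 2, by positivity, ?_⟩
  intro Ω mΩ μ _ 𝒢 Z a b n hZ ha hb hZa hZb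
  have hq1 := one_le_ofReal_of_two_le hq
  have hZp : ∀ k < n, MemLp (Z k) (ENNReal.ofReal q) μ := fun k hk =>
    memLp_of_eLpNorm_le ((hZ k hk).mono (𝒢.le _)).aestronglyMeasurable (hZb k hk)
  have hZi : ∀ k < n, Integrable (Z k) μ := fun k hk => (hZp k hk).integrable hq1
  set c : ℕ → Ω → E := fun k => μ[Z k|𝒢 k]
  have hcm : ∀ k, StronglyMeasurable[𝒢 k] (c k) := fun k => stronglyMeasurable_condExp
  have hcp : ∀ k < n, AEStronglyMeasurable (c k) μ := fun k _ =>
    ((hcm k).mono (𝒢.le k)).aestronglyMeasurable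
  -- the martingale part, cut off at `n` because nothing is assumed about later indices
  let D : ℕ → Ω → E := fun k => if k < n then Z k - c k else 0
  have hDn : ∀ k < n, D k = Z k - c k := fun k hk => if_pos hk
  have h1 := hmax μ 𝒢 D (fun k => if k < n then 2 * b k else 0) n ?_ ?_ ?_ ?_
  · have h2 : ∑ k ∈ Finset.range n, (if k < n then 2 * b k else 0) ^ 2
        = 2 ^ 2 * ∑ k ∈ Finset.range n, b k ^ 2 := by
      rw [Finset.mul_sum]
      refine Finset.sum_congr rfl fun k hk => ?_
      rw [if_pos (Finset.mem_range.1 hk), mul_pow]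
    rw [h2, Real.sqrt_mul (by norm_num), Real.sqrt_sq (by norm_num), ← mul_assoc] at h1
    have hpt : ∀ ω, maxPartialSum Z n ω
        ≤ (∑ k ∈ Finset.range n, fun ω => ‖c k ω‖ₑ) ω + maxPartialSum D n ω := fun ω => by
      rw [maxPartialSum, Finset.sup_le_iff]
      intro m hm
      have hmn : m ≤ n := Nat.lt_succ_iff.1 (Finset.mem_range.1 hm)
      have h3 : ∑ k ∈ Finset.range m, Z k ω
          = ∑ k ∈ Finset.range m, c k ω + ∑ k ∈ Finset.range m, D k ω := by
        rw [← Finset.sum_add_distrib]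
        refine Finset.sum_congr rfl fun k hk => ?_
        rw [hDn k ((Finset.mem_range.1 hk).trans_le hmn)]; simp
      rw [h3, Finset.sum_apply]
      refine (enorm_add_le _ _).trans (add_le_add ?_ (enorm_sum_le_maxPartialSum D hmn ω))
      exact (enorm_sum_le _ _).trans
        (Finset.sum_le_sum_of_subset (Finset.range_subset_range.2 hmn))
    have hcm' : ∀ k ∈ Finset.range n, AEStronglyMeasurable (fun ω => ‖c k ω‖ₑ) μ := fun k hk =>
      (hcp k (Finset.mem_range.1 hk)).enorm.aestronglyMeasurable
    calc eLpNorm (maxPartialSum Z n) (ENNReal.ofReal q) μ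
        ≤ eLpNorm ((∑ k ∈ Finset.range n, fun ω => ‖c k ω‖ₑ) + maxPartialSum D n)
            (ENNReal.ofReal q) μ := eLpNorm_mono_enorm fun ω => by
              simp only [enorm_eq_self, Pi.add_apply]; exact hpt ω
      _ ≤ eLpNorm (∑ k ∈ Finset.range n, fun ω => ‖c k ω‖ₑ) (ENNReal.ofReal q) μ
            + eLpNorm (maxPartialSum D n) (ENNReal.ofReal q) μ := by
          refine eLpNorm_add_le (Finset.aestronglyMeasurable_sum _ hcm') ?_ hq1
          refine (aemeasurable_maxPartialSum fun k hk => ?_).aestronglyMeasurable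
          rw [hDn k hk]
          exact (hZp k hk).aestronglyMeasurable.sub (hcp k hk)
      _ ≤ (∑ k ∈ Finset.range n, ENNReal.ofReal (a k))
            + ENNReal.ofReal (C * 2 * √(∑ k ∈ Finset.range n, b k ^ 2)) := by
          refine add_le_add ((eLpNorm_sum_le hcm' hq1).trans (Finset.sum_le_sum fun k hk => ?_)) h1
          rw [eLpNorm_enorm]; exact hZa k (Finset.mem_range.1 hk)
      _ = _ := by
          rw [← ENNReal.ofReal_sum_of_nonneg fun k hk => ha k (Finset.mem_range.1 hk),
            ← ENNReal.ofReal_add (Finset.sum_nonneg fun k hk => ha k (Finset.mem_range.1 hk))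
              (by positivity)]
  · intro k
    by_cases hk : k < n
    · rw [hDn k hk]; exact (hZ k hk).sub ((hcm k).mono (𝒢.mono (Nat.le_succ k)))
    · simp only [D, if_neg hk]; exact stronglyMeasurable_zero
  · intro k
    by_cases hk : k < n
    · rw [hDn k hk]
      have h4 := condExp_sub (m := 𝒢 k) (hZi k hk) (integrable_condExp (μ := μ) (m := 𝒢 k) (f := Z k))
      have h5 : μ[c k|𝒢 k] = c k :=
        condExp_of_stronglyMeasurable (𝒢.le k) (hcm k) integrable_condExp
      refine h4.trans ?_
      filter_upwards with ω
      simp only [Pi.sub_apply, Pi.zero_apply]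
      rw [show (μ[μ[Z k|𝒢 k]|𝒢 k]) = c k from h5]; exact sub_self _
    · simp only [D, if_neg hk]
      rw [condExp_zero]
  · intro k
    split_ifs with hk
    · have := hb k hk; positivity
    · exact le_rfl
  · intro k
    by_cases hk : k < n
    · rw [hDn k hk]
      simp only [if_pos hk]
      refine (eLpNorm_sub_le (hZp k hk).aestronglyMeasurable (hcp k hk) hq1).trans ?_
      have h6 := eLpNorm_condExp_le_of_memLp (𝒢.le k) (by linarith) (hZp k hk)
      rw [two_mul, ENNReal.ofReal_add (hb k hk) (hb k hk)]
      exact add_le_add (hZb k hk) (h6.trans (hZb k hk))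
    · simp [D, if_neg hk]

/-! ### Controls and their left limits -/

/-- Young's inequality for sums: mixed powers of total order at least one are superadditive. -/
theorem sum_rpow_mul_rpow_le {ι : Type*} {S : Finset ι} {a b : ι → ℝ} {A B x y : ℝ}
    (ha : ∀ k ∈ S, 0 ≤ a k) (hb : ∀ k ∈ S, 0 ≤ b k) (hA : ∑ k ∈ S, a k ≤ A)
    (hB : ∑ k ∈ S, b k ≤ B) (hx : 0 ≤ x) (hy : 0 ≤ y) (hxy : 1 ≤ x + y) :
    ∑ k ∈ S, a k ^ x * b k ^ y ≤ A ^ x * B ^ y := by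
  have hA0 : 0 ≤ A := (Finset.sum_nonneg ha).trans hA
  have hB0 : 0 ≤ B := (Finset.sum_nonneg hb).trans hB
  have haA : ∀ k ∈ S, a k ≤ A := fun k hk => (Finset.single_le_sum ha hk).trans hA
  have hbB : ∀ k ∈ S, b k ≤ B := fun k hk => (Finset.single_le_sum hb hk).trans hB
  have hs : 0 < x + y := by linarith
  -- if a total vanishes, so do all of its terms, and the junk value of the quotient is harmless
  have hu : ∀ k ∈ S, a k = a k / A * A := fun k hk => by
    rcases eq_or_ne A 0 with h | h
    · have := haA k hk; have := ha k hk; rw [h, mul_zero]; linarith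
    · field_simp
  have hv : ∀ k ∈ S, b k = b k / B * B := fun k hk => by
    rcases eq_or_ne B 0 with h | h
    · have := hbB k hk; have := hb k hk; rw [h, mul_zero]; linarith
    · field_simp
  have hterm : ∀ k ∈ S, a k ^ x * b k ^ y
      ≤ (x / (x + y) * (a k / A) + y / (x + y) * (b k / B)) * (A ^ x * B ^ y) := fun k hk => by
    have hu0 : 0 ≤ a k / A := div_nonneg (ha k hk) hA0
    have hv0 : 0 ≤ b k / B := div_nonneg (hb k hk) hB0
    have hu1 : a k / A ≤ 1 := div_le_one_of_le₀ (haA k hk) hA0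
    have hv1 : b k / B ≤ 1 := div_le_one_of_le₀ (hbB k hk) hB0
    have h1 : a k ^ x * b k ^ y = (a k / A) ^ x * (b k / B) ^ y * (A ^ x * B ^ y) := by
      conv_lhs => rw [hu k hk, hv k hk]
      rw [Real.mul_rpow hu0 hA0, Real.mul_rpow hv0 hB0]; ring
    rw [h1]
    refine mul_le_mul_of_nonneg_right ?_ (by positivity)
    have h2 := Real.geom_mean_le_arith_mean2_weighted (w₁ := x / (x + y)) (w₂ := y / (x + y))
      (by positivity) (by positivity) hu0 hv0 (by field_simp)
    refine le_trans (mul_le_mul ?_ ?_ (by positivity) (by positivity)) h2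
    · exact Real.rpow_le_rpow_of_exponent_ge' hu0 hu1 (by positivity)
        ((div_le_iff₀ hs).2 (by nlinarith))
    · exact Real.rpow_le_rpow_of_exponent_ge' hv0 hv1 (by positivity)
        ((div_le_iff₀ hs).2 (by nlinarith))
  refine (Finset.sum_le_sum hterm).trans ?_
  rw [← Finset.sum_mul, Finset.sum_add_distrib, ← Finset.mul_sum, ← Finset.mul_sum,
    ← Finset.sum_div, ← Finset.sum_div]
  have h3 : (∑ k ∈ S, a k) / A ≤ 1 := div_le_one_of_le₀ hA hA0
  have h4 : (∑ k ∈ S, b k) / B ≤ 1 := div_le_one_of_le₀ hB hB0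
  have h5 : x / (x + y) * ((∑ k ∈ S, a k) / A) + y / (x + y) * ((∑ k ∈ S, b k) / B) ≤ 1 := by
    have e : x / (x + y) + y / (x + y) = 1 := by field_simp
    have : 0 ≤ x / (x + y) := by positivity
    have : 0 ≤ y / (x + y) := by positivity
    nlinarith
  have : 0 ≤ A ^ x * B ^ y := by positivity
  nlinarith

/-- If the first factors are at most the fraction `ρ` of their total, excess order beyond one turns
into a positive power of `ρ`. -/
theorem sum_rpow_mul_rpow_le_of_le_mul {ι : Type*} {S : Finset ι} {a b : ι → ℝ} {A B x y ρ θ : ℝ}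
    (ha : ∀ k ∈ S, 0 ≤ a k) (hb : ∀ k ∈ S, 0 ≤ b k) (hA : ∑ k ∈ S, a k ≤ A)
    (hB : ∑ k ∈ S, b k ≤ B) (hρ : 0 ≤ ρ) (haρ : ∀ k ∈ S, a k ≤ ρ * A) (hy : 0 ≤ y)
    (hθ : 0 < θ) (hθx : θ ≤ x) (hθxy : θ ≤ x + y - 1) :
    ∑ k ∈ S, a k ^ x * b k ^ y ≤ ρ ^ θ * (A ^ x * B ^ y) := by
  have hA0 : 0 ≤ A := (Finset.sum_nonneg ha).trans hA
  have hB0 : 0 ≤ B := (Finset.sum_nonneg hb).trans hB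
  have hsplit : ∀ z : ℝ, 0 ≤ z → z ^ x = z ^ θ * z ^ (x - θ) := fun z hz => by
    rw [← Real.rpow_add_of_nonneg hz hθ.le (by linarith)]; congr 1; ring
  calc ∑ k ∈ S, a k ^ x * b k ^ y
      ≤ ∑ k ∈ S, (ρ * A) ^ θ * (a k ^ (x - θ) * b k ^ y) := Finset.sum_le_sum fun k hk => by
        rw [hsplit _ (ha k hk), mul_assoc]
        exact mul_le_mul_of_nonneg_right (Real.rpow_le_rpow (ha k hk) (haρ k hk) hθ.le)
          (mul_nonneg (Real.rpow_nonneg (ha k hk) _) (Real.rpow_nonneg (hb k hk) _))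
    _ ≤ (ρ * A) ^ θ * (A ^ (x - θ) * B ^ y) := by
        rw [← Finset.mul_sum]
        exact mul_le_mul_of_nonneg_left
          (sum_rpow_mul_rpow_le ha hb hA hB (by linarith) hy (by linarith)) (by positivity)
    _ = _ := by rw [Real.mul_rpow hρ hA0, hsplit A hA0]; ring

/-- A superadditive function which is continuous from the left in its second argument and from the
right in its first, such as the left-limit version `w(s,t-)` of a control `w` which is
right-continuous in its first argument. -/
structure IsLeftControl (T : ℝ) (W : ℝ → ℝ → ℝ) : Prop where
  nonneg : ∀ s t, 0 ≤ s → s ≤ t → t ≤ T → 0 ≤ W s t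
  superadd : ∀ s u t, 0 ≤ s → s ≤ u → u ≤ t → t ≤ T → W s u + W u t ≤ W s t
  tendsto_left : ∀ s t, 0 ≤ s → s < t → t ≤ T → Tendsto (fun v => W s v) (𝓝[<] t) (𝓝 (W s t))
  tendsto_right : ∀ s t, 0 ≤ s → s < t → t ≤ T → Tendsto (fun u => W u t) (𝓝[>] s) (𝓝 (W s t))

theorem mono_of_superadd {T : ℝ} {W : ℝ → ℝ → ℝ} (h0 : ∀ s t, 0 ≤ s → s ≤ t → t ≤ T → 0 ≤ W s t)
    (h : ∀ s u t, 0 ≤ s → s ≤ u → u ≤ t → t ≤ T → W s u + W u t ≤ W s t) {s u v t : ℝ}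
    (hs : 0 ≤ s) (hsu : s ≤ u) (huv : u ≤ v) (hvt : v ≤ t) (ht : t ≤ T) : W u v ≤ W s t := by
  have h1 := h s u t hs hsu (huv.trans hvt) ht
  have h2 := h u v t (hs.trans hsu) huv hvt ht
  have h3 := h0 s u hs hsu ((huv.trans hvt).trans ht)
  have h4 := h0 v t (hs.trans (hsu.trans huv)) hvt ht
  linarith

/-- A nonnegative superadditive function summed over some of the intervals of a chain. -/
theorem sum_le_of_superadd {T : ℝ} {W : ℝ → ℝ → ℝ}
    (h0 : ∀ s t, 0 ≤ s → s ≤ t → t ≤ T → 0 ≤ W s t)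
    (h : ∀ s u t, 0 ≤ s → s ≤ u → u ≤ t → t ≤ T → W s u + W u t ≤ W s t) {s t : ℝ}
    (hs : 0 ≤ s) (ht : t ≤ T) {x : ℕ → ℝ} (hx : Monotone x)
    (hxs : ∀ k, s ≤ x k) (hxt : ∀ k, x k ≤ t) (S : Finset ℕ) :
    ∑ k ∈ S, W (x k) (x (k + 1)) ≤ W s t := by
  have hsum : ∀ n, ∑ k ∈ Finset.range n, W (x k) (x (k + 1)) ≤ W (x 0) (x n) := by
    intro n
    induction n with
    | zero => simpa using h0 _ _ (hs.trans (hxs 0)) le_rfl ((hxt 0).trans ht)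
    | succ n ih =>
      rw [Finset.sum_range_succ]
      have := h (x 0) (x n) (x (n + 1)) (hs.trans (hxs 0)) (hx (Nat.zero_le n))
        (hx (Nat.le_succ n)) ((hxt _).trans ht)
      linarith
  obtain ⟨n, hn⟩ := S.exists_nat_subset_range
  refine (Finset.sum_le_sum_of_subset_of_nonneg hn fun k _ _ => ?_).trans ((hsum n).trans ?_)
  · exact h0 _ _ (hs.trans (hxs k)) (hx (Nat.le_succ k)) ((hxt _).trans ht)
  · exact mono_of_superadd h0 h hs (hxs 0) (hx (Nat.zero_le n)) (hxt n) ht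

namespace IsLeftControl

variable {T : ℝ}

theorem const_mul {W : ℝ → ℝ → ℝ} (h : IsLeftControl T W) {c : ℝ} (hc : 0 ≤ c) :
    IsLeftControl T fun s t => c * W s t where
  nonneg s t hs hst ht := mul_nonneg hc (h.nonneg s t hs hst ht)
  superadd s u t hs hsu hut ht := by
    rw [← mul_add]; exact mul_le_mul_of_nonneg_left (h.superadd s u t hs hsu hut ht) hc
  tendsto_left s t hs hst ht := (h.tendsto_left s t hs hst ht).const_mul c
  tendsto_right s t hs hst ht := (h.tendsto_right s t hs hst ht).const_mul c

theorem add {W W' : ℝ → ℝ → ℝ} (h : IsLeftControl T W) (h' : IsLeftControl T W') :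
    IsLeftControl T fun s t => W s t + W' s t where
  nonneg s t hs hst ht := add_nonneg (h.nonneg s t hs hst ht) (h'.nonneg s t hs hst ht)
  superadd s u t hs hsu hut ht := by
    linarith [h.superadd s u t hs hsu hut ht, h'.superadd s u t hs hsu hut ht]
  tendsto_left s t hs hst ht := (h.tendsto_left s t hs hst ht).add (h'.tendsto_left s t hs hst ht)
  tendsto_right s t hs hst ht :=
    (h.tendsto_right s t hs hst ht).add (h'.tendsto_right s t hs hst ht)

theorem sum {ι : Type*} {S : Finset ι} {W : ι → ℝ → ℝ → ℝ} (h : ∀ i ∈ S, IsLeftControl T (W i)) :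
    IsLeftControl T fun s t => ∑ i ∈ S, W i s t where
  nonneg s t hs hst ht := Finset.sum_nonneg fun i hi => (h i hi).nonneg s t hs hst ht
  superadd s u t hs hsu hut ht := by
    rw [← Finset.sum_add_distrib]
    exact Finset.sum_le_sum fun i hi => (h i hi).superadd s u t hs hsu hut ht
  tendsto_left s t hs hst ht := tendsto_finsetSum _ fun i hi => (h i hi).tendsto_left s t hs hst ht
  tendsto_right s t hs hst ht := tendsto_finsetSum _ fun i hi => (h i hi).tendsto_right s t hs hst ht

theorem length : IsLeftControl T fun s t => t - s where
  nonneg s t _ hst _ := sub_nonneg.2 hst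
  superadd s u t _ _ _ _ := by linarith
  tendsto_left s t _ _ _ :=
    ((continuous_id.sub continuous_const).tendsto t).mono_left nhdsWithin_le_nhds
  tendsto_right s t _ _ _ :=
    ((continuous_const.sub continuous_id).tendsto s).mono_left nhdsWithin_le_nhds

theorem mono {W : ℝ → ℝ → ℝ} (h : IsLeftControl T W) {s u v t : ℝ}
    (hs : 0 ≤ s) (hsu : s ≤ u) (huv : u ≤ v) (hvt : v ≤ t) (ht : t ≤ T) : W u v ≤ W s t :=
  mono_of_superadd h.nonneg h.superadd hs hsu huv hvt ht

theorem self {W : ℝ → ℝ → ℝ} (h : IsLeftControl T W) {s : ℝ} (hs : 0 ≤ s) (hsT : s ≤ T) :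
    W s s = 0 := by
  have := h.superadd s s s hs le_rfl le_rfl hsT
  have := h.nonneg s s hs le_rfl hsT
  linarith

end IsLeftControl

section LeftValue

variable {T : ℝ} {w : ℝ → ℝ → ℝ}

theorem StochSewing.IsControl.mono (hw : IsControl T w) {s u v t : ℝ} (hs : 0 ≤ s) (hsu : s ≤ u)
    (huv : u ≤ v) (hvt : v ≤ t) (ht : t ≤ T) : w u v ≤ w s t :=
  mono_of_superadd hw.nonneg hw.superadd hs hsu huv hvt ht

theorem leftValue_self (w : ℝ → ℝ → ℝ) (s : ℝ) : leftValue w s s = 0 := by simp [leftValue]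

theorem tendsto_leftValue (hw : IsControl T w) {s t : ℝ} (hs : 0 ≤ s) (hst : s < t) (ht : t ≤ T) :
    Tendsto (w s) (𝓝[<] t) (𝓝 (leftValue w s t)) := by
  have hmono : MonotoneOn (w s) (Set.Ioo s t) := fun a ha b hb hab =>
    hw.mono hs le_rfl ha.1.le hab (hb.2.le.trans ht)
  have hbdd : BddAbove (w s '' Set.Ioo s t) := ⟨w s t, by
    rintro _ ⟨a, ha, rfl⟩
    exact hw.mono hs le_rfl ha.1.le ha.2.le ht⟩
  have h : Tendsto (w s) (𝓝[<] t) (𝓝 (sSup (w s '' Set.Ioo s t))) := by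
    exact hmono.tendsto_nhdsWithin_Ioo_left (Set.nonempty_Ioo.2 hst) hbdd
  rw [leftValue, if_pos hst, leftLim_eq_of_tendsto h]
  exact h

theorem le_leftValue (hw : IsControl T w) {s u t : ℝ} (hs : 0 ≤ s) (hsu : s ≤ u) (hut : u < t)
    (ht : t ≤ T) : w s u ≤ leftValue w s t := by
  refine ge_of_tendsto (tendsto_leftValue hw hs (hsu.trans_lt hut) ht) ?_
  filter_upwards [Ioo_mem_nhdsLT hut] with v hv
  exact hw.mono hs le_rfl hsu hv.1.le (hv.2.le.trans ht)

theorem leftValue_le_of_forall (hw : IsControl T w) {s t c : ℝ} (hs : 0 ≤ s) (hst : s < t)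
    (ht : t ≤ T) (h : ∀ v, s ≤ v → v < t → w s v ≤ c) : leftValue w s t ≤ c := by
  refine le_of_tendsto (tendsto_leftValue hw hs hst ht) ?_
  filter_upwards [Ioo_mem_nhdsLT hst] with v hv
  exact h v hv.1.le hv.2

theorem leftValue_nonneg (hw : IsControl T w) {s t : ℝ} (hs : 0 ≤ s) (hst : s ≤ t) (ht : t ≤ T) :
    0 ≤ leftValue w s t := by
  rcases eq_or_lt_of_le hst with rfl | h
  · rw [leftValue_self]
  · exact (hw.nonneg s s hs le_rfl (h.le.trans ht)).trans (le_leftValue hw hs le_rfl h ht)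

theorem leftValue_superadd (hw : IsControl T w) {s u t : ℝ} (hs : 0 ≤ s) (hsu : s ≤ u)
    (hut : u ≤ t) (ht : t ≤ T) : leftValue w s u + leftValue w u t ≤ leftValue w s t := by
  rcases eq_or_lt_of_le hsu with rfl | hsu'
  · rw [leftValue_self, zero_add]
  rcases eq_or_lt_of_le hut with rfl | hut'
  · rw [leftValue_self, add_zero]
  have h1 : leftValue w u t ≤ leftValue w s t - leftValue w s u := by
    refine leftValue_le_of_forall hw (hs.trans hsu) hut' ht fun v huv hvt => ?_
    have h2 : leftValue w s u ≤ w s v - w u v := by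
      refine leftValue_le_of_forall hw hs hsu' (hut.trans ht) fun v' hsv' hv'u => ?_
      have := hw.superadd s v' v hs hsv' (hv'u.le.trans huv) (hvt.le.trans ht)
      have := hw.mono (hs.trans hsv') hv'u.le huv le_rfl (hvt.le.trans ht)
      linarith
    linarith [le_leftValue hw hs (hsu.trans huv) hvt ht]
  linarith

theorem isLeftControl_leftValue (hw : IsControl T w) (hr : RightContFst T w) :
    IsLeftControl T (leftValue w) where
  nonneg s t hs hst ht := leftValue_nonneg hw hs hst ht
  superadd s u t hs hsu hut ht := leftValue_superadd hw hs hsu hut ht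
  tendsto_left s t hs hst ht := by
    refine tendsto_order.2 ⟨fun c hc => ?_, fun c hc => ?_⟩
    · have h1 := (tendsto_leftValue hw hs hst ht).eventually (eventually_gt_nhds hc)
      obtain ⟨v, hv, hvs⟩ := (h1.and (Ioo_mem_nhdsLT hst)).exists
      filter_upwards [Ioo_mem_nhdsLT hvs.2] with v' hv'
      exact hv.trans_le (le_leftValue hw hs hvs.1.le hv'.1 (hv'.2.le.trans ht))
    · filter_upwards [Ioo_mem_nhdsLT hst] with v hv
      refine lt_of_le_of_lt ?_ hc
      exact mono_of_superadd (fun _ _ => leftValue_nonneg hw) (fun _ _ _ => leftValue_superadd hw)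
        hs le_rfl hv.1.le hv.2.le ht
  tendsto_right s t hs hst ht := by
    refine tendsto_order.2 ⟨fun c hc => ?_, fun c hc => ?_⟩
    · have h1 := (tendsto_leftValue hw hs hst ht).eventually (eventually_gt_nhds hc)
      obtain ⟨v, hv, hvs⟩ := (h1.and (Ioo_mem_nhdsLT hst)).exists
      filter_upwards [(hr s v hs hvs.1 (hvs.2.le.trans ht)).eventually (eventually_gt_nhds hv),
        Ioo_mem_nhdsGT hvs.1] with u hu hus
      exact hu.trans_le (le_leftValue hw (hs.trans hus.1.le) hus.2.le hvs.2 ht)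
    · filter_upwards [Ioo_mem_nhdsGT hst] with u hu
      refine lt_of_le_of_lt ?_ hc
      exact mono_of_superadd (fun _ _ => leftValue_nonneg hw) (fun _ _ _ => leftValue_superadd hw)
        hs hu.1.le hu.2.le le_rfl ht

end LeftValue

/-! ### Fineness of partitions measured by a control -/

theorem exists_pos_forall_le {n : ℕ} (f : Fin n → ℝ) (hf : ∀ i, 0 < f i) :
    ∃ θ : ℝ, 0 < θ ∧ ∀ i, θ ≤ f i := by
  rcases isEmpty_or_nonempty (Fin n) with h | h
  · exact ⟨1, one_pos, fun i => isEmptyElim i⟩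
  · obtain ⟨i, hi⟩ := Finite.exists_min f
    exact ⟨f i, hf i, hi⟩

theorem controlSumLeft_nonneg {T : ℝ} {n : ℕ} {w₁ w₂ : Fin n → ℝ → ℝ → ℝ} {a b : Fin n → ℝ}
    (h₁ : ∀ i, IsControl T (w₁ i)) (h₂ : ∀ i, IsControl T (w₂ i)) {s t : ℝ} (hs : 0 ≤ s)
    (hst : s ≤ t) (ht : t ≤ T) : 0 ≤ controlSumLeft w₁ w₂ a b s t :=
  Finset.sum_nonneg fun i _ => mul_nonneg
    (Real.rpow_nonneg (leftValue_nonneg (h₁ i) hs hst ht) _)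
    (Real.rpow_nonneg ((h₂ i).nonneg s t hs hst ht) _)

theorem controlSumLeft_mono {T : ℝ} {n : ℕ} {w₁ w₂ : Fin n → ℝ → ℝ → ℝ} {a b : Fin n → ℝ}
    (h₁ : ∀ i, IsControl T (w₁ i)) (h₂ : ∀ i, IsControl T (w₂ i)) (ha : ∀ i, 0 < a i)
    (hb : ∀ i, 0 < b i) {s u v t : ℝ} (hs : 0 ≤ s) (hsu : s ≤ u) (huv : u ≤ v) (hvt : v ≤ t)
    (ht : t ≤ T) : controlSumLeft w₁ w₂ a b u v ≤ controlSumLeft w₁ w₂ a b s t :=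
  Finset.sum_le_sum fun i _ => mul_le_mul
    (Real.rpow_le_rpow (leftValue_nonneg (h₁ i) (hs.trans hsu) huv (hvt.trans ht))
      (mono_of_superadd (fun _ _ => leftValue_nonneg (h₁ i)) (fun _ _ _ => leftValue_superadd (h₁ i))
        hs hsu huv hvt ht) (ha i).le)
    (Real.rpow_le_rpow ((h₂ i).nonneg u v (hs.trans hsu) huv (hvt.trans ht))
      ((h₂ i).mono hs hsu huv hvt ht) (hb i).le)
    (Real.rpow_nonneg ((h₂ i).nonneg u v (hs.trans hsu) huv (hvt.trans ht)) _)
    (Real.rpow_nonneg (leftValue_nonneg (h₁ i) hs (hsu.trans (huv.trans hvt)) ht) _)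

/-- The three-point bound is controlled by the two-point one as soon as the last two points are
distinct, because then `w₁(s,u) ≤ w₁(s,t-)`. -/
theorem controlSum_le_controlSumLeft {T : ℝ} {n : ℕ} {w₁ w₂ : Fin n → ℝ → ℝ → ℝ}
    {a b : Fin n → ℝ} (h₁ : ∀ i, IsControl T (w₁ i)) (h₂ : ∀ i, IsControl T (w₂ i))
    (ha : ∀ i, 0 < a i) (hb : ∀ i, 0 < b i) {s u t : ℝ} (hs : 0 ≤ s) (hsu : s ≤ u) (hut : u < t)
    (ht : t ≤ T) : controlSum w₁ w₂ a b s u t ≤ controlSumLeft w₁ w₂ a b s t :=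
  Finset.sum_le_sum fun i _ => mul_le_mul
    (Real.rpow_le_rpow ((h₁ i).nonneg s u hs hsu (hut.le.trans ht))
      (le_leftValue (h₁ i) hs hsu hut ht) (ha i).le)
    (Real.rpow_le_rpow ((h₂ i).nonneg u t (hs.trans hsu) hut.le ht)
      ((h₂ i).mono hs hsu hut.le le_rfl ht) (hb i).le)
    (Real.rpow_nonneg ((h₂ i).nonneg u t (hs.trans hsu) hut.le ht) _)
    (Real.rpow_nonneg (leftValue_nonneg (h₁ i) hs (hsu.trans hut.le) ht) _)

/-- Along a chain of points in `[s,t]`, the `ℓ^p` sum of `controlSumLeft` over intervals on which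
each first control has at most the fraction `Lδ` of its size on `[s,t]` decays like a power of
`δ`, provided that all exponents add up to more than `1/p`. -/
theorem exists_sum_controlSumLeft_rpow_le {n : ℕ} (a b : Fin n → ℝ) (ha : ∀ i, 0 < a i)
    (hb : ∀ i, 0 < b i) {p : ℝ} (hp : 1 ≤ p) (hab : ∀ i, 1 / p < a i + b i) {L : ℝ} (hL : 0 ≤ L) :
    ∃ θ : ℝ, 0 < θ ∧ ∃ K : ℝ, 0 < K ∧
    ∀ (T : ℝ) (w₁ w₂ : Fin n → ℝ → ℝ → ℝ), (∀ i, IsControl T (w₁ i)) → (∀ i, IsControl T (w₂ i)) →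
    ∀ (s t : ℝ), 0 ≤ s → s ≤ t → t ≤ T →
    ∀ (x : ℕ → ℝ) (S : Finset ℕ) (δ : ℝ), Monotone x → (∀ k, s ≤ x k) → (∀ k, x k ≤ t) → 0 ≤ δ →
      (∀ i, ∀ k ∈ S, leftValue (w₁ i) (x k) (x (k + 1)) ≤ L * δ * leftValue (w₁ i) s t) →
      ∑ k ∈ S, controlSumLeft w₁ w₂ a b (x k) (x (k + 1)) ^ p
        ≤ (K * δ ^ θ * controlSumLeft w₁ w₂ a b s t) ^ p := by
  have hp0 : 0 < p := by linarith
  have hpab : ∀ i, 0 < p * (a i + b i) - 1 := fun i => by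
    have := hab i; rw [div_lt_iff₀ hp0] at this; linarith
  obtain ⟨θ, hθ, hθle⟩ := exists_pos_forall_le (fun i => min (p * a i) (p * (a i + b i) - 1))
    fun i => lt_min (mul_pos hp0 (ha i)) (hpab i)
  -- the factor `(n + 1) ^ (p - 1)` comes from the power mean inequality for a sum of `n` terms
  set K : ℝ := ((n + 1 : ℝ) ^ (p - 1) * (L ^ θ + 1)) ^ (1 / p) with hKdef
  have hKp : K ^ p = (n + 1 : ℝ) ^ (p - 1) * (L ^ θ + 1) := by
    rw [hKdef, ← Real.rpow_mul (by positivity), one_div_mul_cancel hp0.ne', Real.rpow_one]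
  refine ⟨θ / p, by positivity, K, by positivity, ?_⟩
  intro T w₁ w₂ h₁ h₂ s t hs hst ht x S δ hx hxs hxt hδ hsmall
  have hxk : ∀ k, x k ≤ x (k + 1) := fun k => hx (Nat.le_succ k)
  have hx0 : ∀ k, 0 ≤ x k := fun k => hs.trans (hxs k)
  have hxT : ∀ k, x k ≤ T := fun k => (hxt k).trans ht
  set c : Fin n → ℝ := fun i => leftValue (w₁ i) s t ^ a i * w₂ i s t ^ b i
  have hc0 : ∀ i, 0 ≤ c i := fun i => mul_nonneg
    (Real.rpow_nonneg (leftValue_nonneg (h₁ i) hs hst ht) _)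
    (Real.rpow_nonneg ((h₂ i).nonneg s t hs hst ht) _)
  set d : ℕ → Fin n → ℝ := fun k i =>
    leftValue (w₁ i) (x k) (x (k + 1)) ^ a i * w₂ i (x k) (x (k + 1)) ^ b i
  have hl0 : ∀ k i, 0 ≤ leftValue (w₁ i) (x k) (x (k + 1)) := fun k i =>
    leftValue_nonneg (h₁ i) (hx0 k) (hxk k) (hxT _)
  have hw0 : ∀ k i, 0 ≤ w₂ i (x k) (x (k + 1)) := fun k i =>
    (h₂ i).nonneg _ _ (hx0 k) (hxk k) (hxT _)
  have hd0 : ∀ k i, 0 ≤ d k i := fun k i => mul_nonneg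
    (Real.rpow_nonneg (hl0 k i) _) (Real.rpow_nonneg (hw0 k i) _)
  have hpow : ∀ y z u v : ℝ, 0 ≤ y → 0 ≤ z → (y ^ u * z ^ v) ^ p = y ^ (p * u) * z ^ (p * v) :=
    fun y z u v hy hz => by
      rw [Real.mul_rpow (Real.rpow_nonneg hy _) (Real.rpow_nonneg hz _), ← Real.rpow_mul hy,
        ← Real.rpow_mul hz, mul_comm u, mul_comm v]
  have hi : ∀ i, ∑ k ∈ S, d k i ^ p ≤ (L * δ) ^ θ * c i ^ p := fun i => by
    have e1 : ∀ k, d k i ^ p = leftValue (w₁ i) (x k) (x (k + 1)) ^ (p * a i)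
        * w₂ i (x k) (x (k + 1)) ^ (p * b i) := fun k => hpow _ _ _ _ (hl0 k i) (hw0 k i)
    have e2 : c i ^ p = leftValue (w₁ i) s t ^ (p * a i) * w₂ i s t ^ (p * b i) :=
      hpow _ _ _ _ (leftValue_nonneg (h₁ i) hs hst ht) ((h₂ i).nonneg s t hs hst ht)
    simp_rw [e1, e2]
    refine sum_rpow_mul_rpow_le_of_le_mul (fun k _ => hl0 k i) (fun k _ => hw0 k i) ?_ ?_
      (by positivity) (fun k hk => hsmall i k hk) (mul_pos hp0 (hb i)).le hθ
      ((hθle i).trans (min_le_left _ _)) ((hθle i).trans (min_le_right _ _) |>.trans_eq (by ring))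
    · exact sum_le_of_superadd (fun _ _ => leftValue_nonneg (h₁ i))
        (fun _ _ _ => leftValue_superadd (h₁ i)) hs ht hx hxs hxt S
    · exact sum_le_of_superadd (h₂ i).nonneg (h₂ i).superadd hs ht hx hxs hxt S
  have hn : ((Finset.univ : Finset (Fin n)).card : ℝ) ^ (p - 1) ≤ (n + 1 : ℝ) ^ (p - 1) := by
    rw [Finset.card_univ, Fintype.card_fin]
    exact Real.rpow_le_rpow (by positivity) (by linarith) (by linarith)
  have hctot : ∑ i, c i ^ p ≤ (∑ i, c i) ^ p := by
    have : ∀ U : Finset (Fin n), ∑ i ∈ U, c i ^ p ≤ (∑ i ∈ U, c i) ^ p := fun U => by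
      induction U using Finset.induction_on with
      | empty => simp [Real.zero_rpow hp0.ne']
      | insert i U hiU ih =>
        rw [Finset.sum_insert hiU, Finset.sum_insert hiU]
        exact (add_le_add_right ih _).trans
          (Real.add_rpow_le_rpow_add (hc0 i) (Finset.sum_nonneg fun i _ => hc0 i) hp)
    exact this Finset.univ
  calc ∑ k ∈ S, controlSumLeft w₁ w₂ a b (x k) (x (k + 1)) ^ p
      ≤ ∑ k ∈ S, (n + 1 : ℝ) ^ (p - 1) * ∑ i, d k i ^ p := Finset.sum_le_sum fun k _ => by
        refine (Real.rpow_sum_le_const_mul_sum_rpow_of_nonneg (f := d k) Finset.univ hp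
          fun i _ => hd0 k i).trans ?_
        exact mul_le_mul_of_nonneg_right hn
          (Finset.sum_nonneg fun i _ => Real.rpow_nonneg (hd0 k i) _)
    _ = (n + 1 : ℝ) ^ (p - 1) * ∑ i, ∑ k ∈ S, d k i ^ p := by
        rw [← Finset.mul_sum, Finset.sum_comm]
    _ ≤ (n + 1 : ℝ) ^ (p - 1) * ∑ i, (L * δ) ^ θ * c i ^ p := by
        gcongr with i; exact hi i
    _ = (n + 1 : ℝ) ^ (p - 1) * (L ^ θ * δ ^ θ * ∑ i, c i ^ p) := by
        rw [← Finset.mul_sum, Real.mul_rpow hL hδ]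
    _ ≤ (n + 1 : ℝ) ^ (p - 1) * ((L ^ θ + 1) * δ ^ θ * (∑ i, c i) ^ p) := by
        have : 0 ≤ ∑ i, c i ^ p := Finset.sum_nonneg fun i _ => Real.rpow_nonneg (hc0 i) _
        gcongr
        linarith
    _ = _ := by
        have hcs : 0 ≤ ∑ i, c i := Finset.sum_nonneg fun i _ => hc0 i
        rw [show controlSumLeft w₁ w₂ a b s t = ∑ i, c i from rfl,
          Real.mul_rpow (by positivity) hcs, Real.mul_rpow (by positivity) (by positivity), hKp,
          ← Real.rpow_mul hδ, div_mul_cancel₀ _ hp0.ne']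
        ring

/-- What the sewing argument needs to know about the two-point bounds `A`, `B`, `Γ`: they are
monotone, and on each `[s,t]` some left control `W`, of size at most `L`, measures the fineness of a
chain in such a way that the `ℓ¹` sum of `A`, the `ℓ²` sum of `B` and the `ℓ^q` sum of `Γ` over
intervals with `W ≤ Lδ` are at most a multiple of `δ ^ η`. -/
structure IsGauge (q T L K η : ℝ) (A B Γ : ℝ → ℝ → ℝ) : Prop where
  A_nonneg : ∀ {s t}, 0 ≤ s → s ≤ t → t ≤ T → 0 ≤ A s t
  B_nonneg : ∀ {s t}, 0 ≤ s → s ≤ t → t ≤ T → 0 ≤ B s t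
  Γ_nonneg : ∀ {s t}, 0 ≤ s → s ≤ t → t ≤ T → 0 ≤ Γ s t
  A_mono : ∀ {s u v t}, 0 ≤ s → s ≤ u → u ≤ v → v ≤ t → t ≤ T → A u v ≤ A s t
  B_mono : ∀ {s u v t}, 0 ≤ s → s ≤ u → u ≤ v → v ≤ t → t ≤ T → B u v ≤ B s t
  exists_control : ∀ s t, 0 ≤ s → s < t → t ≤ T → ∃ W, IsLeftControl T W ∧ W s t ≤ L ∧
    (∀ u v, s ≤ u → u ≤ v → v ≤ t → v - u ≤ (t - s) * W u v) ∧
    ∀ (x : ℕ → ℝ) (S : Finset ℕ) (δ : ℝ), Monotone x → (∀ k, s ≤ x k) → (∀ k, x k ≤ t) →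
      0 ≤ δ → δ ≤ 1 → (∀ k ∈ S, W (x k) (x (k + 1)) ≤ L * δ) →
      ∑ k ∈ S, A (x k) (x (k + 1)) ≤ K * δ ^ η * A s t ∧
      √(∑ k ∈ S, B (x k) (x (k + 1)) ^ 2) ≤ K * δ ^ η * B s t ∧
      (∑ k ∈ S, Γ (x k) (x (k + 1)) ^ q) ^ (1 / q) ≤ K * δ ^ η * Γ s t

/-- The normalized sum of the first controls is the left control which witnesses `IsGauge`. -/
theorem exists_isGauge {q : ℝ} (hq : 2 ≤ q) {N M R : ℕ}
    {α₁ α₂ : Fin N → ℝ} {β₁ β₂ : Fin M → ℝ} {γ₁ γ₂ : Fin R → ℝ}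
    (hα₁ : ∀ i, 0 < α₁ i) (hα₂ : ∀ i, 0 < α₂ i) (hα : ∀ i, 1 < α₁ i + α₂ i)
    (hβ₁ : ∀ j, 0 < β₁ j) (hβ₂ : ∀ j, 0 < β₂ j) (hβ : ∀ j, 1 / 2 < β₁ j + β₂ j)
    (hγ₁ : ∀ k, 0 < γ₁ k) (hγ₂ : ∀ k, 0 < γ₂ k) (hγ : ∀ k, 1 / q < γ₁ k + γ₂ k) :
    ∃ L : ℝ, 0 < L ∧ ∃ η : ℝ, 0 < η ∧ ∃ K : ℝ, 0 < K ∧ ∀ (T : ℝ)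
      (w₁ w₂ : Fin N → ℝ → ℝ → ℝ) (wb₁ wb₂ : Fin M → ℝ → ℝ → ℝ) (wh₁ wh₂ : Fin R → ℝ → ℝ → ℝ),
      (∀ i, IsControl T (w₁ i) ∧ RightContFst T (w₁ i)) → (∀ i, IsControl T (w₂ i)) →
      (∀ j, IsControl T (wb₁ j) ∧ RightContFst T (wb₁ j)) → (∀ j, IsControl T (wb₂ j)) →
      (∀ k, IsControl T (wh₁ k) ∧ RightContFst T (wh₁ k)) → (∀ k, IsControl T (wh₂ k)) →
      IsGauge q T L K η (controlSumLeft w₁ w₂ α₁ α₂) (controlSumLeft wb₁ wb₂ β₁ β₂)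
        (controlSumLeft wh₁ wh₂ γ₁ γ₂) := by
  have hq0 : 0 < q := by linarith
  set L : ℝ := 1 + N + M + R with hLdef
  have hL : 0 < L := by positivity
  obtain ⟨θ₁, hθ₁, K₁, hK₁, H₁⟩ := exists_sum_controlSumLeft_rpow_le α₁ α₂ hα₁ hα₂ (p := 1) le_rfl
    (by simpa using hα) hL.le
  obtain ⟨θ₂, hθ₂, K₂, hK₂, H₂⟩ := exists_sum_controlSumLeft_rpow_le β₁ β₂ hβ₁ hβ₂ (p := 2)
    (by norm_num) hβ hL.le
  obtain ⟨θ₃, hθ₃, K₃, hK₃, H₃⟩ := exists_sum_controlSumLeft_rpow_le γ₁ γ₂ hγ₁ hγ₂ (p := q)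
    (by linarith) hγ hL.le
  set η := min θ₁ (min θ₂ θ₃) with hη
  have hη₁ : η ≤ θ₁ := min_le_left _ _
  have hη₂ : η ≤ θ₂ := (min_le_right _ _).trans (min_le_left _ _)
  have hη₃ : η ≤ θ₃ := (min_le_right _ _).trans (min_le_right _ _)
  have hη0 : 0 < η := lt_min hθ₁ (lt_min hθ₂ hθ₃)
  refine ⟨L, hL, η, hη0, K₁ + K₂ + K₃, by positivity, ?_⟩
  intro T w₁ w₂ wb₁ wb₂ wh₁ wh₂ h₁ h₂ hb₁ hb₂ hh₁ hh₂
  refine ⟨fun hs hst ht => controlSumLeft_nonneg (fun i => (h₁ i).1) h₂ hs hst ht,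
    fun hs hst ht => controlSumLeft_nonneg (fun i => (hb₁ i).1) hb₂ hs hst ht,
    fun hs hst ht => controlSumLeft_nonneg (fun i => (hh₁ i).1) hh₂ hs hst ht,
    fun hs hsu huv hvt ht =>
      controlSumLeft_mono (fun i => (h₁ i).1) h₂ hα₁ hα₂ hs hsu huv hvt ht,
    fun hs hsu huv hvt ht =>
      controlSumLeft_mono (fun i => (hb₁ i).1) hb₂ hβ₁ hβ₂ hs hsu huv hvt ht, ?_⟩
  intro s t hs hst ht
  have hA := controlSumLeft_nonneg (a := α₁) (b := α₂) (fun i => (h₁ i).1) h₂ hs hst.le ht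
  have hB := controlSumLeft_nonneg (a := β₁) (b := β₂) (fun i => (hb₁ i).1) hb₂ hs hst.le ht
  have hΓ := controlSumLeft_nonneg (a := γ₁) (b := γ₂) (fun i => (hh₁ i).1) hh₂ hs hst.le ht
  -- the inverse below is zero for a control without mass on `[s,t]`
  let V : ∀ {n : ℕ}, (Fin n → ℝ → ℝ → ℝ) → ℝ → ℝ → ℝ := fun w u v =>
    ∑ i, (leftValue (w i) s t)⁻¹ * leftValue (w i) u v
  have hV : ∀ {n : ℕ} (w : Fin n → ℝ → ℝ → ℝ), (∀ i, IsControl T (w i) ∧ RightContFst T (w i)) →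
      IsLeftControl T (V w) ∧ V w s t ≤ n ∧
      ∀ i u v, s ≤ u → u ≤ v → v ≤ t →
        leftValue (w i) u v ≤ V w u v * leftValue (w i) s t := by
    intro n w hw
    have hst0 : ∀ i, 0 ≤ leftValue (w i) s t := fun i => leftValue_nonneg (hw i).1 hs hst.le ht
    refine ⟨IsLeftControl.sum fun i _ =>
      (isLeftControl_leftValue (hw i).1 (hw i).2).const_mul (inv_nonneg.2 (hst0 i)), ?_, ?_⟩
    · refine (Finset.sum_le_card_nsmul _ _ 1 fun i _ => inv_mul_le_one).trans ?_
      simp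
    · intro i u v hsu huv hvt
      have hle : leftValue (w i) u v ≤ leftValue (w i) s t :=
        (isLeftControl_leftValue (hw i).1 (hw i).2).mono hs hsu huv hvt ht
      rcases eq_or_lt_of_le (hst0 i) with h | h
      · rw [← h, mul_zero]; exact hle.trans h.symm.le
      · have h3 : (leftValue (w i) s t)⁻¹ * leftValue (w i) u v ≤ V w u v :=
          Finset.single_le_sum (f := fun i => (leftValue (w i) s t)⁻¹ * leftValue (w i) u v)
            (fun j _ => mul_nonneg (inv_nonneg.2 (hst0 j))
              (leftValue_nonneg (hw j).1 (hs.trans hsu) huv (hvt.trans ht))) (Finset.mem_univ i)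
        calc leftValue (w i) u v
            = (leftValue (w i) s t)⁻¹ * leftValue (w i) u v * leftValue (w i) s t := by field_simp
          _ ≤ _ := mul_le_mul_of_nonneg_right h3 h.le
  obtain ⟨hV₁, hV₁L, hV₁r⟩ := hV w₁ h₁
  obtain ⟨hV₂, hV₂L, hV₂r⟩ := hV wb₁ hb₁
  obtain ⟨hV₃, hV₃L, hV₃r⟩ := hV wh₁ hh₁
  have hts : 0 < t - s := sub_pos.2 hst
  have hlen := (IsLeftControl.length (T := T)).const_mul (inv_nonneg.2 hts.le)
  refine ⟨fun u v => (t - s)⁻¹ * (v - u) + V w₁ u v + V wb₁ u v + V wh₁ u v,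
    ((hlen.add hV₁).add hV₂).add hV₃, ?_, ?_, ?_⟩
  · dsimp only
    rw [inv_mul_cancel₀ hts.ne', hLdef]
    linarith
  · intro u v hsu huv hvt
    have n1 := hV₁.nonneg u v (hs.trans hsu) huv (hvt.trans ht)
    have n2 := hV₂.nonneg u v (hs.trans hsu) huv (hvt.trans ht)
    have n3 := hV₃.nonneg u v (hs.trans hsu) huv (hvt.trans ht)
    have e : v - u = (t - s) * ((t - s)⁻¹ * (v - u)) := by field_simp
    have : (t - s) * ((t - s)⁻¹ * (v - u))
        ≤ (t - s) * ((t - s)⁻¹ * (v - u) + V w₁ u v + V wb₁ u v + V wh₁ u v) :=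
      mul_le_mul_of_nonneg_left (by linarith) hts.le
    linarith
  · intro x S δ hx hxs hxt hδ hδ1 hS
    have hxk : ∀ k, x k ≤ x (k + 1) := fun k => hx (Nat.le_succ k)
    have n0 : ∀ k, 0 ≤ (t - s)⁻¹ * (x (k + 1) - x k) := fun k =>
      mul_nonneg (inv_nonneg.2 hts.le) (sub_nonneg.2 (hxk k))
    have n1 : ∀ k, 0 ≤ V w₁ (x k) (x (k + 1)) := fun k =>
      hV₁.nonneg _ _ (hs.trans (hxs k)) (hxk k) ((hxt _).trans ht)
    have n2 : ∀ k, 0 ≤ V wb₁ (x k) (x (k + 1)) := fun k =>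
      hV₂.nonneg _ _ (hs.trans (hxs k)) (hxk k) ((hxt _).trans ht)
    have n3 : ∀ k, 0 ≤ V wh₁ (x k) (x (k + 1)) := fun k =>
      hV₃.nonneg _ _ (hs.trans (hxs k)) (hxk k) ((hxt _).trans ht)
    have hpw : ∀ {θ k c : ℝ}, η ≤ θ → 0 < k → k ≤ K₁ + K₂ + K₃ → 0 ≤ c →
        k * δ ^ θ * c ≤ (K₁ + K₂ + K₃) * δ ^ η * c := fun {θ k c} hθ hk hkK hc => by
      have : δ ^ θ ≤ δ ^ η := Real.rpow_le_rpow_of_exponent_ge' hδ hδ1 hη0.le hθ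
      gcongr
    refine ⟨?_, ?_, ?_⟩
    · have h := H₁ T w₁ w₂ (fun i => (h₁ i).1) h₂ s t hs hst.le ht x S δ hx hxs hxt hδ
        fun i k hk => (hV₁r i _ _ (hxs k) (hxk k) (hxt _)).trans
          (mul_le_mul_of_nonneg_right (by linarith [hS k hk, n0 k, n1 k, n2 k, n3 k])
            (leftValue_nonneg (h₁ i).1 hs hst.le ht))
      simp only [Real.rpow_one] at h
      exact h.trans (hpw hη₁ hK₁ (by linarith) hA)
    · have h := H₂ T wb₁ wb₂ (fun i => (hb₁ i).1) hb₂ s t hs hst.le ht x S δ hx hxs hxt hδ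
        fun i k hk => (hV₂r i _ _ (hxs k) (hxk k) (hxt _)).trans
          (mul_le_mul_of_nonneg_right (by linarith [hS k hk, n0 k, n1 k, n2 k, n3 k])
            (leftValue_nonneg (hb₁ i).1 hs hst.le ht))
      simp only [Real.rpow_two] at h
      refine le_trans ?_ (hpw hη₂ hK₂ (by linarith) hB)
      rw [← Real.sqrt_sq (show 0 ≤ K₂ * δ ^ θ₂ * controlSumLeft wb₁ wb₂ β₁ β₂ s t by positivity)]
      exact Real.sqrt_le_sqrt h
    · have h := H₃ T wh₁ wh₂ (fun i => (hh₁ i).1) hh₂ s t hs hst.le ht x S δ hx hxs hxt hδ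
        fun i k hk => (hV₃r i _ _ (hxs k) (hxk k) (hxt _)).trans
          (mul_le_mul_of_nonneg_right (by linarith [hS k hk, n0 k, n1 k, n2 k, n3 k])
            (leftValue_nonneg (hh₁ i).1 hs hst.le ht))
      refine le_trans ?_ (hpw hη₃ hK₃ (by linarith) hΓ)
      have h0 : 0 ≤ K₃ * δ ^ θ₃ * controlSumLeft wh₁ wh₂ γ₁ γ₂ s t := by positivity
      rw [one_div]
      refine (Real.rpow_inv_le_iff_of_pos (Finset.sum_nonneg fun k _ => ?_) h0 hq0).2 h
      exact Real.rpow_nonneg (controlSumLeft_nonneg (fun i => (hh₁ i).1) hh₂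
        (hs.trans (hxs k)) (hxk k) ((hxt _).trans ht)) _

/-! ### Partitions and refining chains -/

section Intervals

theorem mem_intervals {P : Finset ℝ} {u v : ℝ} :
    (u, v) ∈ intervals P ↔ u ∈ P ∧ v ∈ P ∧ u < v ∧ ∀ x ∈ P, x ≤ u ∨ v ≤ x := by
  simp [intervals, and_assoc]

/-- The intervals of a partition which is enumerated with repetitions. -/
theorem intervals_image_range {x : ℕ → ℝ} (hx : Monotone x) (n : ℕ) :
    intervals ((Finset.range (n + 1)).image x)
      = ((Finset.range n).filter fun k => x k < x (k + 1)).image fun k => (x k, x (k + 1)) := by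
  ext ⟨u, v⟩
  rw [mem_intervals]
  simp only [Finset.mem_image, Finset.mem_range, Finset.mem_filter, Prod.mk.injEq]
  constructor
  · rintro ⟨⟨i, hi, rfl⟩, ⟨j', hj', rfl⟩, huv, hsep⟩
    have hex : ∃ j, x i < x j := ⟨j', huv⟩
    classical
    set j := Nat.find hex with hj
    have hj1 : x i < x j := Nat.find_spec hex
    have hjle : j ≤ j' := Nat.find_min' hex huv
    have hij : i < j := by
      by_contra h
      exact absurd (hx (not_lt.1 h)) (not_le.2 hj1)
    obtain ⟨k, hk⟩ : ∃ k, j = k + 1 := ⟨j - 1, by omega⟩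
    have hk1 : x k ≤ x i := by
      by_contra h
      have := Nat.find_min' hex (not_le.1 h)
      omega
    have hk2 : x i ≤ x k := hx (by omega)
    have hk3 : x k = x i := le_antisymm hk1 hk2
    rw [hk] at hj1
    have hv : x (k + 1) = x j' := by
      refine le_antisymm (hx (by omega)) ?_
      rcases hsep (x (k + 1)) ⟨k + 1, by omega, rfl⟩ with h | h
      · exact absurd h (not_le.2 hj1)
      · exact h
    exact ⟨k, ⟨by omega, by rw [hk3]; exact hj1⟩, hk3, hv⟩
  · rintro ⟨k, ⟨hk, hlt⟩, rfl, rfl⟩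
    refine ⟨⟨k, by omega, rfl⟩, ⟨k + 1, by omega, rfl⟩, hlt, ?_⟩
    rintro _ ⟨j, _, rfl⟩
    rcases Nat.lt_or_ge k j with h | h
    · exact Or.inr (hx h)
    · exact Or.inl (hx h)

/-- Sums over the intervals of a partition, in terms of an enumeration with repetitions. -/
theorem sum_intervals_image_range {M : Type*} [AddCommMonoid M] {x : ℕ → ℝ} (hx : Monotone x)
    (n : ℕ) {f : ℝ × ℝ → M} (hf : ∀ k < n, f (x k, x k) = 0) :
    ∑ p ∈ intervals ((Finset.range (n + 1)).image x), f p
      = ∑ k ∈ Finset.range n, f (x k, x (k + 1)) := by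
  rw [intervals_image_range hx, Finset.sum_image, Finset.sum_filter]
  · refine Finset.sum_congr rfl fun k hk => ?_
    split_ifs with h
    · rfl
    · have : x (k + 1) = x k := le_antisymm (not_lt.1 h) (hx (Nat.le_succ k))
      rw [this, hf k (Finset.mem_range.1 hk)]
  · intro i hi j hj hij
    simp only [Finset.coe_filter, Finset.mem_range, Set.mem_ofPred_eq] at hi hj
    simp only [Prod.mk.injEq] at hij
    by_contra hne
    rcases Nat.lt_or_gt_of_ne hne with h | h
    · have := hx (Nat.succ_le_of_lt h); have := hi.2; simp only [Nat.succ_eq_add_one] at *; linarith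
    · have := hx (Nat.succ_le_of_lt h); have := hj.2; simp only [Nat.succ_eq_add_one] at *; linarith

theorem exists_monotone_image_range_eq (P : Finset ℝ) (hP : P.Nonempty) :
    ∃ (n : ℕ) (x : ℕ → ℝ), Monotone x ∧ (∀ k, n ≤ k → x k = x n) ∧
      (Finset.range (n + 1)).image x = P := by
  induction P using Finset.induction_on_max with
  | empty => simp at hP
  | insert b P hb ih =>
    rcases P.eq_empty_or_nonempty with rfl | hne
    · exact ⟨0, fun _ => b, monotone_const, fun _ _ => rfl, by simp⟩
    · obtain ⟨n, x, hx, hconst, himg⟩ := ih hne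
      have hxb : ∀ k ≤ n, x k < b := fun k hk => hb _ (by
        rw [← himg]; exact Finset.mem_image_of_mem _ (Finset.mem_range.2 (by omega)))
      refine ⟨n + 1, fun k => if k ≤ n then x k else b, ?_, ?_, ?_⟩
      · intro i j hij
        dsimp only
        split_ifs with h1 h2
        · exact hx hij
        · exact (hxb i h1).le
        · omega
        · exact le_rfl
      · intro k hk
        simp only [if_neg (show ¬ k ≤ n by omega), if_neg (show ¬ n + 1 ≤ n by omega)]
      · rw [Finset.range_add_one, Finset.image_insert, if_neg (by omega)]
        congr 1
        rw [← himg]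
        refine Finset.image_congr fun k hk => ?_
        have := Finset.mem_range.1 (Finset.mem_coe.1 hk)
        exact if_pos (by omega)

/-- Every partition of `[s,t]` can be enumerated by a monotone sequence. -/
theorem StochSewing.IsPartition.exists_chain {P : Finset ℝ} {s t : ℝ} (hP : IsPartition P s t) :
    ∃ (n : ℕ) (x : ℕ → ℝ), Monotone x ∧ x 0 = s ∧ (∀ k, n ≤ k → x k = t) ∧
      (Finset.range (n + 1)).image x = P := by
  obtain ⟨hs, ht, hst⟩ := hP
  obtain ⟨n, x, hx, hconst, himg⟩ := exists_monotone_image_range_eq P ⟨s, hs⟩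
  have hmem : ∀ k ≤ n, x k ∈ P := fun k hk => by
    rw [← himg]; exact Finset.mem_image_of_mem _ (Finset.mem_range.2 (by omega))
  refine ⟨n, x, hx, ?_, ?_, himg⟩
  · rw [← himg] at hs
    obtain ⟨j, _, rfl⟩ := Finset.mem_image.1 hs
    exact le_antisymm (hx (Nat.zero_le j)) (hst _ (hmem 0 (Nat.zero_le n))).1
  · intro k hk
    rw [hconst k hk]
    rw [← himg] at ht
    obtain ⟨j, hj, rfl⟩ := Finset.mem_image.1 ht
    have := Finset.mem_range.1 hj
    exact le_antisymm (hst _ (hmem n le_rfl)).2 (hx (by omega))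

theorem dist_le_mesh {P : Finset ℝ} {u v : ℝ} (h : (u, v) ∈ intervals P) : v - u ≤ mesh P := by
  have h1 : nndist u v ≤ mesh P := Finset.le_sup (f := fun p : ℝ × ℝ => nndist p.1 p.2) h
  have h2 : (nndist u v : ℝ) ≤ mesh P := h1
  rw [coe_nndist, Real.dist_eq, abs_sub_comm] at h2
  exact (le_abs_self _).trans h2

theorem mesh_le {P : Finset ℝ} {d : ℝ≥0} (h : ∀ u v, (u, v) ∈ intervals P → v - u ≤ d) :
    mesh P ≤ d := by
  refine Finset.sup_le fun p hp => ?_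
  obtain ⟨u, v⟩ := p
  have h1 := h u v hp
  have h2 := (mem_intervals.1 hp).2.2.1
  rw [← NNReal.coe_le_coe, coe_nndist, Real.dist_eq, abs_sub_comm, abs_of_pos (by linarith)]
  exact h1

theorem StochSewing.IsPartition.insert {P : Finset ℝ} {s t p : ℝ} (hP : IsPartition P s t)
    (hsp : s ≤ p) (hpt : p ≤ t) : IsPartition (insert p P) s t :=
  ⟨Finset.mem_insert_of_mem hP.1, Finset.mem_insert_of_mem hP.2.1, fun x hx => by
    rcases Finset.mem_insert.1 hx with rfl | h
    · exact ⟨hsp, hpt⟩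
    · exact hP.2.2 x h⟩

theorem mesh_insert_le {P : Finset ℝ} {s t p : ℝ} (hP : IsPartition P s t)
    (hsp : s ≤ p) (hpt : p ≤ t) : mesh (insert p P) ≤ mesh P := by
  refine mesh_le fun u v huv => ?_
  obtain ⟨hu, hv, hlt, hsep⟩ := mem_intervals.1 huv
  have hsu : s ≤ u := ((hP.insert hsp hpt).2.2 u hu).1
  have hvt : v ≤ t := ((hP.insert hsp hpt).2.2 v hv).2
  -- the largest point of `P` up to `u` and the smallest one from `v` on are consecutive in `P`
  obtain ⟨a, ha, hamax⟩ := (P.filter fun x => x ≤ u).exists_maximal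
    ⟨s, Finset.mem_filter.2 ⟨hP.1, hsu⟩⟩
  obtain ⟨b, hb, hbmin⟩ := (P.filter fun x => v ≤ x).exists_minimal
    ⟨t, Finset.mem_filter.2 ⟨hP.2.1, hvt⟩⟩
  rw [Finset.mem_filter] at ha hb
  have hab : (a, b) ∈ intervals P := by
    refine mem_intervals.2 ⟨ha.1, hb.1, by linarith [ha.2, hb.2], fun x hx => ?_⟩
    rcases hsep x (Finset.mem_insert_of_mem hx) with h | h
    · left
      rcases le_total x a with h' | h'
      · exact h'
      · exact hamax (Finset.mem_filter.2 ⟨hx, h⟩) h'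
    · right
      rcases le_total b x with h' | h'
      · exact h'
      · exact hbmin (Finset.mem_filter.2 ⟨hx, h⟩) h'
  linarith [dist_le_mesh hab, ha.2, hb.2]

/-- Inserting a point into a partition splits one of its intervals. -/
theorem exists_sum_intervals_insert {M : Type*} [AddCommGroup M] {P : Finset ℝ} {s t p : ℝ}
    (hP : IsPartition P s t) (hsp : s ≤ p) (hpt : p ≤ t) (hp : p ∉ P) :
    ∃ u v, (u, v) ∈ intervals P ∧ u < p ∧ p < v ∧ ∀ f : ℝ × ℝ → M,
      ∑ z ∈ intervals (insert p P), f z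
        = ∑ z ∈ intervals P, f z - (f (u, v) - f (u, p) - f (p, v)) := by
  have hne : ∀ x ∈ P, x ≠ p := fun x hx h => hp (h ▸ hx)
  have hsp' : s < p := lt_of_le_of_ne hsp (hne s hP.1)
  have hpt' : p < t := lt_of_le_of_ne hpt (hne t hP.2.1).symm
  obtain ⟨u, hu, humax⟩ := (P.filter fun x => x < p).exists_maximal
    ⟨s, Finset.mem_filter.2 ⟨hP.1, hsp'⟩⟩
  obtain ⟨v, hv, hvmin⟩ := (P.filter fun x => p < x).exists_minimal
    ⟨t, Finset.mem_filter.2 ⟨hP.2.1, hpt'⟩⟩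
  rw [Finset.mem_filter] at hu hv
  have hu' : ∀ x ∈ P, x < p → x ≤ u := fun x hx h => by
    rcases le_total x u with h' | h'
    · exact h'
    · exact humax (Finset.mem_filter.2 ⟨hx, h⟩) h'
  have hv' : ∀ x ∈ P, p < x → v ≤ x := fun x hx h => by
    rcases le_total v x with h' | h'
    · exact h'
    · exact hvmin (Finset.mem_filter.2 ⟨hx, h⟩) h'
  have huv : (u, v) ∈ intervals P := mem_intervals.2 ⟨hu.1, hv.1, hu.2.trans hv.2, fun x hx => by
    rcases lt_or_gt_of_ne (hne x hx) with h | h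
    · exact Or.inl (hu' x hx h)
    · exact Or.inr (hv' x hx h)⟩
  refine ⟨u, v, huv, hu.2, hv.2, fun f => ?_⟩
  have hset : intervals (insert p P)
      = insert (u, p) (insert (p, v) ((intervals P).erase (u, v))) := by
    ext ⟨a, b⟩
    simp only [Finset.mem_insert, Finset.mem_erase, mem_intervals, Prod.mk.injEq, ne_eq]
    constructor
    · rintro ⟨ha, hb, hab, hsep⟩
      rcases ha with rfl | ha
      · rcases hb with rfl | hb
        · exact absurd hab (lt_irrefl _)
        · right; left
          refine ⟨rfl, le_antisymm ?_ (hv' b hb hab)⟩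
          rcases hsep v (Or.inr hv.1) with h | h
          · exact absurd h (not_le.2 hv.2)
          · exact h
      · rcases hb with rfl | hb
        · left
          refine ⟨le_antisymm (hu' a ha hab) ?_, rfl⟩
          rcases hsep u (Or.inr hu.1) with h | h
          · exact h
          · exact absurd h (not_le.2 hu.2)
        · right; right
          refine ⟨?_, ha, hb, hab, fun x hx => hsep x (Or.inr hx)⟩
          rintro ⟨rfl, rfl⟩
          rcases hsep p (Or.inl rfl) with h | h
          · exact absurd h (not_le.2 hu.2)
          · exact absurd h (not_le.2 hv.2)
    · rintro (⟨rfl, rfl⟩ | ⟨rfl, rfl⟩ | ⟨hne', ha, hb, hab, hsep⟩)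
      · refine ⟨Or.inr hu.1, Or.inl rfl, hu.2, ?_⟩
        rintro x (rfl | hx)
        · exact Or.inr le_rfl
        · rcases lt_or_gt_of_ne (hne x hx) with h | h
          · exact Or.inl (hu' x hx h)
          · exact Or.inr h.le
      · refine ⟨Or.inl rfl, Or.inr hv.1, hv.2, ?_⟩
        rintro x (rfl | hx)
        · exact Or.inl le_rfl
        · rcases lt_or_gt_of_ne (hne x hx) with h | h
          · exact Or.inl h.le
          · exact Or.inr (hv' x hx h)
      · refine ⟨Or.inr ha, Or.inr hb, hab, ?_⟩
        rintro x (rfl | hx)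
        · by_contra hcon
          push Not at hcon
          refine hne' ⟨le_antisymm (hu' a ha hcon.1) ?_, le_antisymm ?_ (hv' b hb hcon.2)⟩
          · rcases hsep u hu.1 with h | h
            · exact h
            · linarith [hu.2, hcon.2]
          · rcases hsep v hv.1 with h | h
            · linarith [hv.2, hcon.1]
            · exact h
        · exact hsep x hx
  have hp1 : (p, v) ∉ (intervals P).erase (u, v) := fun h =>
    hp (mem_intervals.1 (Finset.mem_of_mem_erase h)).1
  have hp2 : (u, p) ∉ insert (p, v) ((intervals P).erase (u, v)) := fun h => by
    rcases Finset.mem_insert.1 h with h | h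
    · exact hu.2.ne (Prod.mk.inj h).1
    · exact hp (mem_intervals.1 (Finset.mem_of_mem_erase h)).2.1
  rw [hset, Finset.sum_insert hp2, Finset.sum_insert hp1, ← Finset.add_sum_erase _ f huv]
  abel

end Intervals

section Chains

variable {T : ℝ} {W : ℝ → ℝ → ℝ}

/-- Halving a left control within a closed set `Q`: two points of `Q` that are consecutive in `Q`
or equal cut `[u,v]` into pieces, the outer two of which carry at most half of `W(u,v)`. -/
theorem IsLeftControl.exists_split (hW : IsLeftControl T W) {Q : Set ℝ} (hQ : IsClosed Q)
    {u v : ℝ} (hu : u ∈ Q) (hv : v ∈ Q) (hu0 : 0 ≤ u) (huv : u ≤ v) (hvT : v ≤ T) :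
    ∃ m₁ m₂, m₁ ∈ Q ∧ m₂ ∈ Q ∧ u ≤ m₁ ∧ m₁ ≤ m₂ ∧ m₂ ≤ v ∧ W u m₁ ≤ W u v / 2 ∧
      W m₂ v ≤ W u v / 2 ∧ ∀ y ∈ Q, ¬ (m₁ < y ∧ y < m₂) := by
  have h0 : 0 ≤ W u v := hW.nonneg u v hu0 huv hvT
  -- `m₁` is the last point of `Q` before which at most half of `W` has accumulated; left-continuity
  -- in the second argument shows that it has this property itself
  set S : Set ℝ := {x | x ∈ Q ∧ u ≤ x ∧ x ≤ v ∧ W u x ≤ W u v / 2} with hS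
  have huS : u ∈ S := ⟨hu, le_rfl, huv, by rw [hW.self hu0 (huv.trans hvT)]; linarith⟩
  have hSb : BddAbove S := ⟨v, fun x hx => hx.2.2.1⟩
  set m₁ := sSup S with hm₁
  have hum : u ≤ m₁ := le_csSup hSb huS
  have hmv : m₁ ≤ v := csSup_le ⟨u, huS⟩ fun x hx => hx.2.2.1
  have hmS : m₁ ∈ S := by
    by_contra hcon
    have hlt : u < m₁ := lt_of_le_of_ne hum fun h => hcon (h ▸ huS)
    -- `m₁` is then approximated by points of `S` strictly to its left
    have hfreq : ∃ᶠ x in 𝓝[<] m₁, x ∈ S := by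
      have h1 := (isLUB_csSup ⟨u, huS⟩ hSb).frequently_mem ⟨u, huS⟩
      rw [frequently_nhdsWithin_iff] at h1 ⊢
      refine h1.mono fun x hx => ⟨hx.1, lt_of_le_of_ne hx.2 fun h : x = m₁ => hcon (h ▸ hx.1)⟩
    refine hcon ⟨hQ.mem_of_frequently_of_tendsto (hfreq.mono fun x hx => hx.1)
      (tendsto_id.mono_left nhdsWithin_le_nhds), hum, hmv, ?_⟩
    by_contra hgt
    have h2 := (hW.tendsto_left u m₁ hu0 hlt (hmv.trans hvT)).eventually
      (eventually_gt_nhds (not_le.1 hgt))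
    obtain ⟨x, hx, hx'⟩ := (hfreq.and_eventually h2).exists
    exact absurd hx.2.2.2 (not_le.2 hx')
  rcases eq_or_lt_of_le hmv with hmv' | hmv'
  · exact ⟨m₁, m₁, hmS.1, hmS.1, hum, le_rfl, hmv, hmS.2.2.2, by
      rw [hmv', hW.self (hu0.trans huv) hvT]; linarith, fun y _ h => absurd h.1 h.2.le.not_gt⟩
  -- `m₂` is the next point of `Q`, or equals `m₁` if there are points of `Q` arbitrarily close to the
  -- right of `m₁`; then right-continuity in the first argument is used
  set R : Set ℝ := {x | x ∈ Q ∧ m₁ < x ∧ x ≤ v} with hR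
  have hvR : v ∈ R := ⟨hv, hmv', le_rfl⟩
  have hRb : BddBelow R := ⟨m₁, fun x hx => hx.2.1.le⟩
  have hRhalf : ∀ x ∈ R, W x v ≤ W u v / 2 := fun x hx => by
    have hux : u ≤ x := hum.trans hx.2.1.le
    have h1 : W u v / 2 < W u x := by
      by_contra h
      exact absurd (le_csSup hSb (show x ∈ S from ⟨hx.1, hux, hx.2.2, not_lt.1 h⟩))
        (not_le.2 hx.2.1)
    linarith [hW.superadd u x v hu0 hux hx.2.2 hvT]
  set m₂ := sInf R with hm₂
  have hm12 : m₁ ≤ m₂ := le_csInf ⟨v, hvR⟩ fun x hx => hx.2.1.le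
  have hm2v : m₂ ≤ v := csInf_le hRb hvR
  have hm2Q : m₂ ∈ Q := by
    have h1 := (isGLB_csInf ⟨v, hvR⟩ hRb).frequently_mem ⟨v, hvR⟩
    exact hQ.mem_of_frequently_of_tendsto (h1.mono fun x hx => hx.1)
      (tendsto_id.mono_left nhdsWithin_le_nhds)
  refine ⟨m₁, m₂, hmS.1, hm2Q, hum, hm12, hm2v, hmS.2.2.2, ?_, fun y hy hym => ?_⟩
  · by_cases hmem : m₂ ∈ R
    · exact hRhalf _ hmem
    · have hlt : m₂ < v := lt_of_le_of_ne hm2v fun h => hmem (h ▸ hvR)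
      have hfreq : ∃ᶠ x in 𝓝[>] m₂, x ∈ R := by
        have h1 := (isGLB_csInf ⟨v, hvR⟩ hRb).frequently_mem ⟨v, hvR⟩
        rw [frequently_nhdsWithin_iff] at h1 ⊢
        exact h1.mono fun x hx => ⟨hx.1, lt_of_le_of_ne hx.2 fun h : m₂ = x => hmem (h ▸ hx.1)⟩
      by_contra hgt
      have h2 := (hW.tendsto_right m₂ v (hu0.trans (hum.trans hm12)) hlt hvT).eventually
        (eventually_gt_nhds (not_le.1 hgt))
      obtain ⟨x, hx, hx'⟩ := (hfreq.and_eventually h2).exists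
      exact absurd (hRhalf x hx) (not_le.2 hx')
  · exact absurd (csInf_le hRb (show y ∈ R from ⟨hy, hym.1, (hym.2.trans_le hm2v).le⟩))
      (not_le.2 hym.2)

/-- The chain with `3 ^ h` intervals obtained from `s, t` by inserting the points `m₁ u v` and
`m₂ u v` into each interval `[u,v]`, `h` times in a row. It is constant from the index `3 ^ h` on. -/
noncomputable def triChain (m₁ m₂ : ℝ → ℝ → ℝ) (s t : ℝ) : ℕ → ℕ → ℝ
  | 0, k => if k = 0 then s else t
  | h + 1, k =>
    if k % 3 = 0 then triChain m₁ m₂ s t h (k / 3)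
    else if k % 3 = 1 then
      m₁ (triChain m₁ m₂ s t h (k / 3)) (triChain m₁ m₂ s t h (k / 3 + 1))
    else m₂ (triChain m₁ m₂ s t h (k / 3)) (triChain m₁ m₂ s t h (k / 3 + 1))

/-- Successive refinements of `[s,t]` by points of a closed set `Q`. After `h` steps, each interval
either has no point of `Q` in its interior or carries at most `2 ^ (-h)` of the control. -/
structure IsRefiningChain (W : ℝ → ℝ → ℝ) (L : ℝ) (Q : Set ℝ) (s t : ℝ) (x : ℕ → ℕ → ℝ) :
    Prop where
  mono : ∀ h, Monotone (x h)
  mem : ∀ h k, x h k ∈ Q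
  left : ∀ h, x h 0 = s
  right : ∀ h k, 3 ^ h ≤ k → x h k = t
  refine_zero : ∀ h k, x (h + 1) (3 * k) = x h k
  dichotomy : ∀ h k, (∀ y ∈ Q, ¬ (x h k < y ∧ y < x h (k + 1))) ∨
    W (x h k) (x h (k + 1)) ≤ L * (1 / 2) ^ h
  middle : ∀ h k, ∀ y ∈ Q, ¬ (x (h + 1) (3 * k + 1) < y ∧ y < x (h + 1) (3 * k + 2))

/-- Repeated halving of a left control within a closed set. -/
theorem IsLeftControl.exists_isRefiningChain (hW : IsLeftControl T W) {Q : Set ℝ}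
    (hQ : IsClosed Q) {s t L : ℝ} (hs : 0 ≤ s) (hst : s ≤ t) (ht : t ≤ T) (hsQ : s ∈ Q)
    (htQ : t ∈ Q) (hQst : Q ⊆ Set.Icc s t) (hL : W s t ≤ L) :
    ∃ x, IsRefiningChain W L Q s t x := by
  have hsplit : ∀ u v, ∃ m₁ m₂, u ∈ Q → v ∈ Q → u ≤ v → m₁ ∈ Q ∧ m₂ ∈ Q ∧ u ≤ m₁ ∧ m₁ ≤ m₂ ∧
      m₂ ≤ v ∧ W u m₁ ≤ W u v / 2 ∧ W m₂ v ≤ W u v / 2 ∧ ∀ y ∈ Q, ¬ (m₁ < y ∧ y < m₂) := by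
    intro u v
    by_cases h : u ∈ Q ∧ v ∈ Q ∧ u ≤ v
    · obtain ⟨m₁, m₂, hm⟩ := hW.exists_split hQ h.1 h.2.1 (hs.trans (hQst h.1).1) h.2.2
        ((hQst h.2.1).2.trans ht)
      exact ⟨m₁, m₂, fun _ _ _ => hm⟩
    · exact ⟨0, 0, fun h1 h2 h3 => absurd ⟨h1, h2, h3⟩ h⟩
  choose m₁ m₂ hm using hsplit
  set x := triChain m₁ m₂ s t with hx
  have hx0 : ∀ h k, x (h + 1) (3 * k) = x h k := fun h k => by
    simp only [hx, triChain]
    rw [if_pos (by omega), show 3 * k / 3 = k by omega]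
  have hx1 : ∀ h k, x (h + 1) (3 * k + 1) = m₁ (x h k) (x h (k + 1)) := fun h k => by
    simp only [hx, triChain]
    rw [if_neg (by omega), if_pos (by omega), show (3 * k + 1) / 3 = k by omega]
  have hx2 : ∀ h k, x (h + 1) (3 * k + 2) = m₂ (x h k) (x h (k + 1)) := fun h k => by
    simp only [hx, triChain]
    rw [if_neg (by omega), if_neg (by omega), show (3 * k + 2) / 3 = k by omega]
  have hmod : ∀ k : ℕ, ∃ j, k = 3 * j ∨ k = 3 * j + 1 ∨ k = 3 * j + 2 := fun k =>
    ⟨k / 3, by omega⟩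
  have hbase : ∀ h, (∀ k, x h k ∈ Q) ∧ ∀ k, x h k ≤ x h (k + 1) := by
    intro h
    induction h with
    | zero =>
      refine ⟨fun k => ?_, fun k => ?_⟩
      · simp only [hx, triChain]; split_ifs <;> assumption
      · simp only [hx, triChain, if_neg (Nat.succ_ne_zero k)]
        split_ifs
        · exact hst
        · exact le_rfl
    | succ h ih =>
      have hh := fun k => hm (x h k) (x h (k + 1)) (ih.1 k) (ih.1 (k + 1)) (ih.2 k)
      refine ⟨fun k => ?_, fun k => ?_⟩
      · obtain ⟨j, rfl | rfl | rfl⟩ := hmod k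
        · rw [hx0]; exact ih.1 j
        · rw [hx1]; exact (hh j).1
        · rw [hx2]; exact (hh j).2.1
      · obtain ⟨j, rfl | rfl | rfl⟩ := hmod k
        · rw [hx0, hx1]; exact (hh j).2.2.1
        · rw [hx1, hx2]; exact (hh j).2.2.2.1
        · rw [hx2, show 3 * j + 2 + 1 = 3 * (j + 1) by ring, hx0]; exact (hh j).2.2.2.2.1
  have hh := fun h k => hm (x h k) (x h (k + 1)) ((hbase h).1 k) ((hbase h).1 (k + 1))
    ((hbase h).2 k)
  refine ⟨x, fun h => monotone_nat_of_le_succ (hbase h).2, fun h k => (hbase h).1 k, fun h => ?_,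
    fun h => ?_, hx0, fun h => ?_, fun h k => ?_⟩
  · induction h with
    | zero => simp [hx, triChain]
    | succ h ih => have := hx0 h 0; rw [mul_zero] at this; rw [this, ih]
  · induction h with
    | zero =>
      intro k hk
      simp only [hx, triChain]
      rw [if_neg (by simpa using Nat.one_le_iff_ne_zero.1 (by simpa using hk))]
    | succ h ih =>
      intro k hk
      have hk' : 3 ^ h * 3 ≤ k := by rwa [← pow_succ]
      have hmono : Monotone (x (h + 1)) := monotone_nat_of_le_succ (hbase (h + 1)).2
      refine le_antisymm (hQst ((hbase (h + 1)).1 k)).2 ?_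
      have h1 := hmono hk'
      rwa [mul_comm, hx0, ih _ le_rfl] at h1
  · induction h with
    | zero =>
      intro k
      right
      have h1 := hW.mono hs (hQst ((hbase 0).1 k)).1 ((hbase 0).2 k) (hQst ((hbase 0).1 (k + 1))).2
        ht
      simpa using h1.trans hL
    | succ h ih =>
      intro k
      have hstep : ∀ j u v, x h j ≤ u → v ≤ x h (j + 1) →
          (W u v ≤ W (x h j) (x h (j + 1)) / 2) →
          ((∀ y ∈ Q, ¬ (u < y ∧ y < v)) ∨ W u v ≤ L * (1 / 2) ^ (h + 1)) := by
        intro j u v hju hjv hhalf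
        rcases ih j with h1 | h1
        · exact Or.inl fun y hy hyy => h1 y hy ⟨hju.trans_lt hyy.1, hyy.2.trans_le hjv⟩
        · right; rw [pow_succ]; linarith
      obtain ⟨j, rfl | rfl | rfl⟩ := hmod k
      · rw [hx0, hx1]
        exact hstep j _ _ le_rfl ((hh h j).2.2.2.1.trans (hh h j).2.2.2.2.1) (hh h j).2.2.2.2.2.1
      · left
        rw [hx1, show 3 * j + 1 + 1 = 3 * j + 2 by ring, hx2]
        exact (hh h j).2.2.2.2.2.2.2
      · rw [hx2, show 3 * j + 2 + 1 = 3 * (j + 1) by ring, hx0]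
        exact hstep j _ _ ((hh h j).2.2.1.trans (hh h j).2.2.2.1) le_rfl (hh h j).2.2.2.2.2.2.1
  · rw [hx1, hx2]; exact (hh h k).2.2.2.2.2.2.2

end Chains

/-! ### Levels of a refining chain and the maximal estimate along a level -/

section Chains

variable {T L s t : ℝ} {W : ℝ → ℝ → ℝ} {Q : Set ℝ} {x : ℕ → ℕ → ℝ}

theorem sum_range_three_mul {M : Type*} [AddCommMonoid M] (f : ℕ → M) (n : ℕ) :
    ∑ k ∈ Finset.range (3 * n), f k
      = ∑ k ∈ Finset.range n, (f (3 * k) + f (3 * k + 1) + f (3 * k + 2)) := by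
  induction n with
  | zero => simp
  | succ n ih =>
    rw [Finset.sum_range_succ, ← ih, show 3 * (n + 1) = 3 * n + 1 + 1 + 1 by ring,
      Finset.sum_range_succ, Finset.sum_range_succ, Finset.sum_range_succ]
    simp only [add_assoc]

/-- The points of a chain at level `h`, as a finite set. -/
noncomputable def chainPoints (x : ℕ → ℕ → ℝ) (h : ℕ) : Finset ℝ :=
  (Finset.range (3 ^ h + 1)).image (x h)

namespace IsRefiningChain

theorem left_le (hx : IsRefiningChain W L Q s t x) (h k : ℕ) : s ≤ x h k := by
  rw [← hx.left h]; exact hx.mono h (Nat.zero_le k)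

theorem le_right (hx : IsRefiningChain W L Q s t x) (h k : ℕ) : x h k ≤ t := by
  rw [← hx.right h (max k (3 ^ h)) (le_max_right _ _)]; exact hx.mono h (le_max_left _ _)

theorem refine_three (hx : IsRefiningChain W L Q s t x) (h k : ℕ) :
    x (h + 1) (3 * k + 3) = x h (k + 1) := by
  rw [← hx.refine_zero h (k + 1), mul_add, mul_one]

theorem le_one (hx : IsRefiningChain W L Q s t x) (h k : ℕ) :
    x h k ≤ x (h + 1) (3 * k + 1) := by
  rw [← hx.refine_zero h k]; exact hx.mono _ (by omega)

theorem one_le_two (hx : IsRefiningChain W L Q s t x) (h k : ℕ) :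
    x (h + 1) (3 * k + 1) ≤ x (h + 1) (3 * k + 2) := hx.mono _ (by omega)

theorem two_le (hx : IsRefiningChain W L Q s t x) (h k : ℕ) :
    x (h + 1) (3 * k + 2) ≤ x h (k + 1) := by
  rw [← hx.refine_three h k]; exact hx.mono _ (by omega)

theorem isPartition (hx : IsRefiningChain W L Q s t x) (h : ℕ) :
    IsPartition (chainPoints x h) s t := by
  refine ⟨Finset.mem_image.2 ⟨0, Finset.mem_range.2 (Nat.succ_pos _), hx.left h⟩,
    Finset.mem_image.2 ⟨3 ^ h, Finset.mem_range.2 (by omega), hx.right h _ le_rfl⟩, ?_⟩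
  intro y hy
  obtain ⟨k, _, rfl⟩ := Finset.mem_image.1 hy
  exact ⟨hx.left_le h k, hx.le_right h k⟩

theorem chainPoints_subset (hx : IsRefiningChain W L Q s t x) (h : ℕ) :
    chainPoints x h ⊆ chainPoints x (h + 1) := by
  intro y hy
  obtain ⟨k, hk, rfl⟩ := Finset.mem_image.1 hy
  have := Finset.mem_range.1 hk
  refine Finset.mem_image.2 ⟨3 * k, Finset.mem_range.2 ?_, hx.refine_zero h k⟩
  rw [pow_succ]; omega

theorem chainPoints_zero (hx : IsRefiningChain W L Q s t x) : chainPoints x 0 = {s, t} := by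
  have h1 := hx.left 0
  have h2 := hx.right 0 1 (by simp)
  simp [chainPoints, Finset.range_add_one, h1, h2, Finset.pair_comm]

/-- For a finite set `Q` the refinement reaches `Q` after finitely many steps. -/
theorem exists_chainPoints_eq {P : Finset ℝ} (hP : IsPartition P s t)
    (hx : IsRefiningChain W L (P : Set ℝ) s t x)
    (hlen : ∀ u v, s ≤ u → u ≤ v → v ≤ t → v - u ≤ (t - s) * W u v) (hst : s ≤ t) :
    ∃ h, chainPoints x h = P := by
  -- `g` is the smallest distance between points of `P`
  obtain ⟨g, hg, hgap⟩ : ∃ g : ℝ, 0 < g ∧ ∀ u ∈ P, ∀ v ∈ P, u < v → g ≤ v - u := by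
    rcases (intervals P).eq_empty_or_nonempty with h | h
    · refine ⟨1, one_pos, fun u hu v hv huv => ?_⟩
      exfalso
      obtain ⟨b, hb, hbmin⟩ := (P.filter fun y => u < y).exists_minimal
        ⟨v, Finset.mem_filter.2 ⟨hv, huv⟩⟩
      rw [Finset.mem_filter] at hb
      have : (u, b) ∈ intervals P := mem_intervals.2 ⟨hu, hb.1, hb.2, fun y hy => by
        rcases le_or_gt y u with h' | h'
        · exact Or.inl h'
        · rcases le_total b y with h'' | h''
          · exact Or.inr h''
          · exact Or.inr (hbmin (Finset.mem_filter.2 ⟨hy, h'⟩) h'')⟩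
      rw [h] at this
      simp at this
    · obtain ⟨p, hp, hpmin⟩ := (intervals P).exists_min_image (fun p => p.2 - p.1) h
      refine ⟨p.2 - p.1, sub_pos.2 (mem_intervals.1 hp).2.2.1, fun u hu v hv huv => ?_⟩
      obtain ⟨b, hb, hbmin⟩ := (P.filter fun y => u < y).exists_minimal
        ⟨v, Finset.mem_filter.2 ⟨hv, huv⟩⟩
      rw [Finset.mem_filter] at hb
      have hub : (u, b) ∈ intervals P := mem_intervals.2 ⟨hu, hb.1, hb.2, fun y hy => by
        rcases le_or_gt y u with h' | h'
        · exact Or.inl h'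
        · rcases le_total b y with h'' | h''
          · exact Or.inr h''
          · exact Or.inr (hbmin (Finset.mem_filter.2 ⟨hy, h'⟩) h'')⟩
      have h1 := hpmin _ hub
      have h2 : b ≤ v := by
        rcases le_total b v with h' | h'
        · exact h'
        · exact hbmin (Finset.mem_filter.2 ⟨hv, huv⟩) h'
      dsimp only at h1
      linarith
  have htend : Tendsto (fun h : ℕ => (t - s) * (L * (1 / 2 : ℝ) ^ h)) atTop (𝓝 0) := by
    have := ((tendsto_pow_atTop_nhds_zero_of_lt_one (r := (1 / 2 : ℝ)) (by norm_num)
      (by norm_num)).const_mul L).const_mul (t - s)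
    simpa using this
  obtain ⟨h, hh⟩ := (htend.eventually (eventually_lt_nhds hg)).exists
  -- an interval of length less than `g` has no point of `P` in its interior
  have hinert : ∀ k, ∀ y ∈ (P : Set ℝ), ¬ (x h k < y ∧ y < x h (k + 1)) := fun k y hy hyk => by
    rcases hx.dichotomy h k with h1 | h1
    · exact h1 y hy hyk
    · have h2 := hlen _ _ (hx.left_le h k) (hx.mono h (Nat.le_succ k)) (hx.le_right h (k + 1))
      have h3 := hgap _ (hx.mem h k) y hy hyk.1
      have h4 := mul_le_mul_of_nonneg_left h1 (sub_nonneg.2 hst)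
      linarith [hyk.2]
  refine ⟨h, Finset.Subset.antisymm (fun y hy => ?_) fun y hy => ?_⟩
  · obtain ⟨k, _, rfl⟩ := Finset.mem_image.1 hy
    exact hx.mem h k
  · have hex : ∃ k, y ≤ x h k := ⟨3 ^ h, by rw [hx.right h _ le_rfl]; exact (hP.2.2 y hy).2⟩
    classical
    obtain ⟨k, hk, hkmin⟩ : ∃ k, y ≤ x h k ∧ ∀ j < k, x h j < y :=
      ⟨Nat.find hex, Nat.find_spec hex, fun j hj => not_le.1 (Nat.find_min hex hj)⟩
    have hkle : k ≤ 3 ^ h := by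
      by_contra hcon
      have := hkmin _ (not_le.1 hcon)
      rw [hx.right h _ le_rfl] at this
      exact absurd (hP.2.2 y hy).2 (not_le.2 this)
    refine Finset.mem_image.2 ⟨k, Finset.mem_range.2 (by omega), le_antisymm ?_ hk⟩
    rcases k with _ | k
    · rw [hx.left h]; exact (hP.2.2 y hy).1
    · by_contra hcon
      exact hinert k y hy ⟨hkmin k (Nat.lt_succ_self k), not_le.1 hcon⟩

theorem tendsto_mesh (hx : IsRefiningChain W L (Set.Icc s t) s t x)
    (hlen : ∀ u v, s ≤ u → u ≤ v → v ≤ t → v - u ≤ (t - s) * W u v) (hst : s ≤ t) :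
    Tendsto (fun h => mesh (chainPoints x h)) atTop (𝓝 0) := by
  have hle : ∀ h, (mesh (chainPoints x h) : ℝ) ≤ max ((t - s) * (L * (1 / 2 : ℝ) ^ h)) 0 := by
    intro h
    have h1 : mesh (chainPoints x h) ≤ ⟨max ((t - s) * (L * (1 / 2 : ℝ) ^ h)) 0, le_max_right _ _⟩ := by
      refine mesh_le fun u v huv => ?_
      rw [chainPoints, intervals_image_range (hx.mono h)] at huv
      obtain ⟨k, hk, hkuv⟩ := Finset.mem_image.1 huv
      obtain ⟨rfl, rfl⟩ := Prod.mk.inj hkuv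
      have hlt := (Finset.mem_filter.1 hk).2
      rcases hx.dichotomy h k with h1 | h1
      · obtain ⟨y, hy⟩ := exists_between hlt
        exact absurd hy (h1 y ⟨(hx.left_le h k).trans hy.1.le, hy.2.le.trans (hx.le_right h _)⟩)
      · have h2 := hlen _ _ (hx.left_le h k) hlt.le (hx.le_right h (k + 1))
        have h4 := mul_le_mul_of_nonneg_left h1 (sub_nonneg.2 hst)
        exact (h2.trans h4).trans (le_max_left _ _)
    exact_mod_cast h1
  have htend : Tendsto (fun h : ℕ => max ((t - s) * (L * (1 / 2 : ℝ) ^ h)) 0) atTop (𝓝 0) := by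
    have := (((tendsto_pow_atTop_nhds_zero_of_lt_one (r := (1 / 2 : ℝ)) (by norm_num)
      (by norm_num)).const_mul L).const_mul (t - s)).max (tendsto_const_nhds (x := (0 : ℝ)))
    simpa using this
  rw [← NNReal.tendsto_coe]
  exact squeeze_zero (fun h => (mesh (chainPoints x h)).2) hle htend

end IsRefiningChain

end Chains

section Germ

variable {Ω : Type*} {mΩ : MeasurableSpace Ω} {E : Type*} [NormedAddCommGroup E] [NormedSpace ℝ E]

/-- The constant `κ` is admissible in the `L^q(μ)` maximal estimate for sums of adapted `E`-valued
random variables. -/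
def IsMaximalConst (q : ℝ) (E : Type*) [NormedAddCommGroup E] [NormedSpace ℝ E] (κ : ℝ)
    {Ω : Type*} {mΩ : MeasurableSpace Ω} (μ : Measure Ω) : Prop :=
  ∀ (𝒢 : Filtration ℕ mΩ) (Z : ℕ → Ω → E) (a b : ℕ → ℝ) (n : ℕ),
    (∀ k < n, StronglyMeasurable[𝒢 (k + 1)] (Z k)) → (∀ k < n, 0 ≤ a k) → (∀ k < n, 0 ≤ b k) →
    (∀ k < n, eLpNorm (μ[Z k|𝒢 k]) (ENNReal.ofReal q) μ ≤ ENNReal.ofReal (a k)) →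
    (∀ k < n, eLpNorm (Z k) (ENNReal.ofReal q) μ ≤ ENNReal.ofReal (b k)) →
    eLpNorm (maxPartialSum Z n) (ENNReal.ofReal q) μ
      ≤ ENNReal.ofReal (∑ k ∈ Finset.range n, a k + κ * √(∑ k ∈ Finset.range n, b k ^ 2))

/-- The filtration sampled along a monotone sequence of times. -/
def sampledFiltration (ℱ : Filtration ℝ mΩ) {x : ℕ → ℝ} (hx : Monotone x) : Filtration ℕ mΩ where
  seq k := ℱ (x k)
  mono' _ _ h := ℱ.mono (hx h)
  le' k := ℱ.le (x k)

/-- The `ℓ²` norm of a sum, in terms of an `ℓ¹` norm and an `ℓ²` norm. -/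
theorem sqrt_sum_add_sq_le {ι : Type*} {S : Finset ι} {a b : ι → ℝ} (ha : ∀ k ∈ S, 0 ≤ a k) :
    √(∑ k ∈ S, (a k + b k) ^ 2) ≤ 2 * (∑ k ∈ S, a k + √(∑ k ∈ S, b k ^ 2)) := by
  have hA : 0 ≤ ∑ k ∈ S, a k := Finset.sum_nonneg ha
  have h1 : ∑ k ∈ S, a k ^ 2 ≤ (∑ k ∈ S, a k) ^ 2 := by
    rw [sq (∑ k ∈ S, a k), Finset.sum_mul]
    refine Finset.sum_le_sum fun k hk => ?_
    rw [sq]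
    exact mul_le_mul_of_nonneg_left (Finset.single_le_sum ha hk) (ha k hk)
  have hB : 0 ≤ ∑ k ∈ S, b k ^ 2 := Finset.sum_nonneg fun k _ => sq_nonneg _
  have h2 : ∑ k ∈ S, (a k + b k) ^ 2 ≤ 2 * ∑ k ∈ S, a k ^ 2 + 2 * ∑ k ∈ S, b k ^ 2 := by
    rw [Finset.mul_sum, Finset.mul_sum, ← Finset.sum_add_distrib]
    exact Finset.sum_le_sum fun k _ => by nlinarith [sq_nonneg (a k - b k)]
  rw [Real.sqrt_le_left (by positivity)]
  have h3 := Real.sq_sqrt hB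
  have h4 := Real.sqrt_nonneg (∑ k ∈ S, b k ^ 2)
  nlinarith [mul_nonneg hA h4]

variable {μ : Measure Ω} {q κ : ℝ} {ℱ : Filtration ℝ mΩ} [CompleteSpace E]

/-- The maximal estimate along a chain of times for variables which are bounded in terms of `A` and
`B` on the intervals with index in `S` and vanish on the others. -/
theorem IsMaximalConst.eLpNorm_maxPartialSum_le (hκ : IsMaximalConst q E κ μ) (hκ0 : 0 ≤ κ)
    {x : ℕ → ℝ} (hx : Monotone x) {n : ℕ} {S : Finset ℕ} (hS : S ⊆ Finset.range n)
    {Z : ℕ → Ω → E} {A B : ℕ → ℝ} {c ρA ρB : ℝ} (hc : 0 ≤ c)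
    (hA0 : ∀ k ∈ S, 0 ≤ A k) (hB0 : ∀ k ∈ S, 0 ≤ B k)
    (hZ : ∀ k < n, StronglyMeasurable[ℱ (x (k + 1))] (Z k))
    (hZA : ∀ k ∈ S, eLpNorm (μ[Z k|ℱ (x k)]) (ENNReal.ofReal q) μ ≤ ENNReal.ofReal (c * A k))
    (hZB : ∀ k ∈ S, eLpNorm (Z k) (ENNReal.ofReal q) μ ≤ ENNReal.ofReal (c * (A k + B k)))
    (hZ0 : ∀ k < n, k ∉ S → Z k =ᵐ[μ] 0)
    (hA : ∑ k ∈ S, A k ≤ ρA) (hB : √(∑ k ∈ S, B k ^ 2) ≤ ρB) :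
    eLpNorm (maxPartialSum Z n) (ENNReal.ofReal q) μ
      ≤ ENNReal.ofReal (c * (1 + 2 * κ) * (ρA + ρB)) := by
  classical
  have hAB0 : ∀ k ∈ S, 0 ≤ A k + B k := fun k hk => add_nonneg (hA0 k hk) (hB0 k hk)
  have h := hκ (sampledFiltration ℱ hx) Z (fun k => if k ∈ S then c * A k else 0)
    (fun k => if k ∈ S then c * (A k + B k) else 0) n hZ ?_ ?_ ?_ ?_
  · refine h.trans (ENNReal.ofReal_le_ofReal ?_)
    have e1 : ∑ k ∈ Finset.range n, (if k ∈ S then c * A k else 0) = c * ∑ k ∈ S, A k := by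
      rw [Finset.mul_sum, ← Finset.sum_filter]
      congr 1
      ext k
      simp only [Finset.mem_filter]
      exact ⟨fun h => h.2, fun h => ⟨hS h, h⟩⟩
    have e2 : ∑ k ∈ Finset.range n, (if k ∈ S then c * (A k + B k) else 0) ^ 2
        = c ^ 2 * ∑ k ∈ S, (A k + B k) ^ 2 := by
      rw [Finset.mul_sum]
      simp_rw [ite_pow, zero_pow two_ne_zero, mul_pow]
      rw [← Finset.sum_filter]
      congr 1
      ext k
      simp only [Finset.mem_filter]
      exact ⟨fun h => h.2, fun h => ⟨hS h, h⟩⟩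
    rw [e1, e2, Real.sqrt_mul (by positivity), Real.sqrt_sq hc]
    have h3 := sqrt_sum_add_sq_le (b := B) hA0
    have hB' : 0 ≤ ρB := (Real.sqrt_nonneg _).trans hB
    have h4 : c * (κ * √(∑ k ∈ S, (A k + B k) ^ 2)) ≤ c * (κ * (2 * (ρA + ρB))) := by
      gcongr
      exact h3.trans (by linarith)
    have h5 := mul_le_mul_of_nonneg_left hA hc
    have h6 := mul_nonneg hc hB'
    nlinarith
  · intro k _
    split_ifs with hk
    · exact mul_nonneg hc (hA0 k hk)
    · exact le_rfl
  · intro k _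
    split_ifs with hk
    · exact mul_nonneg hc (hAB0 k hk)
    · exact le_rfl
  · intro k hk
    split_ifs with hkS
    · exact hZA k hkS
    · have h1 : μ[Z k|ℱ (x k)] =ᵐ[μ] 0 := by
        have := condExp_congr_ae (m := ℱ (x k)) (hZ0 k hk hkS)
        rwa [condExp_zero] at this
      have : eLpNorm (μ[Z k|ℱ (x k)]) (ENNReal.ofReal q) μ = 0 := by
        rw [eLpNorm_congr_ae h1, eLpNorm_zero]
      exact this.le.trans (zero_le)
  · intro k hk
    split_ifs with hkS
    · exact hZB k hkS
    · rw [eLpNorm_congr_ae (hZ0 k hk hkS), eLpNorm_zero]; exact zero_le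

variable [IsFiniteMeasure μ]

/-- Conditioning on less information decreases the `L^q` norm of conditional means. -/
theorem eLpNorm_condExp_le_of_le {m m' : MeasurableSpace Ω} (hmm : m ≤ m') (hm' : m' ≤ mΩ)
    (hq : 2 ≤ q) {Z : Ω → E} (hZ : MemLp Z (ENNReal.ofReal q) μ) :
    eLpNorm (μ[Z|m]) (ENNReal.ofReal q) μ ≤ eLpNorm (μ[Z|m']) (ENNReal.ofReal q) μ := by
  rw [← eLpNorm_congr_ae (condExp_condExp_of_le hmm hm')]
  refine eLpNorm_condExp_le_of_memLp (hmm.trans hm') (by linarith) ⟨?_, ?_⟩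
  · exact (stronglyMeasurable_condExp.mono hm').aestronglyMeasurable
  · exact (eLpNorm_condExp_le_of_memLp hm' (by linarith) hZ).trans_lt hZ.2

theorem eLpNorm_condExp_sum_le {m : MeasurableSpace Ω} (hm : m ≤ mΩ) (hq : 2 ≤ q) {ι : Type*}
    (S : Finset ι) {Z : ι → Ω → E} {a : ι → ℝ} (hZ : ∀ k ∈ S, MemLp (Z k) (ENNReal.ofReal q) μ)
    (ha0 : ∀ k ∈ S, 0 ≤ a k)
    (ha : ∀ k ∈ S, eLpNorm (μ[Z k|m]) (ENNReal.ofReal q) μ ≤ ENNReal.ofReal (a k)) :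
    eLpNorm (μ[∑ k ∈ S, Z k|m]) (ENNReal.ofReal q) μ ≤ ENNReal.ofReal (∑ k ∈ S, a k) := by
  have hq1 := one_le_ofReal_of_two_le hq
  rw [eLpNorm_congr_ae (condExp_finsetSum (fun k hk => (hZ k hk).integrable hq1) m),
    ENNReal.ofReal_sum_of_nonneg ha0]
  refine (eLpNorm_sum_le (fun k _ => ?_) hq1).trans (Finset.sum_le_sum ha)
  exact (stronglyMeasurable_condExp.mono hm).aestronglyMeasurable

end Germ

/-! ### Sewing estimates for Riemann sums -/

/-- A refining chain of `[s,t]` along which the sums of `A`, `B` and `Γ` decay geometrically in the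
level. The set `S` omits only intervals without points of `Q` in their interior, on which `W` may
stay large. -/
theorem IsGauge.exists_chain {q T L K η : ℝ} {A B Γ : ℝ → ℝ → ℝ} (hG : IsGauge q T L K η A B Γ)
    {s t : ℝ} (hs : 0 ≤ s) (hst : s < t) (ht : t ≤ T) {Q : Set ℝ} (hQ : IsClosed Q) (hsQ : s ∈ Q)
    (htQ : t ∈ Q) (hQst : Q ⊆ Set.Icc s t) :
    ∃ W x, IsRefiningChain W L Q s t x ∧
      (∀ u v, s ≤ u → u ≤ v → v ≤ t → v - u ≤ (t - s) * W u v) ∧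
      ∀ h, ∃ S ⊆ Finset.range (3 ^ h),
        (∀ k, k < 3 ^ h → k ∉ S → ∀ y ∈ Q, ¬ (x h k < y ∧ y < x h (k + 1))) ∧
        ∑ k ∈ S, A (x h k) (x h (k + 1)) ≤ K * ((1 / 2) ^ η) ^ h * A s t ∧
        √(∑ k ∈ S, B (x h k) (x h (k + 1)) ^ 2) ≤ K * ((1 / 2) ^ η) ^ h * B s t ∧
        (∑ k ∈ S, Γ (x h k) (x h (k + 1)) ^ q) ^ (1 / q) ≤ K * ((1 / 2) ^ η) ^ h * Γ s t := by
  classical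
  obtain ⟨W, hW, hWL, hlen, hsum⟩ := hG.exists_control s t hs hst ht
  obtain ⟨x, hx⟩ := hW.exists_isRefiningChain hQ hs hst.le ht hsQ htQ hQst hWL
  refine ⟨W, x, hx, hlen, fun h => ?_⟩
  refine ⟨(Finset.range (3 ^ h)).filter fun k => W (x h k) (x h (k + 1)) ≤ L * (1 / 2) ^ h,
    Finset.filter_subset _ _, fun k hk hkS => ?_, ?_⟩
  · refine (hx.dichotomy h k).resolve_right fun hcon => hkS ?_
    exact Finset.mem_filter.2 ⟨Finset.mem_range.2 hk, hcon⟩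
  · have e : ((1 / 2 : ℝ) ^ η) ^ h = ((1 / 2) ^ h) ^ η := by
      rw [← Real.rpow_natCast, ← Real.rpow_mul (by norm_num), mul_comm,
        Real.rpow_mul (by norm_num), Real.rpow_natCast]
    rw [e]
    exact hsum (x h) _ ((1 / 2) ^ h) (hx.mono h) (hx.left_le h) (hx.le_right h) (by positivity)
      (pow_le_one₀ (by norm_num) (by norm_num)) fun k hk => (Finset.mem_filter.1 hk).2

section Germ

variable {Ω : Type*} {mΩ : MeasurableSpace Ω} {E : Type*} [NormedAddCommGroup E] [NormedSpace ℝ E]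

/-- The hypotheses of sewing, for times after `s₀`, in terms of a single measure `μ` and with
two-point bounds `A` and `B`. -/
structure IsLqGerm (q T s₀ : ℝ) (ℱ : Filtration ℝ mΩ) (μ : Measure Ω) (Ξ : ℝ → ℝ → Ω → E)
    (A B : ℝ → ℝ → ℝ) : Prop where
  adapted : ∀ {s t}, s₀ ≤ s → s ≤ t → t ≤ T → StronglyMeasurable[ℱ t] (Ξ s t)
  self : ∀ᵐ ω ∂μ, ∀ t, s₀ ≤ t → t ≤ T → Ξ t t ω = 0
  condExp_le : ∀ {s u t}, s₀ ≤ s → s ≤ u → u ≤ t → t ≤ T →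
    eLpNorm (μ[delta Ξ s u t|ℱ s]) (ENNReal.ofReal q) μ ≤ ENNReal.ofReal (A s t)
  norm_le : ∀ {s u t}, s₀ ≤ s → s ≤ u → u ≤ t → t ≤ T →
    eLpNorm (delta Ξ s u t) (ENNReal.ofReal q) μ ≤ ENNReal.ofReal (B s t)

/-- The difference between `Ξ_{u,v}` and its refinement by two points `m₁ ≤ m₂` of `[u,v]`. -/
def defect (Ξ : ℝ → ℝ → Ω → E) (u m₁ m₂ v : ℝ) : Ω → E := delta Ξ u m₁ v + delta Ξ m₁ m₂ v

omit [NormedSpace ℝ E] in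
theorem defect_apply (Ξ : ℝ → ℝ → Ω → E) (u m₁ m₂ v : ℝ) (ω : Ω) :
    defect Ξ u m₁ m₂ v ω = Ξ u v ω - (Ξ u m₁ ω + Ξ m₁ m₂ ω + Ξ m₂ v ω) := by
  simp only [defect, Pi.add_apply, delta]; abel

variable {q T s₀ : ℝ} {ℱ : Filtration ℝ mΩ} {μ : Measure Ω} {Ξ : ℝ → ℝ → Ω → E} {A B : ℝ → ℝ → ℝ}

omit [NormedSpace ℝ E] in
theorem delta_stronglyMeasurable {s u t : ℝ}
    (hΞ : ∀ {s t}, s₀ ≤ s → s ≤ t → t ≤ T → StronglyMeasurable[ℱ t] (Ξ s t))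
    (hs : s₀ ≤ s) (hsu : s ≤ u) (hut : u ≤ t) (ht : t ≤ T) :
    StronglyMeasurable[ℱ t] (delta Ξ s u t) :=
  ((hΞ hs (hsu.trans hut) ht).sub ((hΞ hs hsu (hut.trans ht)).mono (ℱ.mono hut))).sub
    (hΞ (hs.trans hsu) hut ht)

namespace IsLqGerm

theorem delta_memLp (hΞ : IsLqGerm q T s₀ ℱ μ Ξ A B) {s u t : ℝ} (hs : s₀ ≤ s) (hsu : s ≤ u)
    (hut : u ≤ t) (ht : t ≤ T) : MemLp (delta Ξ s u t) (ENNReal.ofReal q) μ :=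
  memLp_of_eLpNorm_le ((delta_stronglyMeasurable hΞ.adapted hs hsu hut ht).mono
    (ℱ.le t)).aestronglyMeasurable (hΞ.norm_le hs hsu hut ht)

/-- Inserting the end points of an interval changes nothing. -/
theorem defect_ae_eq_zero (hΞ : IsLqGerm q T s₀ ℱ μ Ξ A B) {u m₁ m₂ v : ℝ} (hu : s₀ ≤ u)
    (huv : u ≤ v) (hv : v ≤ T) (h₁ : m₁ = u ∨ m₁ = v) (h₂ : m₂ = u ∨ m₂ = v)
    (h₁₂ : m₁ ≤ m₂) : defect Ξ u m₁ m₂ v =ᵐ[μ] 0 := by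
  filter_upwards [hΞ.self] with ω hω
  have h3 := hω u hu (huv.trans hv)
  have h4 := hω v (hu.trans huv) hv
  rw [defect_apply, Pi.zero_apply]
  rcases h₁ with rfl | rfl <;> rcases h₂ with rfl | rfl <;> simp [h3, h4]
  obtain rfl := le_antisymm huv h₁₂
  simp [h3]

variable [CompleteSpace E] [IsFiniteMeasure μ]

theorem defect_bounds (hq : 2 ≤ q) (hΞ : IsLqGerm q T s₀ ℱ μ Ξ A B) {L K η : ℝ} {Γ : ℝ → ℝ → ℝ}
    (hG : IsGauge q T L K η A B Γ) (hs₀ : 0 ≤ s₀) {u m₁ m₂ v : ℝ} (hu : s₀ ≤ u) (h1 : u ≤ m₁)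
    (h2 : m₁ ≤ m₂) (h3 : m₂ ≤ v) (hv : v ≤ T) :
    StronglyMeasurable[ℱ v] (defect Ξ u m₁ m₂ v) ∧
    MemLp (defect Ξ u m₁ m₂ v) (ENNReal.ofReal q) μ ∧
    eLpNorm (μ[defect Ξ u m₁ m₂ v|ℱ u]) (ENNReal.ofReal q) μ ≤ ENNReal.ofReal (2 * A u v) ∧
    eLpNorm (defect Ξ u m₁ m₂ v) (ENNReal.ofReal q) μ ≤ ENNReal.ofReal (2 * (A u v + B u v)) := by
  have hq1 := one_le_ofReal_of_two_le hq
  have hu0 := hs₀.trans hu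
  have hm := hu.trans h1
  have m1 := hΞ.delta_memLp hu h1 (h2.trans h3) hv
  have m2 := hΞ.delta_memLp hm h2 h3 hv
  have hA0 := hG.A_nonneg hu0 (h1.trans (h2.trans h3)) hv
  have hB0 := hG.B_nonneg hu0 (h1.trans (h2.trans h3)) hv
  refine ⟨(delta_stronglyMeasurable hΞ.adapted hu h1 (h2.trans h3) hv).add
    (delta_stronglyMeasurable hΞ.adapted hm h2 h3 hv), m1.add m2, ?_, ?_⟩
  · rw [defect, eLpNorm_congr_ae (condExp_add (m1.integrable hq1) (m2.integrable hq1) (ℱ u))]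
    refine (eLpNorm_add_le (stronglyMeasurable_condExp.mono (ℱ.le u)).aestronglyMeasurable
      (stronglyMeasurable_condExp.mono (ℱ.le u)).aestronglyMeasurable hq1).trans ?_
    rw [two_mul, ENNReal.ofReal_add hA0 hA0]
    refine add_le_add (hΞ.condExp_le hu h1 (h2.trans h3) hv) ?_
    refine (eLpNorm_condExp_le_of_le (ℱ.mono h1) (ℱ.le _) hq m2).trans ?_
    exact (hΞ.condExp_le hm h2 h3 hv).trans
      (ENNReal.ofReal_le_ofReal (hG.A_mono hu0 h1 (h2.trans h3) le_rfl hv))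
  · refine (eLpNorm_add_le m1.1 m2.1 hq1).trans ?_
    refine le_trans (add_le_add (hΞ.norm_le hu h1 (h2.trans h3) hv)
      ((hΞ.norm_le hm h2 h3 hv).trans
        (ENNReal.ofReal_le_ofReal (hG.B_mono hu0 h1 (h2.trans h3) le_rfl hv)))) ?_
    rw [← ENNReal.ofReal_add hB0 hB0]
    exact ENNReal.ofReal_le_ofReal (by linarith)

end IsLqGerm

/-- The Riemann sum of `Ξ` along the chain `x h`. -/
def levelSum (Ξ : ℝ → ℝ → Ω → E) (x : ℕ → ℕ → ℝ) (h : ℕ) : Ω → E :=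
  ∑ k ∈ Finset.range (3 ^ h), Ξ (x h k) (x h (k + 1))

/-- The difference between two consecutive levels, restricted to the `k`-th interval. -/
def levelDefect (Ξ : ℝ → ℝ → Ω → E) (x : ℕ → ℕ → ℝ) (h k : ℕ) : Ω → E :=
  defect Ξ (x h k) (x (h + 1) (3 * k + 1)) (x (h + 1) (3 * k + 2)) (x h (k + 1))

section Levels

variable {W : ℝ → ℝ → ℝ} {L K η κ s t : ℝ} {Γ : ℝ → ℝ → ℝ} {Q : Set ℝ} {x : ℕ → ℕ → ℝ}

omit [NormedSpace ℝ E] in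
theorem IsRefiningChain.levelSum_sub (hx : IsRefiningChain W L Q s t x) (h : ℕ) :
    levelSum Ξ x h - levelSum Ξ x (h + 1) = ∑ k ∈ Finset.range (3 ^ h), levelDefect Ξ x h k := by
  have e : levelSum Ξ x (h + 1) = ∑ k ∈ Finset.range (3 * 3 ^ h),
      Ξ (x (h + 1) k) (x (h + 1) (k + 1)) := by rw [levelSum, pow_succ, mul_comm]
  rw [e, sum_range_three_mul, levelSum, ← Finset.sum_sub_distrib]
  refine Finset.sum_congr rfl fun k _ => ?_
  funext ω
  rw [levelDefect, defect_apply, hx.refine_zero, show 3 * k + 2 + 1 = 3 * k + 3 by ring,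
    hx.refine_three, show 3 * k + 1 + 1 = 3 * k + 2 by ring]
  simp

variable [CompleteSpace E] [IsFiniteMeasure μ]

omit [CompleteSpace E] [IsFiniteMeasure μ] in
theorem IsRefiningChain.levelDefect_ae_eq_zero (hx : IsRefiningChain W L Q s t x)
    (hΞ : IsLqGerm q T s₀ ℱ μ Ξ A B) (hs : s₀ ≤ s) (ht : t ≤ T) {h k : ℕ}
    (hk : ∀ y ∈ Q, ¬ (x h k < y ∧ y < x h (k + 1))) : levelDefect Ξ x h k =ᵐ[μ] 0 := by
  have h1 := hx.le_one h k
  have h2 := hx.one_le_two h k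
  have h3 := hx.two_le h k
  refine hΞ.defect_ae_eq_zero (hs.trans (hx.left_le h k)) (h1.trans (h2.trans h3))
    ((hx.le_right h _).trans ht) ?_ ?_ h2
  · by_contra hcon
    push Not at hcon
    exact hk _ (hx.mem (h + 1) (3 * k + 1)) ⟨lt_of_le_of_ne h1 (Ne.symm hcon.1),
      lt_of_le_of_ne (h2.trans h3) hcon.2⟩
  · by_contra hcon
    push Not at hcon
    exact hk _ (hx.mem (h + 1) (3 * k + 2)) ⟨lt_of_le_of_ne (h1.trans h2) (Ne.symm hcon.1),
      lt_of_le_of_ne h3 hcon.2⟩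

/-- Passing from one level of the chain to the next changes the Riemann sum by an amount which
decays geometrically in the level. -/
theorem IsRefiningChain.level_bounds (hx : IsRefiningChain W L Q s t x) (hq : 2 ≤ q)
    (hκ : IsMaximalConst q E κ μ) (hκ0 : 0 ≤ κ) (hΞ : IsLqGerm q T s₀ ℱ μ Ξ A B)
    (hG : IsGauge q T L K η A B Γ) (hs₀ : 0 ≤ s₀) (hs : s₀ ≤ s) (ht : t ≤ T) {h : ℕ}
    {S : Finset ℕ} (hS : S ⊆ Finset.range (3 ^ h))
    (hinert : ∀ k, k < 3 ^ h → k ∉ S → ∀ y ∈ Q, ¬ (x h k < y ∧ y < x h (k + 1))) {ρA ρB : ℝ}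
    (hA : ∑ k ∈ S, A (x h k) (x h (k + 1)) ≤ ρA)
    (hB : √(∑ k ∈ S, B (x h k) (x h (k + 1)) ^ 2) ≤ ρB) :
    eLpNorm (maxPartialSum (levelDefect Ξ x h) (3 ^ h)) (ENNReal.ofReal q) μ
      ≤ ENNReal.ofReal (2 * (1 + 2 * κ) * (ρA + ρB)) ∧
    MemLp (levelSum Ξ x h - levelSum Ξ x (h + 1)) (ENNReal.ofReal q) μ ∧
    eLpNorm (levelSum Ξ x h - levelSum Ξ x (h + 1)) (ENNReal.ofReal q) μ
      ≤ ENNReal.ofReal (2 * (1 + 2 * κ) * (ρA + ρB)) ∧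
    eLpNorm (μ[levelSum Ξ x h - levelSum Ξ x (h + 1)|ℱ s]) (ENNReal.ofReal q) μ
      ≤ ENNReal.ofReal (2 * ρA) := by
  have hb := fun k => hΞ.defect_bounds hq hG hs₀ (hs.trans (hx.left_le h k)) (hx.le_one h k)
    (hx.one_le_two h k) (hx.two_le h k) ((hx.le_right h (k + 1)).trans ht)
  have hz : ∀ k, k < 3 ^ h → k ∉ S → levelDefect Ξ x h k =ᵐ[μ] 0 := fun k hk hkS =>
    hx.levelDefect_ae_eq_zero hΞ hs ht (hinert k hk hkS)
  have hA0 : ∀ k, 0 ≤ A (x h k) (x h (k + 1)) := fun k =>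
    hG.A_nonneg (hs₀.trans (hs.trans (hx.left_le h k))) (hx.mono h (Nat.le_succ k))
      ((hx.le_right h _).trans ht)
  have hB0 : ∀ k, 0 ≤ B (x h k) (x h (k + 1)) := fun k =>
    hG.B_nonneg (hs₀.trans (hs.trans (hx.left_le h k))) (hx.mono h (Nat.le_succ k))
      ((hx.le_right h _).trans ht)
  have hmax := hκ.eLpNorm_maxPartialSum_le hκ0 (hx.mono h) hS (Z := levelDefect Ξ x h)
    (ℱ := ℱ) (c := 2) (by norm_num) (fun k _ => hA0 k) (fun k _ => hB0 k)
    (fun k _ => (hb k).1) (fun k _ => (hb k).2.2.1) (fun k _ => (hb k).2.2.2) hz hA hB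
  rw [hx.levelSum_sub]
  have hmem : MemLp (∑ k ∈ Finset.range (3 ^ h), levelDefect Ξ x h k) (ENNReal.ofReal q) μ :=
    memLp_finsetSum' _ fun k _ => (hb k).2.1
  refine ⟨hmax, hmem, ?_, ?_⟩
  · refine le_trans (eLpNorm_mono_enorm fun ω => ?_) hmax
    rw [enorm_eq_self, Finset.sum_apply]
    exact enorm_sum_le_maxPartialSum _ le_rfl ω
  -- only the intervals in `S` contribute, so that the sum of `A` over `S` suffices
  · have hae : (∑ k ∈ Finset.range (3 ^ h), levelDefect Ξ x h k)
        =ᵐ[μ] ∑ k ∈ S, levelDefect Ξ x h k := by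
      have : ∀ᵐ ω ∂μ, ∀ k, k < 3 ^ h → k ∉ S → levelDefect Ξ x h k ω = 0 := by
        refine ae_all_iff.2 fun k => ?_
        by_cases hk : k < 3 ^ h
        · by_cases hkS : k ∈ S
          · exact Eventually.of_forall fun ω _ hcon => absurd hkS hcon
          · filter_upwards [hz k hk hkS] with ω hω _ _ using hω
        · exact Eventually.of_forall fun ω hcon => absurd hcon hk
      filter_upwards [this] with ω hω
      rw [Finset.sum_apply, Finset.sum_apply]
      exact (Finset.sum_subset hS fun k hk hkS => hω k (Finset.mem_range.1 hk) hkS).symm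
    rw [eLpNorm_congr_ae (condExp_congr_ae hae)]
    refine (eLpNorm_condExp_sum_le (ℱ.le s) hq S (fun k _ => (hb k).2.1)
      (a := fun k => 2 * A (x h k) (x h (k + 1))) (fun k _ => mul_nonneg (by norm_num) (hA0 k))
      fun k _ => ?_).trans (ENNReal.ofReal_le_ofReal ?_)
    · exact (eLpNorm_condExp_le_of_le (ℱ.mono (hx.left_le h k)) (ℱ.le _) hq (hb k).2.1).trans
        (hb k).2.2.1
    · rw [← Finset.mul_sum]; linarith

/-- The constant in the sewing estimates for Riemann sums along arbitrary partitions. -/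
noncomputable def sewConst (κ K η : ℝ) : ℝ := 2 * (1 + 2 * κ) * K * (1 - (1 / 2) ^ η)⁻¹

theorem half_rpow_lt_one {η : ℝ} (hη : 0 < η) : (1 / 2 : ℝ) ^ η < 1 :=
  Real.rpow_lt_one (by norm_num) (by norm_num) hη

theorem sewConst_pos {κ K η : ℝ} (hκ : 0 ≤ κ) (hK : 0 < K) (hη : 0 < η) : 0 < sewConst κ K η := by
  have := half_rpow_lt_one hη
  have : 0 < (1 - (1 / 2 : ℝ) ^ η)⁻¹ := inv_pos.2 (by linarith)
  unfold sewConst; positivity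

omit [NormedSpace ℝ E] [CompleteSpace E] [IsFiniteMeasure μ] in
theorem levelSum_ae_eq_riemannSum (hx : IsRefiningChain W L Q s t x)
    (hΞ : ∀ᵐ ω ∂μ, ∀ t, s₀ ≤ t → t ≤ T → Ξ t t ω = 0) (hs : s₀ ≤ s) (ht : t ≤ T) (h : ℕ) :
    levelSum Ξ x h =ᵐ[μ] riemannSum Ξ (chainPoints x h) := by
  filter_upwards [hΞ] with ω hω
  rw [riemannSum, chainPoints, sum_intervals_image_range (hx.mono h) (3 ^ h)
    (f := fun p => Ξ p.1 p.2 ω)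
    (fun k _ => hω _ (hs.trans (hx.left_le h k)) ((hx.le_right h k).trans ht)), levelSum,
    Finset.sum_apply]

/-- Sewing estimates for Riemann sums along arbitrary partitions, with a uniform constant: the
points of the partition are inserted by successive halving of the control. -/
theorem IsLqGerm.riemannSum_bounds (hq : 2 ≤ q) (hκ : IsMaximalConst q E κ μ) (hκ0 : 0 ≤ κ)
    (hΞ : IsLqGerm q T s₀ ℱ μ Ξ A B) (hG : IsGauge q T L K η A B Γ) (hK : 0 < K) (hη : 0 < η)
    (hs₀ : 0 ≤ s₀) (hs : s₀ ≤ s) (hst : s < t) (ht : t ≤ T) {P : Finset ℝ}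
    (hP : IsPartition P s t) :
    MemLp (fun ω => riemannSum Ξ P ω - Ξ s t ω) (ENNReal.ofReal q) μ ∧
    eLpNorm (μ[fun ω => riemannSum Ξ P ω - Ξ s t ω|ℱ s]) (ENNReal.ofReal q) μ
      ≤ ENNReal.ofReal (sewConst κ K η * A s t) ∧
    eLpNorm (fun ω => riemannSum Ξ P ω - Ξ s t ω) (ENNReal.ofReal q) μ
      ≤ ENNReal.ofReal (sewConst κ K η * (A s t + B s t)) := by
  have hq1 := one_le_ofReal_of_two_le hq
  have hs0 := hs₀.trans hs
  have hA0 := hG.A_nonneg hs0 hst.le ht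
  have hB0 := hG.B_nonneg hs0 hst.le ht
  -- a chain within `P` itself, which reaches `P` at some level `H`
  obtain ⟨W, x, hx, hlen, hlev⟩ := hG.exists_chain hs0 hst ht P.finite_toSet.isClosed
    (Finset.mem_coe.2 hP.1) (Finset.mem_coe.2 hP.2.1) fun y hy => hP.2.2 y hy
  obtain ⟨H, hH⟩ := hx.exists_chainPoints_eq hP hlen hst.le
  set r : ℝ := (1 / 2) ^ η with hr
  have hr0 : 0 ≤ r := by positivity
  have hr1 : r < 1 := half_rpow_lt_one hη
  have hgeom : ∑ h ∈ Finset.range H, r ^ h ≤ (1 - r)⁻¹ := by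
    rw [← tsum_geometric_of_lt_one hr0 hr1]
    exact (summable_geometric_of_lt_one hr0 hr1).sum_le_tsum _ fun _ _ => by positivity
  have hb : ∀ h, MemLp (levelSum Ξ x h - levelSum Ξ x (h + 1)) (ENNReal.ofReal q) μ ∧
      eLpNorm (levelSum Ξ x h - levelSum Ξ x (h + 1)) (ENNReal.ofReal q) μ
        ≤ ENNReal.ofReal (2 * (1 + 2 * κ) * K * (A s t + B s t) * r ^ h) ∧
      eLpNorm (μ[levelSum Ξ x h - levelSum Ξ x (h + 1)|ℱ s]) (ENNReal.ofReal q) μ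
        ≤ ENNReal.ofReal (2 * K * A s t * r ^ h) := fun h => by
    obtain ⟨S, hS, hin, h1, h2, _⟩ := hlev h
    obtain ⟨_, h3, h4, h5⟩ := hx.level_bounds hq hκ hκ0 hΞ hG hs₀ hs ht hS hin h1 h2
    exact ⟨h3, h4.trans_eq (by congr 1; ring), h5.trans_eq (by congr 1; ring)⟩
  have hae : (fun ω => riemannSum Ξ P ω - Ξ s t ω)
      =ᵐ[μ] -∑ h ∈ Finset.range H, (levelSum Ξ x h - levelSum Ξ x (h + 1)) := by
    filter_upwards [levelSum_ae_eq_riemannSum hx hΞ.self hs ht H] with ω hω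
    rw [Finset.sum_range_sub', Pi.neg_apply, Pi.sub_apply, hω, hH, levelSum]
    simp [hx.left 0, hx.right 0 1]
  have hmem : MemLp (∑ h ∈ Finset.range H, (levelSum Ξ x h - levelSum Ξ x (h + 1)))
      (ENNReal.ofReal q) μ := memLp_finsetSum' _ fun h _ => (hb h).1
  refine ⟨(memLp_congr_ae hae).2 hmem.neg, ?_, ?_⟩
  · rw [eLpNorm_congr_ae (condExp_congr_ae hae), eLpNorm_congr_ae (condExp_neg _ _), eLpNorm_neg]
    refine (eLpNorm_condExp_sum_le (ℱ.le s) hq _ (fun h _ => (hb h).1)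
      (fun h _ => by positivity) fun h _ => (hb h).2.2).trans (ENNReal.ofReal_le_ofReal ?_)
    rw [← Finset.mul_sum]
    have h1 : 2 * K * A s t * ∑ h ∈ Finset.range H, r ^ h ≤ 2 * K * A s t * (1 - r)⁻¹ := by
      gcongr
    have h2 : 2 * K * A s t * (1 - r)⁻¹ * 1 ≤ 2 * K * A s t * (1 - r)⁻¹ * (1 + 2 * κ) := by
      have : 0 ≤ (1 - r)⁻¹ := inv_nonneg.2 (by linarith)
      gcongr
      linarith
    rw [sewConst, ← hr]
    linarith
  · rw [eLpNorm_congr_ae hae, eLpNorm_neg]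
    refine (eLpNorm_sum_le (fun h _ => (hb h).1.1) hq1).trans ?_
    refine (Finset.sum_le_sum fun h _ => (hb h).2.1).trans ?_
    rw [← ENNReal.ofReal_sum_of_nonneg fun h _ => by positivity, ← Finset.mul_sum]
    refine ENNReal.ofReal_le_ofReal ?_
    rw [sewConst, ← hr]
    calc 2 * (1 + 2 * κ) * K * (A s t + B s t) * ∑ h ∈ Finset.range H, r ^ h
        ≤ 2 * (1 + 2 * κ) * K * (A s t + B s t) * (1 - r)⁻¹ := by gcongr
      _ = _ := by ring

end Levels

end Germ

/-! ### Maximal estimate for one refinement step -/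

section Supremum

/-- For a right-continuous function, the supremum over an interval is a supremum over a countable
subset. -/
theorem iSup_Icc_eq_iSup_countable {a b : ℝ} (hab : a ≤ b) {f : ℝ → ℝ≥0∞}
    (hf : ∀ t, a ≤ t → t < b → Tendsto f (𝓝[>] t) (𝓝 (f t))) :
    ⨆ v ∈ Set.Icc a b, f v = (⨆ r : ℚ, ⨆ _ : a ≤ r ∧ (r : ℝ) ≤ b, f r) ⊔ f b := by
  refine le_antisymm (iSup₂_le fun v hv => ?_) (sup_le (iSup₂_le fun r hr => ?_) ?_)
  · rcases hv.2.eq_or_lt with rfl | hvb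
    · exact le_sup_right
    refine le_sup_of_le_left (le_of_tendsto_of_frequently (hf v hv.1 hvb) ?_)
    rw [frequently_nhdsWithin_iff]
    refine frequently_iff.2 fun {U} hU => ?_
    obtain ⟨ε, hε, hball⟩ := Metric.mem_nhds_iff.1 hU
    obtain ⟨r, hr1, hr2⟩ := exists_rat_btwn (lt_min hvb (lt_add_of_pos_right v hε))
    refine ⟨r, hball ?_, ?_, hr1⟩
    · rw [Metric.mem_ball, Real.dist_eq, abs_of_pos (by linarith)]
      linarith [hr2.trans_le (min_le_right _ _)]
    · exact le_iSup₂ (f := fun (r : ℚ) (_ : a ≤ r ∧ (r : ℝ) ≤ b) => f r) r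
        ⟨hv.1.trans hr1.le, (hr2.trans_le (min_le_left _ _)).le⟩
  · exact le_iSup₂ (f := fun (v : ℝ) (_ : v ∈ Set.Icc a b) => f v) _ ⟨hr.1, hr.2⟩
  · exact le_iSup₂ (f := fun (v : ℝ) (_ : v ∈ Set.Icc a b) => f v) b ⟨hab, le_rfl⟩

variable {Ω : Type*} {mΩ : MeasurableSpace Ω} {μ : Measure Ω}

theorem aemeasurable_iSup_Icc {a b : ℝ} (hab : a ≤ b) {f : ℝ → Ω → ℝ≥0∞}
    (hm : ∀ t, a ≤ t → t ≤ b → AEMeasurable (f t) μ)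
    (hf : ∀ᵐ ω ∂μ, ∀ t, a ≤ t → t < b → Tendsto (fun s => f s ω) (𝓝[>] t) (𝓝 (f t ω))) :
    AEMeasurable (fun ω => ⨆ v ∈ Set.Icc a b, f v ω) μ := by
  have h : AEMeasurable (fun ω =>
      (⨆ r : ℚ, ⨆ _ : a ≤ r ∧ (r : ℝ) ≤ b, f r ω) ⊔ f b ω) μ := by
    refine AEMeasurable.sup (AEMeasurable.iSup fun r => AEMeasurable.iSup fun hr => ?_)
      (hm b hab le_rfl)
    exact hm r hr.1 hr.2
  refine h.congr ?_
  filter_upwards [hf] with ω hω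
  exact (iSup_Icc_eq_iSup_countable hab hω).symm

/-- The `L^q` norm of a finite supremum is at most the `ℓ^q` norm of the `L^q` norms. -/
theorem eLpNorm_finset_sup_le {q : ℝ} (hq : 0 < q) {ι : Type*} (S : Finset ι)
    {V : ι → Ω → ℝ≥0∞} {b : ι → ℝ} (hV : ∀ k ∈ S, AEMeasurable (V k) μ) (hb : ∀ k ∈ S, 0 ≤ b k)
    (h : ∀ k ∈ S, eLpNorm (V k) (ENNReal.ofReal q) μ ≤ ENNReal.ofReal (b k)) :
    eLpNorm (fun ω => S.sup fun k => V k ω) (ENNReal.ofReal q) μ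
      ≤ ENNReal.ofReal ((∑ k ∈ S, b k ^ q) ^ (1 / q)) := by
  have hq0 : ENNReal.ofReal q ≠ 0 := by simpa using hq
  have e : ∀ f : Ω → ℝ≥0∞, eLpNorm f (ENNReal.ofReal q) μ = (∫⁻ ω, f ω ^ q ∂μ) ^ (1 / q) :=
    fun f => by
      rw [eLpNorm_eq_lintegral_rpow_enorm_toReal hq0 ENNReal.ofReal_ne_top,
        ENNReal.toReal_ofReal hq.le]
      simp only [enorm_eq_self]
  have hs : 0 ≤ ∑ k ∈ S, b k ^ q := Finset.sum_nonneg fun k hk => Real.rpow_nonneg (hb k hk) _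
  rw [e, ← ENNReal.ofReal_rpow_of_nonneg hs (by positivity)]
  refine ENNReal.rpow_le_rpow ?_ (by positivity)
  calc ∫⁻ ω, (S.sup fun k => V k ω) ^ q ∂μ ≤ ∫⁻ ω, ∑ k ∈ S, V k ω ^ q ∂μ := by
        refine lintegral_mono fun ω => ?_
        rcases S.eq_empty_or_nonempty with rfl | hS
        · simp [hq]
        obtain ⟨k, hk, hk'⟩ := Finset.exists_mem_eq_sup S hS fun k => V k ω
        rw [hk']
        exact Finset.single_le_sum (f := fun k => V k ω ^ q) (fun _ _ => zero_le) hk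
    _ = ∑ k ∈ S, ∫⁻ ω, V k ω ^ q ∂μ :=
        lintegral_finsetSum' _ fun k hk => (hV k hk).pow_const q
    _ ≤ ∑ k ∈ S, ENNReal.ofReal (b k ^ q) := by
        refine Finset.sum_le_sum fun k hk => ?_
        have h1 := h k hk
        rw [e, one_div, ENNReal.rpow_inv_le_iff hq] at h1
        exact h1.trans_eq (ENNReal.ofReal_rpow_of_nonneg (hb k hk) hq.le)
    _ = _ := (ENNReal.ofReal_sum_of_nonneg fun k hk => Real.rpow_nonneg (hb k hk) _).symm

end Supremum

section MaximalGerm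

variable {Ω : Type*} {mΩ : MeasurableSpace Ω} {E : Type*} [NormedAddCommGroup E] [NormedSpace ℝ E]
  {q T : ℝ} {μ : Measure Ω} {Ξ : ℝ → ℝ → Ω → E} {A B Γ : ℝ → ℝ → ℝ}
  {W : ℝ → ℝ → ℝ} {L K η κ : ℝ} {x : ℕ → ℕ → ℝ}

/-- The `L^q(μ)` maximal bound on the germ, with two-point bound `Γ`. -/
structure IsMaxGerm (q T : ℝ) (μ : Measure Ω) (Ξ : ℝ → ℝ → Ω → E) (Γ : ℝ → ℝ → ℝ) : Prop where
  aemeasurable : ∀ {s u t}, 0 ≤ s → s ≤ u → u ≤ t → t ≤ T →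
    AEMeasurable (fun ω => ⨆ v ∈ Set.Icc u t, ‖delta Ξ s u v ω‖ₑ) μ
  norm_le : ∀ {s u t}, 0 ≤ s → s ≤ u → u ≤ t → t ≤ T →
    eLpNorm (fun ω => ⨆ v ∈ Set.Icc u t, ‖delta Ξ s u v ω‖ₑ) (ENNReal.ofReal q) μ
      ≤ ENNReal.ofReal (Γ s t)

/-- The largest defect on the `k`-th interval of level `h`, when the interval is stopped at an
arbitrary time after the point by which it is refined. -/
noncomputable def stoppedDefect (Ξ : ℝ → ℝ → Ω → E) (x : ℕ → ℕ → ℝ) (h k : ℕ) (ω : Ω) : ℝ≥0∞ :=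
  ⨆ v ∈ Set.Icc (x (h + 1) (3 * k + 1)) (x h (k + 1)),
    ‖delta Ξ (x h k) (x (h + 1) (3 * k + 1)) v ω‖ₑ

/-- A bound, uniform in time, for the change from level `h` to level `h + 1`. -/
noncomputable def levelOsc (Ξ : ℝ → ℝ → Ω → E) (x : ℕ → ℕ → ℝ) (h : ℕ) (ω : Ω) : ℝ≥0∞ :=
  maxPartialSum (levelDefect Ξ x h) (3 ^ h) ω +
    (Finset.range (3 ^ h)).sup fun k => stoppedDefect Ξ x h k ω

omit [NormedSpace ℝ E] in
theorem stoppedSum_chainPoints {s t T : ℝ} {Q : Set ℝ} (hx : IsRefiningChain W L Q s t x) {ω : Ω}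
    (hs : 0 ≤ s) (ht : t ≤ T) (hω : ∀ t, 0 ≤ t → t ≤ T → Ξ t t ω = 0) (h : ℕ) {v : ℝ}
    (hv : 0 ≤ v) : stoppedSum Ξ (chainPoints x h) v ω
      = ∑ k ∈ Finset.range (3 ^ h), Ξ (min (x h k) v) (min (x h (k + 1)) v) ω := by
  rw [stoppedSum, chainPoints, sum_intervals_image_range (hx.mono h) (3 ^ h)
    (f := fun p => Ξ (min p.1 v) (min p.2 v) ω)]
  exact fun k _ => hω _ (le_min (hs.trans (hx.left_le h k)) hv)
    ((min_le_left _ _).trans ((hx.le_right h k).trans ht))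

/-- If all points of `[s,t]` are available, each refinement step inserts a single point. -/
theorem IsRefiningChain.one_eq_two {s t : ℝ} (hx : IsRefiningChain W L (Set.Icc s t) s t x)
    (h k : ℕ) : x (h + 1) (3 * k + 2) = x (h + 1) (3 * k + 1) := by
  by_contra hcon
  have h1 := lt_of_le_of_ne (hx.one_le_two h k) (Ne.symm hcon)
  have h2 := hx.left_le (h + 1) (3 * k + 1)
  have h3 := hx.le_right (h + 1) (3 * k + 2)
  exact hx.middle h k ((x (h + 1) (3 * k + 1) + x (h + 1) (3 * k + 2)) / 2)
    ⟨by linarith, by linarith⟩ ⟨by linarith, by linarith⟩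

omit [NormedSpace ℝ E] in
/-- Stopping at time `t` leaves the defects of the intervals before `t` unchanged, cuts one of them
off, and removes all later ones. -/
theorem IsRefiningChain.enorm_stoppedSum_sub_le
    (hx : IsRefiningChain W L (Set.Icc 0 T) 0 T x) {ω : Ω}
    (hω : ∀ t, 0 ≤ t → t ≤ T → Ξ t t ω = 0) (h : ℕ) {t : ℝ} (ht : t ∈ Set.Icc 0 T) :
    ‖stoppedSum Ξ (chainPoints x h) t ω - stoppedSum Ξ (chainPoints x (h + 1)) t ω‖ₑ
      ≤ levelOsc Ξ x h ω := by
  classical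
  set D : ℕ → E := fun k => delta Ξ (min (x h k) t) (min (x (h + 1) (3 * k + 1)) t)
    (min (x h (k + 1)) t) ω with hD
  have e : stoppedSum Ξ (chainPoints x h) t ω - stoppedSum Ξ (chainPoints x (h + 1)) t ω
      = ∑ k ∈ Finset.range (3 ^ h), D k := by
    rw [stoppedSum_chainPoints hx le_rfl le_rfl hω h ht.1,
      stoppedSum_chainPoints hx le_rfl le_rfl hω (h + 1) ht.1, pow_succ, mul_comm (3 ^ h) 3,
      sum_range_three_mul, ← Finset.sum_sub_distrib]
    refine Finset.sum_congr rfl fun k _ => ?_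
    rw [hx.refine_zero, show 3 * k + 2 + 1 = 3 * k + 3 by ring, hx.refine_three,
      show 3 * k + 1 + 1 = 3 * k + 2 by ring, hx.one_eq_two,
      hω (min (x (h + 1) (3 * k + 1)) t) (le_min (hx.left_le _ _) ht.1)
        ((min_le_right _ _).trans ht.2), hD]
    simp only [delta]
    abel
  -- the interval with index `n` is the one which is cut off at time `t`
  set n := Nat.findGreatest (fun n => x h n ≤ t) (3 ^ h) with hn
  have hn1 : x h n ≤ t := Nat.findGreatest_spec (P := fun n => x h n ≤ t) (Nat.zero_le _)
    (by rw [hx.left]; exact ht.1)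
  have hnle : n ≤ 3 ^ h := Nat.findGreatest_le _
  have hn2 : ∀ k, n < k → k ≤ 3 ^ h → t < x h k := fun k h1 h2 =>
    not_le.1 (Nat.findGreatest_is_greatest h1 h2)
  have hlt : ∀ k, k < n → D k = levelDefect Ξ x h k ω := fun k hk => by
    have h1 : x h (k + 1) ≤ t := (hx.mono h hk).trans hn1
    have h2 : x (h + 1) (3 * k + 1) ≤ x h (k + 1) := (hx.one_le_two h k).trans (hx.two_le h k)
    have h3 := hω (x (h + 1) (3 * k + 1)) (hx.left_le _ _) (hx.le_right _ _)
    have h4 := hx.le_one h k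
    rw [levelDefect, defect_apply, hx.one_eq_two, h3, hD]
    simp only [min_eq_left h1, min_eq_left (h2.trans h1), min_eq_left (h4.trans (h2.trans h1)),
      delta]
    abel
  have hgt : ∀ k, n < k → k < 3 ^ h → D k = 0 := fun k h1 h2 => by
    have h3 := (hn2 k h1 h2.le).le
    have h4 := hx.le_one h k
    have h5 : x (h + 1) (3 * k + 1) ≤ x h (k + 1) := (hx.one_le_two h k).trans (hx.two_le h k)
    simp only [hD, min_eq_right h3, min_eq_right (h3.trans h4), min_eq_right (h3.trans
      (h4.trans h5)), delta, hω t ht.1 ht.2, sub_zero]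
  have heq : n < 3 ^ h → ‖D n‖ₑ ≤ stoppedDefect Ξ x h n ω := fun h1 => by
    have h3 := (hn2 (n + 1) (Nat.lt_succ_self n) h1).le
    have h4 := hx.le_one h n
    simp only [hD, min_eq_left hn1, min_eq_right h3]
    rcases le_total t (x (h + 1) (3 * n + 1)) with h5 | h5
    · rw [min_eq_right h5, delta, hω t ht.1 ht.2]
      simp
    · rw [min_eq_left h5]
      exact le_iSup₂ (f := fun (v : ℝ) (_ : v ∈ Set.Icc (x (h + 1) (3 * n + 1)) (x h (n + 1))) =>
        ‖delta Ξ (x h n) (x (h + 1) (3 * n + 1)) v ω‖ₑ) t ⟨h5, h3⟩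
  rw [e, levelOsc]
  rcases hnle.eq_or_lt with h1 | h1
  · rw [← h1, Finset.sum_congr rfl fun k hk => hlt k (Finset.mem_range.1 hk)]
    exact (enorm_sum_le_maxPartialSum _ le_rfl ω).trans le_self_add
  · have : ∑ k ∈ Finset.range (3 ^ h), D k = ∑ k ∈ Finset.range (n + 1), D k := by
      refine (Finset.sum_subset (Finset.range_subset_range.2 h1) fun k hk hk' => ?_).symm
      refine hgt k ?_ (Finset.mem_range.1 hk)
      exact not_le.1 fun hcon => hk' (Finset.mem_range.2 (Nat.lt_succ_of_le hcon))
    rw [this, Finset.sum_range_succ, Finset.sum_congr rfl fun k hk => hlt k (Finset.mem_range.1 hk)]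
    refine (enorm_add_le _ _).trans (add_le_add (enorm_sum_le_maxPartialSum _ hnle ω)
      ((heq h1).trans ?_))
    exact Finset.le_sup (f := fun k => stoppedDefect Ξ x h k ω) (Finset.mem_range.2 h1)

variable [CompleteSpace E] [IsFiniteMeasure μ] {ℱ : Filtration ℝ mΩ}

omit [NormedSpace ℝ E] [CompleteSpace E] [IsFiniteMeasure μ] in
theorem IsRefiningChain.aemeasurable_levelOsc (hx : IsRefiningChain W L (Set.Icc 0 T) 0 T x)
    (hΞ : ∀ {s t}, 0 ≤ s → s ≤ t → t ≤ T → StronglyMeasurable[ℱ t] (Ξ s t))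
    (hmax : IsMaxGerm q T μ Ξ Γ) (h : ℕ) : AEMeasurable (levelOsc Ξ x h) μ := by
  refine AEMeasurable.add (aemeasurable_maxPartialSum fun k _ => ?_) ?_
  · have h1 := hx.left_le h k
    have h2 := hx.le_one h k
    have h3 := hx.one_le_two h k
    have h4 := hx.two_le h k
    have h5 := hx.le_right h (k + 1)
    exact (((delta_stronglyMeasurable hΞ h1 h2 (h3.trans h4) h5).add
      (delta_stronglyMeasurable hΞ (h1.trans h2) h3 h4 h5)).mono (ℱ.le _)).aestronglyMeasurable
  · have h : (fun ω => (Finset.range (3 ^ h)).sup fun k => stoppedDefect Ξ x h k ω)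
        = fun ω => ⨆ k ∈ Finset.range (3 ^ h), stoppedDefect Ξ x h k ω := by
      funext ω; rw [Finset.sup_eq_iSup]
    rw [h]
    refine AEMeasurable.iSup fun k => AEMeasurable.iSup fun _ => ?_
    exact hmax.aemeasurable (hx.left_le _ k) (hx.le_one _ k)
      ((hx.one_le_two _ k).trans (hx.two_le _ k)) (hx.le_right _ _)

/-- The constant in the maximal estimate for one refinement step. -/
noncomputable def oscConst (κ K : ℝ) : ℝ := (2 * (1 + 2 * κ) + 1) * K

/-- The change from one level to the next, uniformly in time: the partial sums of the defects are
bounded by the maximal inequality, and the largest stopped defect by the `ℓ^q` sum of `Γ`. -/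
theorem IsRefiningChain.eLpNorm_levelOsc_le (hx : IsRefiningChain W L (Set.Icc 0 T) 0 T x)
    (hq : 2 ≤ q) (hκ : IsMaximalConst q E κ μ) (hκ0 : 0 ≤ κ) (hΞ : IsLqGerm q T 0 ℱ μ Ξ A B)
    (hG : IsGauge q T L K η A B Γ) (hmax : IsMaxGerm q T μ Ξ Γ) {h : ℕ}
    {S : Finset ℕ} (hS : S ⊆ Finset.range (3 ^ h))
    (hinert : ∀ k, k < 3 ^ h → k ∉ S → ∀ y ∈ Set.Icc 0 T, ¬ (x h k < y ∧ y < x h (k + 1)))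
    {ρA ρB ρΓ : ℝ} (hA : ∑ k ∈ S, A (x h k) (x h (k + 1)) ≤ ρA)
    (hB : √(∑ k ∈ S, B (x h k) (x h (k + 1)) ^ 2) ≤ ρB)
    (hΓ : (∑ k ∈ S, Γ (x h k) (x h (k + 1)) ^ q) ^ (1 / q) ≤ ρΓ) :
    eLpNorm (levelOsc Ξ x h) (ENNReal.ofReal q) μ
      ≤ ENNReal.ofReal (2 * (1 + 2 * κ) * (ρA + ρB) + ρΓ) := by
  have hq1 := one_le_ofReal_of_two_le hq
  obtain ⟨h1, -⟩ := hx.level_bounds hq hκ hκ0 hΞ hG le_rfl le_rfl le_rfl hS hinert hA hB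
  have hA0 : 0 ≤ ρA := (Finset.sum_nonneg fun k _ => hG.A_nonneg (hx.left_le h k)
    (hx.mono h (Nat.le_succ k)) (hx.le_right h _)).trans hA
  have hB0 : 0 ≤ ρB := (Real.sqrt_nonneg _).trans hB
  have hΓ0 : ∀ k ∈ S, 0 ≤ Γ (x h k) (x h (k + 1)) := fun k _ => hG.Γ_nonneg (hx.left_le h k)
    (hx.mono h (Nat.le_succ k)) (hx.le_right h _)
  have hρ : 0 ≤ ρΓ := (Real.rpow_nonneg (Finset.sum_nonneg fun k hk =>
    Real.rpow_nonneg (hΓ0 k hk) _) _).trans hΓ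
  have hmeas : ∀ k, AEMeasurable (stoppedDefect Ξ x h k) μ := fun k =>
    hmax.aemeasurable (hx.left_le _ k) (hx.le_one _ k)
      ((hx.one_le_two _ k).trans (hx.two_le _ k)) (hx.le_right _ _)
  have hsupm : ∀ S : Finset ℕ, AEMeasurable (fun ω => S.sup fun k => stoppedDefect Ξ x h k ω) μ :=
    fun S => by
      have h : (fun ω => S.sup fun k => stoppedDefect Ξ x h k ω)
          = fun ω => ⨆ k ∈ S, stoppedDefect Ξ x h k ω := by
        funext ω; rw [Finset.sup_eq_iSup]
      rw [h]
      exact AEMeasurable.iSup fun k => AEMeasurable.iSup fun _ => hmeas k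
  have h2 : eLpNorm (fun ω => (Finset.range (3 ^ h)).sup fun k => stoppedDefect Ξ x h k ω)
      (ENNReal.ofReal q) μ ≤ ENNReal.ofReal ρΓ := by
    have hae : (fun ω => (Finset.range (3 ^ h)).sup fun k => stoppedDefect Ξ x h k ω)
        =ᵐ[μ] fun ω => S.sup fun k => stoppedDefect Ξ x h k ω := by
      filter_upwards [hΞ.self] with ω hω
      refine le_antisymm (Finset.sup_le fun k hk => ?_) (Finset.sup_mono hS)
      by_cases hkS : k ∈ S
      · exact Finset.le_sup (f := fun k => stoppedDefect Ξ x h k ω) hkS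
      -- an interval without interior points of `[0,T]` is degenerate
      have huv : x h k = x h (k + 1) := by
        by_contra hne
        have h3 := lt_of_le_of_ne (hx.mono h (Nat.le_succ k)) hne
        have h4 := hx.left_le h k
        have h5 := hx.le_right h (k + 1)
        exact hinert k (Finset.mem_range.1 hk) hkS ((x h k + x h (k + 1)) / 2)
          ⟨by linarith, by linarith⟩ ⟨by linarith, by linarith⟩
      have h3 := hx.le_one h k
      have h4 := (hx.one_le_two h k).trans (hx.two_le h k)
      have h5 : x (h + 1) (3 * k + 1) = x h k := le_antisymm (huv ▸ h4) h3
      refine (iSup₂_le fun v hv => ?_).trans zero_le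
      rw [h5, ← huv] at hv
      rw [h5, le_antisymm hv.2 hv.1, delta, hω _ (hx.left_le h k) (hx.le_right h k)]
      simp
    rw [eLpNorm_congr_ae hae]
    refine (eLpNorm_finset_sup_le (by linarith) S (fun k _ => hmeas k) hΓ0 fun k _ => ?_).trans
      (ENNReal.ofReal_le_ofReal hΓ)
    have h3 := hmax.norm_le (hx.left_le h k) (hx.le_one h k)
      ((hx.one_le_two h k).trans (hx.two_le h k)) (hx.le_right h (k + 1))
    exact h3
  have hmp : AEMeasurable (maxPartialSum (levelDefect Ξ x h) (3 ^ h)) μ :=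
    aemeasurable_maxPartialSum fun k _ =>
      ((hΞ.defect_bounds hq hG le_rfl (hx.left_le h k) (hx.le_one h k)
        (hx.one_le_two h k) (hx.two_le h k) (hx.le_right h (k + 1))).2.1).1
  rw [ENNReal.ofReal_add (by positivity) hρ]
  exact (eLpNorm_add_le hmp.aestronglyMeasurable (hsupm _).aestronglyMeasurable hq1).trans
    (add_le_add h1 h2)

end MaximalGerm

/-! ### Duality for conditional norms -/

section Duality

variable {Ω : Type*} {m m' mΩ : MeasurableSpace Ω} {P : Measure Ω} {r : ℝ≥0∞}
  {g : Ω → ℝ≥0} {q : ℝ}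

/-- A bounded `m`-measurable density in the unit ball of the dual of `L^r(P)`. -/
structure IsTestDensity {Ω : Type*} (r : ℝ≥0∞) (m : MeasurableSpace Ω) {mΩ : MeasurableSpace Ω}
    (P : Measure Ω) (g : Ω → ℝ≥0) : Prop where
  measurable : Measurable[m] g
  bounded : ∃ c : ℝ≥0, ∀ ω, g ω ≤ c
  le : ∀ f : Ω → ℝ≥0∞, AEMeasurable f P → ∫⁻ ω, g ω * f ω ∂P ≤ eLpNorm f r P

/-- The measure with density `g` with respect to `P`. -/
noncomputable def weighted {Ω : Type*} {mΩ : MeasurableSpace Ω} (P : Measure[mΩ] Ω)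
    (g : Ω → ℝ≥0) : Measure[mΩ] Ω := P.withDensity fun ω => (g ω : ℝ≥0∞)

theorem IsTestDensity.mono (hg : IsTestDensity r m P g) (h : m ≤ m') : IsTestDensity r m' P g :=
  ⟨hg.measurable.mono h le_rfl, hg.bounded, hg.le⟩

theorem isTestDensity_one [IsProbabilityMeasure P] (hr : 1 ≤ r) : IsTestDensity r m P 1 where
  measurable := measurable_const
  bounded := ⟨1, fun _ => le_rfl⟩
  le f hf := by
    refine le_trans ?_ (eLpNorm_le_eLpNorm_of_exponent_le hr hf.aestronglyMeasurable)
    rw [eLpNorm_one_eq_lintegral_enorm]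
    simp

theorem weighted_one : weighted P 1 = P := by
  simp [weighted]

theorem weighted_absolutelyContinuous : weighted P g ≪ P := withDensity_absolutelyContinuous _ _

theorem lintegral_weighted (hm : m ≤ mΩ) (hg : Measurable[m] g) (f : Ω → ℝ≥0∞) :
    ∫⁻ ω, f ω ∂(weighted P g) = ∫⁻ ω, g ω * f ω ∂P := by
  rw [weighted, lintegral_withDensity_eq_lintegral_mul_non_measurable P
    ((hg.mono hm le_rfl).coe_nnreal_ennreal) (by simp)]
  rfl

theorem weighted_le_smul {c : ℝ≥0} (hc : ∀ ω, g ω ≤ c) : weighted P g ≤ c • P := by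
  calc weighted P g ≤ P.withDensity fun _ => (c : ℝ≥0∞) :=
        withDensity_mono (Eventually.of_forall fun ω => ENNReal.coe_le_coe.2 (hc ω))
    _ = c • P := by rw [withDensity_const]; rfl

theorem IsTestDensity.isFiniteMeasure [IsProbabilityMeasure P] (hg : IsTestDensity r m P g) :
    IsFiniteMeasure (weighted P g) := by
  obtain ⟨c, hc⟩ := hg.bounded
  exact isFiniteMeasure_of_le _ (weighted_le_smul hc)

/-- A bounded density transfers `L^q` convergence. -/
theorem eLpNorm_weighted_le {ε : Type*} [TopologicalSpace ε] [ESeminormedAddMonoid ε]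
    {c : ℝ≥0} (hc : ∀ ω, g ω ≤ c) {p : ℝ≥0∞} (hp : p ≠ ∞)
    (f : Ω → ε) : eLpNorm f p (weighted P g) ≤ (c : ℝ≥0∞) ^ (1 / p).toReal * eLpNorm f p P := by
  refine (eLpNorm_mono_measure f (weighted_le_smul hc)).trans_eq ?_
  have := eLpNorm_smul_measure_of_ne_top hp f (c : ℝ≥0∞) (μ := P)
  rw [smul_eq_mul] at this
  exact this

/-- The conditional expectation given `m` does not change under an `m`-measurable density. -/
theorem lintegral_condLExp_weighted [IsFiniteMeasure P] (hm : m ≤ mΩ) (hg : Measurable[m] g)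
    {f : Ω → ℝ≥0∞} (hf : AEMeasurable f P) :
    ∫⁻ ω, condLExp m P f ω ∂(weighted P g) = ∫⁻ ω, f ω ∂(weighted P g) := by
  have hgm : Measurable[m] fun ω => (g ω : ℝ≥0∞) := hg.coe_nnreal_ennreal
  have hgm' : Measurable fun ω => (g ω : ℝ≥0∞) := hgm.mono hm le_rfl
  have h1 : (P.withDensity (condLExp m P f)).trim hm = (P.withDensity f).trim hm := by
    refine @Measure.ext _ m _ _ fun s hs => ?_
    rw [trim_measurableSet_eq hm hs, trim_measurableSet_eq hm hs, withDensity_apply _ (hm s hs),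
      withDensity_apply _ (hm s hs), setLIntegral_condLExp hm P f hs]
  have h2 : ∀ F : Ω → ℝ≥0∞, AEMeasurable F P →
      ∫⁻ ω, F ω ∂(weighted P g) = ∫⁻ ω, g ω ∂((P.withDensity F).trim hm) := fun F hF => by
    rw [lintegral_weighted hm hg, lintegral_trim hm hgm,
      lintegral_withDensity_eq_lintegral_mul₀ hF hgm'.aemeasurable]
    simp only [Pi.mul_apply, mul_comm]
  rw [h2 _ (measurable_condLExp' m P f).aemeasurable, h2 f hf, h1]

/-- An `m`-measurable density does not change conditional expectations given `m' ≥ m`. -/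
theorem condExp_weighted {E : Type*} [NormedAddCommGroup E] [NormedSpace ℝ E] [CompleteSpace E]
    [IsProbabilityMeasure P] (hm' : m' ≤ mΩ) (hmm : m ≤ m') (hg : IsTestDensity r m P g)
    {Y : Ω → E} (hY : Integrable Y P) : (weighted P g)[Y|m'] =ᵐ[weighted P g] P[Y|m'] := by
  obtain ⟨c, hc⟩ := hg.bounded
  have hgm : Measurable[m'] g := hg.measurable.mono hmm le_rfl
  have hfin := hg.isFiniteMeasure
  have hint : ∀ {Z : Ω → E}, Integrable Z P → Integrable Z (weighted P g) := fun hZ =>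
    (hZ.smul_measure_nnreal (c := c)).mono_measure (weighted_le_smul hc)
  refine (ae_eq_condExp_of_forall_setIntegral_eq hm' (hint hY)
    (fun s _ _ => (hint integrable_condExp).integrableOn) (fun s hs _ => ?_)
    stronglyMeasurable_condExp.aestronglyMeasurable).symm
  have hgs : StronglyMeasurable[m'] fun ω => (g ω : ℝ) :=
    (hgm.coe_nnreal_real).stronglyMeasurable
  have hgb : ∀ {Z : Ω → E}, Integrable Z P → Integrable (fun ω => (g ω : ℝ) • Z ω) P := fun hZ =>
    hZ.bdd_smul (c : ℝ) (hgs.mono hm').aestronglyMeasurable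
      (Eventually.of_forall fun ω =>
        (Real.norm_of_nonneg (g ω).coe_nonneg).le.trans (NNReal.coe_le_coe.2 (hc ω)))
  have e : ∀ Z : Ω → E, ∫ ω in s, Z ω ∂(weighted P g) = ∫ ω in s, (g ω : ℝ) • Z ω ∂P := fun Z => by
    rw [weighted, restrict_withDensity (hm' s hs),
      integral_withDensity_eq_integral_smul (hgm.mono hm' le_rfl)]
    rfl
  rw [e, e, ← setIntegral_condExp hm' (hgb hY) hs]
  refine setIntegral_congr_ae (hm' s hs) ?_
  filter_upwards [condExp_smul_of_aestronglyMeasurable_left (m := m') hgs.aestronglyMeasurable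
    (hgb hY) hY] with ω hω _
  exact hω.symm

/-- Duality for `L^r` norms, by means of bounded test densities. -/
theorem eLpNorm_le_of_forall_isTestDensity [IsProbabilityMeasure P] (hm : m ≤ mΩ) (hr : 1 ≤ r)
    {F : Ω → ℝ≥0∞} (hF : Measurable[m] F) {d : ℝ≥0∞}
    (h : ∀ g, IsTestDensity r m P g → ∫⁻ ω, g ω * F ω ∂P ≤ d) : eLpNorm F r P ≤ d := by
  have hF' : Measurable F := hF.mono hm le_rfl
  rcases eq_or_ne r ∞ with rfl | hr_top
  · -- test densities supported on events
    rw [eLpNorm_exponent_top]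
    refine eLpNormEssSup_le_of_ae_enorm_bound ?_
    simp only [enorm_eq_self]
    refine ae_of_ae_trim hm (ae_le_of_forall_setLIntegral_le_of_sigmaFinite hF fun s hs _ => ?_)
    rw [setLIntegral_trim hm hF hs, setLIntegral_const, trim_measurableSet_eq hm hs]
    rcases eq_or_ne (P s) 0 with h0 | h0
    · rw [Measure.restrict_eq_zero.2 h0]; simp
    have htop : (P s) ≠ ∞ := measure_ne_top _ _
    have hcoe : ((P s).toNNReal⁻¹ : ℝ≥0) = (P s)⁻¹ := by
      rw [ENNReal.coe_inv, ENNReal.coe_toNNReal htop]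
      simp [ENNReal.toNNReal_eq_zero_iff, h0, htop]
    have e : ∀ f : Ω → ℝ≥0∞, ∫⁻ ω, (s.indicator (fun _ => (P s).toNNReal⁻¹) ω : ℝ≥0) * f ω ∂P
        = (P s)⁻¹ * ∫⁻ ω in s, f ω ∂P := fun f => by
      rw [← lintegral_const_mul' _ _ (ENNReal.inv_ne_top.2 h0), ← lintegral_indicator (hm s hs)]
      refine lintegral_congr fun ω => ?_
      by_cases hω : ω ∈ s <;> simp [hω, ← hcoe]
    have := h (s.indicator fun _ => (P s).toNNReal⁻¹) ⟨measurable_const.indicator hs,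
      ⟨(P s).toNNReal⁻¹, fun ω => Set.indicator_le_self' (by simp) ω⟩, fun f hf => ?_⟩
    · rw [e] at this
      calc ∫⁻ ω in s, F ω ∂P = P s * ((P s)⁻¹ * ∫⁻ ω in s, F ω ∂P) := by
            rw [← mul_assoc, ENNReal.mul_inv_cancel h0 htop, one_mul]
        _ ≤ P s * d := by gcongr
        _ = d * P s := mul_comm _ _
    · rw [e]
      calc (P s)⁻¹ * ∫⁻ ω in s, f ω ∂P ≤ (P s)⁻¹ * ∫⁻ ω in s, eLpNorm f ∞ P ∂P := by
            gcongr 1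
            refine lintegral_mono_ae (ae_restrict_of_ae ?_)
            have := enorm_ae_le_eLpNormEssSup f P
            simpa [eLpNorm_exponent_top] using this
        _ = eLpNorm f ∞ P := by
            rw [setLIntegral_const, mul_comm (eLpNorm f ∞ P), ← mul_assoc,
              ENNReal.inv_mul_cancel h0 htop, one_mul]
  rcases eq_or_ne r 1 with rfl | hr1
  · have := h 1 (isTestDensity_one le_rfl)
    rw [eLpNorm_one_eq_lintegral_enorm]
    simpa using this
  -- for `1 < r < ∞`, test with normalized powers of truncations of `F`
  obtain ⟨ρ, hρ⟩ : ∃ ρ : ℝ, ρ = r.toReal := ⟨_, rfl⟩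
  have hρ1 : 1 < ρ := by
    rw [hρ, ← ENNReal.toReal_one]
    exact (ENNReal.toReal_lt_toReal ENNReal.one_ne_top hr_top).2 (lt_of_le_of_ne hr (Ne.symm hr1))
  have hρ0 : 0 < ρ := by linarith
  have hr0 : r ≠ 0 := (zero_lt_one.trans_le hr).ne'
  have hconj : ρ.HolderConjugate (ρ.conjExponent) := Real.HolderConjugate.conjExponent hρ1
  set ρ' := ρ.conjExponent with hρ'
  have hρ'0 : 0 < ρ' := hconj.symm.pos
  have enorm_eq : ∀ f : Ω → ℝ≥0∞, eLpNorm f r P = (∫⁻ ω, f ω ^ ρ ∂P) ^ (1 / ρ) := fun f => by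
    rw [eLpNorm_eq_lintegral_rpow_enorm_toReal hr0 hr_top, ← hρ]
    simp only [enorm_eq_self]
  have key : ∀ n : ℕ, ∫⁻ ω, (min (F ω) n) ^ ρ ∂P ≤ d ^ ρ := fun n => by
    obtain ⟨φ, hφ⟩ : ∃ φ : Ω → ℝ≥0, ∀ ω, (φ ω : ℝ≥0∞) = min (F ω) n :=
      ⟨fun ω => (min (F ω) n).toNNReal, fun ω => ENNReal.coe_toNNReal
        (ne_top_of_le_ne_top (ENNReal.natCast_ne_top n) (min_le_right _ _))⟩
    have hφm : Measurable[m] φ := by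
      have h1 : Measurable[m] fun ω => (φ ω : ℝ≥0∞) := by
        simp_rw [hφ]; exact hF.min measurable_const
      simpa using h1.ennreal_toNNReal
    have hφn : ∀ ω, φ ω ≤ n := fun ω => by
      have : (φ ω : ℝ≥0∞) ≤ n := by rw [hφ]; exact min_le_right _ _
      exact_mod_cast this
    simp_rw [← hφ]
    set N := ∫⁻ ω, (φ ω : ℝ≥0∞) ^ ρ ∂P with hN
    have hNtop : N ≠ ∞ := by
      refine ne_top_of_le_ne_top (b := ((n : ℝ≥0∞) ^ ρ)) (ENNReal.rpow_ne_top_of_nonneg hρ0.le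
        (ENNReal.natCast_ne_top n)) ?_
      calc N ≤ ∫⁻ _, (n : ℝ≥0∞) ^ ρ ∂P := by
            refine lintegral_mono fun ω => ENNReal.rpow_le_rpow ?_ hρ0.le
            exact_mod_cast hφn ω
        _ = _ := by simp
    rcases eq_or_ne N 0 with hN0 | hN0
    · rw [hN0]; exact zero_le
    obtain ⟨ν, hν⟩ : ∃ ν : ℝ≥0, (ν : ℝ≥0∞) = N := ⟨N.toNNReal, ENNReal.coe_toNNReal hNtop⟩
    have hν0 : ν ≠ 0 := by rintro rfl; exact hN0 (by rw [← hν]; rfl)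
    set g : Ω → ℝ≥0 := fun ω => φ ω ^ (ρ - 1) * (ν ^ (1 / ρ'))⁻¹ with hg
    have hνp : ν ^ (1 / ρ') ≠ 0 := (NNReal.rpow_pos (pos_iff_ne_zero.2 hν0)).ne'
    have hgm : Measurable[m] g := (hφm.pow_const _).mul_const _
    have hgc : ∀ ω, (g ω : ℝ≥0∞) = (φ ω : ℝ≥0∞) ^ (ρ - 1) * (N ^ (1 / ρ'))⁻¹ := fun ω => by
      rw [hg, ENNReal.coe_mul, ENNReal.coe_inv hνp,
        ENNReal.coe_rpow_of_nonneg _ (by linarith), ENNReal.coe_rpow_of_nonneg _ (by positivity),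
        hν]
    have hgint : ∫⁻ ω, (g ω : ℝ≥0∞) ^ ρ' ∂P = 1 := by
      have e1 : ∀ ω, (g ω : ℝ≥0∞) ^ ρ' = (φ ω : ℝ≥0∞) ^ ρ * N⁻¹ := fun ω => by
        rw [hgc, ENNReal.mul_rpow_of_nonneg _ _ hρ'0.le, ← ENNReal.rpow_mul, ENNReal.inv_rpow,
          ← ENNReal.rpow_mul, one_div, inv_mul_cancel₀ hρ'0.ne', ENNReal.rpow_one,
          hconj.sub_one_mul_conj]
      simp_rw [e1]
      rw [lintegral_mul_const' _ _ (ENNReal.inv_ne_top.2 hN0), ← hN,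
        ENNReal.mul_inv_cancel hN0 hNtop]
    have htest : IsTestDensity r m P g := by
      refine ⟨hgm, ⟨(n : ℝ≥0) ^ (ρ - 1) * (ν ^ (1 / ρ'))⁻¹, fun ω => ?_⟩, fun f hf => ?_⟩
      · exact mul_le_mul_left (NNReal.rpow_le_rpow (hφn ω) (by linarith)) _
      · have := ENNReal.lintegral_mul_le_Lp_mul_Lq P hconj.symm (f := fun ω => (g ω : ℝ≥0∞))
          ((hgm.mono hm le_rfl).coe_nnreal_ennreal).aemeasurable hf
        rw [hgint, ENNReal.one_rpow, one_mul] at this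
        rw [enorm_eq]
        exact this
    have h1 : ∫⁻ ω, g ω * (φ ω : ℝ≥0∞) ∂P ≤ d := by
      refine le_trans (lintegral_mono fun ω => ?_) (h g htest)
      gcongr
      rw [hφ]; exact min_le_left _ _
    have e2 : ∀ ω, (g ω : ℝ≥0∞) * φ ω = (φ ω : ℝ≥0∞) ^ ρ * (N ^ (1 / ρ'))⁻¹ := fun ω => by
      rw [hgc, mul_right_comm]
      congr 1
      rcases eq_or_ne (φ ω : ℝ≥0∞) 0 with h0 | h0
      · rw [h0, mul_zero, ENNReal.zero_rpow_of_pos hρ0]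
      · conv_lhs => rw [← ENNReal.rpow_one (φ ω : ℝ≥0∞), ← ENNReal.rpow_mul, one_mul]
        rw [← ENNReal.rpow_add _ _ h0 ENNReal.coe_ne_top, sub_add_cancel]
    simp_rw [e2] at h1
    rw [lintegral_mul_const' _ _ (ENNReal.inv_ne_top.2 (by
      simp [hN0, hNtop])), ← hN] at h1
    have e3 : N * (N ^ (1 / ρ'))⁻¹ = N ^ (1 / ρ) := by
      rw [← ENNReal.rpow_neg]
      conv_lhs => rw [← ENNReal.rpow_one N, ← ENNReal.rpow_mul, one_mul]
      rw [← ENNReal.rpow_add _ _ hN0 hNtop]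
      congr 1
      have := hconj.inv_add_inv_eq_one
      simp only [one_div]; linarith
    rw [e3, one_div, ENNReal.rpow_inv_le_iff hρ0] at h1
    exact h1
  rw [enorm_eq, one_div, ENNReal.rpow_inv_le_iff hρ0]
  have hlim : ∀ ω, (F ω) ^ ρ = ⨆ n : ℕ, (min (F ω) n) ^ ρ := fun ω => by
    refine le_antisymm ?_ (iSup_le fun n => ENNReal.rpow_le_rpow (min_le_left _ _) hρ0.le)
    have h1 : Tendsto (fun n : ℕ => (min (F ω) n) ^ ρ) atTop (𝓝 ((min (F ω) ∞) ^ ρ)) :=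
      ((ENNReal.continuous_rpow_const.tendsto _).comp
        (tendsto_const_nhds.min ENNReal.tendsto_nat_nhds_top))
    rw [min_eq_left le_top] at h1
    exact le_of_tendsto h1 (Eventually.of_forall fun n => le_iSup (fun n : ℕ => min (F ω) n ^ ρ) n)
  simp_rw [hlim]
  rw [lintegral_iSup (fun n => (hF'.min measurable_const).pow_const _)
    fun a b hab ω => ENNReal.rpow_le_rpow (min_le_min le_rfl (by exact_mod_cast hab)) hρ0.le]
  exact iSup_le key

section CondNorm

variable [IsProbabilityMeasure P] {Y : Ω → ℝ≥0∞} {c : ℝ≥0∞}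

omit [IsProbabilityMeasure P] in
theorem condNorm_mono {X Y : Ω → ℝ≥0∞} (hq : 0 ≤ q) (h : X ≤ᵐ[P] Y) :
    condNorm q r m P X ≤ condNorm q r m P Y := by
  refine ENNReal.rpow_le_rpow ?_ (by positivity)
  refine eLpNorm_mono_enorm_ae ?_
  simp only [enorm_eq_self]
  refine condLExp_mono ?_
  filter_upwards [h] with ω hω
  exact ENNReal.rpow_le_rpow hω hq

theorem lintegral_rpow_le_iff_eLpNorm_le {μ : Measure Ω} (hq : 0 < q) (Y : Ω → ℝ≥0∞) (c : ℝ≥0∞) :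
    ∫⁻ ω, Y ω ^ q ∂μ ≤ c ^ q ↔ eLpNorm Y (ENNReal.ofReal q) μ ≤ c := by
  rw [eLpNorm_eq_lintegral_rpow_enorm_toReal (by simpa using hq) ENNReal.ofReal_ne_top,
    ENNReal.toReal_ofReal hq.le, one_div, ENNReal.rpow_inv_le_iff hq]
  simp only [enorm_eq_self]

/-- The norm `‖·‖_{q,r,s}` is a supremum of `L^q` norms with respect to weighted measures. -/
theorem condNorm_le_iff (hm : m ≤ mΩ) (hr : 1 ≤ r) (hq : 0 < q) (hY : AEMeasurable Y P) :
    condNorm q r m P Y ≤ c ↔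
      ∀ g, IsTestDensity r m P g → eLpNorm Y (ENNReal.ofReal q) (weighted P g) ≤ c := by
  rw [condNorm, one_div, ENNReal.rpow_inv_le_iff hq]
  have hc : ∀ g, IsTestDensity r m P g →
      ∫⁻ ω, g ω * condLExp m P (fun ω => Y ω ^ q) ω ∂P = ∫⁻ ω, Y ω ^ q ∂(weighted P g) :=
    fun g hg => by
      rw [← lintegral_weighted hm hg.measurable,
        lintegral_condLExp_weighted hm hg.measurable (hY.pow_const q)]
  constructor
  · intro h g hg
    rw [← lintegral_rpow_le_iff_eLpNorm_le hq, ← hc g hg]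
    exact (hg.le _ (measurable_condLExp' _ _ _).aemeasurable).trans h
  · intro h
    refine eLpNorm_le_of_forall_isTestDensity hm hr (measurable_condLExp _ _ _) fun g hg => ?_
    rw [hc g hg, lintegral_rpow_le_iff_eLpNorm_le hq]
    exact h g hg

/-- The `L^{qr}` norm of a conditional mean is a supremum of `L^q` norms with respect to weighted
measures. -/
theorem eLpNorm_condExp_le_iff {E : Type*} [NormedAddCommGroup E] [NormedSpace ℝ E]
    [CompleteSpace E] (hm : m ≤ mΩ) (hr : 1 ≤ r) (hq : 0 < q) {Z : Ω → E} (hZ : Integrable Z P) :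
    eLpNorm (P[Z|m]) (ENNReal.ofReal q * r) P ≤ c ↔ ∀ g, IsTestDensity r m P g →
      eLpNorm ((weighted P g)[Z|m]) (ENNReal.ofReal q) (weighted P g) ≤ c := by
  have h1 : eLpNorm (P[Z|m]) (ENNReal.ofReal q * r) P ≤ c ↔
      eLpNorm (fun ω => ‖P[Z|m] ω‖ₑ ^ q) r P ≤ c ^ q := by
    rw [eLpNorm_enorm_rpow _ hq, mul_comm, ENNReal.rpow_le_rpow_iff hq]
  have h2 : ∀ g, IsTestDensity r m P g →
      (eLpNorm ((weighted P g)[Z|m]) (ENNReal.ofReal q) (weighted P g) ≤ c ↔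
        ∫⁻ ω, g ω * ‖P[Z|m] ω‖ₑ ^ q ∂P ≤ c ^ q) := fun g hg => by
    rw [eLpNorm_congr_ae (condExp_weighted hm le_rfl hg hZ), ← eLpNorm_enorm,
      ← lintegral_rpow_le_iff_eLpNorm_le hq, lintegral_weighted hm hg.measurable]
  rw [h1]
  have hmeas : Measurable[m] fun ω => ‖P[Z|m] ω‖ₑ ^ q :=
    (stronglyMeasurable_condExp.enorm).pow_const q
  constructor
  · intro h g hg
    rw [h2 g hg]
    exact (hg.le _ (hmeas.mono hm le_rfl).aemeasurable).trans h
  · intro h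
    exact eLpNorm_le_of_forall_isTestDensity hm hr hmeas fun g hg => (h2 g hg).1 (h g hg)

end CondNorm

end Duality

/-! ### Uniform limits of càdlàg processes -/

section Limits

variable {Ω : Type*} {mΩ : MeasurableSpace Ω} {μ : Measure Ω}

/-- Minkowski's inequality for series of `[0,∞]`-valued functions. -/
theorem eLpNorm_tsum_le_tsum {q : ℝ} (hq : 1 ≤ q) {Y : ℕ → Ω → ℝ≥0∞}
    (hY : ∀ h, AEMeasurable (Y h) μ) :
    eLpNorm (fun ω => ∑' h, Y h ω) (ENNReal.ofReal q) μ
      ≤ ∑' h, eLpNorm (Y h) (ENNReal.ofReal q) μ := by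
  have hq0 : 0 < q := by linarith
  rw [← lintegral_rpow_le_iff_eLpNorm_le hq0]
  have e : ∀ ω, (∑' h, Y h ω) ^ q = ⨆ n, (∑ h ∈ Finset.range n, Y h ω) ^ q := fun ω => by
    rw [ENNReal.tsum_eq_iSup_nat]
    exact (ENNReal.orderIsoRpow q hq0).map_iSup _
  simp_rw [e]
  rw [lintegral_iSup' (fun n => (Finset.aemeasurable_fun_sum _ fun h _ => hY h).pow_const q)
    (Eventually.of_forall fun ω a b hab => ENNReal.rpow_le_rpow
      (Finset.sum_le_sum_of_subset (Finset.range_subset_range.2 hab)) hq0.le)]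
  refine iSup_le fun n => ?_
  rw [lintegral_rpow_le_iff_eLpNorm_le hq0]
  have h1 : (fun ω => ∑ h ∈ Finset.range n, Y h ω) = ∑ h ∈ Finset.range n, Y h := by
    funext ω; rw [Finset.sum_apply]
  rw [h1]
  exact (eLpNorm_sum_le (fun h _ => (hY h).aestronglyMeasurable)
    (by simpa using ENNReal.ofReal_le_ofReal hq)).trans (ENNReal.sum_le_tsum _)

variable {E : Type*} [NormedAddCommGroup E]

theorem isCadlagOn_zero (a b : ℝ) : IsCadlagOn (fun _ => (0 : E)) a b :=
  ⟨fun _ _ _ => tendsto_const_nhds, fun _ _ _ => ⟨0, tendsto_const_nhds⟩⟩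

theorem IsCadlagOn.sum {ι : Type*} {S : Finset ι} {f : ι → ℝ → E} {a b : ℝ}
    (hf : ∀ i ∈ S, IsCadlagOn (f i) a b) : IsCadlagOn (fun t => ∑ i ∈ S, f i t) a b := by
  refine ⟨fun t h1 h2 => tendsto_finsetSum _ fun i hi => (hf i hi).1 t h1 h2, fun t h1 h2 => ?_⟩
  have : ∀ i, ∃ l, i ∈ S → Tendsto (f i) (𝓝[<] t) (𝓝 l) := fun i => by
    by_cases hi : i ∈ S
    · obtain ⟨l, hl⟩ := (hf i hi).2 t h1 h2
      exact ⟨l, fun _ => hl⟩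
    · exact ⟨0, fun h => absurd h hi⟩
  choose l hl using this
  exact ⟨∑ i ∈ S, l i, tendsto_finsetSum _ hl⟩

/-- A uniform limit of càdlàg paths is càdlàg. -/
theorem IsCadlagOn.of_uniform_limit [CompleteSpace E] {S : ℕ → ℝ → E} {F : ℝ → E} {a b : ℝ}
    (hS : ∀ h, IsCadlagOn (S h) a b)
    (hF : ∀ ε > 0, ∃ h, ∀ t, a ≤ t → t ≤ b → dist (F t) (S h t) < ε) : IsCadlagOn F a b := by
  constructor
  · intro t h1 h2
    rw [Metric.tendsto_nhds]
    intro ε hε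
    obtain ⟨h, hh⟩ := hF (ε / 3) (by positivity)
    have h3 := Metric.tendsto_nhds.1 ((hS h).1 t h1 h2) (ε / 3) (by positivity)
    have h4 : ∀ᶠ v in 𝓝[>] t, v ∈ Set.Ioo t b := Ioo_mem_nhdsGT h2
    filter_upwards [h3, h4] with v h5 h6
    have h7 := hh v (h1.trans h6.1.le) h6.2.le
    have h8 := hh t h1 h2.le
    calc dist (F v) (F t) ≤ dist (F v) (S h v) + dist (S h v) (S h t) + dist (S h t) (F t) :=
          dist_triangle4 _ _ _ _
      _ < ε := by rw [dist_comm (S h t)]; linarith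
  · intro t h1 h2
    have hc : Cauchy (map F (𝓝[<] t)) := by
      rw [Metric.cauchy_iff]
      refine ⟨inferInstance, fun ε hε => ?_⟩
      obtain ⟨h, hh⟩ := hF (ε / 4) (by positivity)
      obtain ⟨l, hl⟩ := (hS h).2 t h1 h2
      have h3 := Metric.tendsto_nhds.1 hl (ε / 4) (by positivity)
      have h4 : ∀ᶠ v in 𝓝[<] t, v ∈ Set.Ioo a t := Ioo_mem_nhdsLT h1
      refine ⟨F '' {v | dist (S h v) l < ε / 4 ∧ v ∈ Set.Ioo a t},
        image_mem_map (h3.and h4), ?_⟩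
      rintro _ ⟨v, ⟨hv1, hv2⟩, rfl⟩ _ ⟨w, ⟨hw1, hw2⟩, rfl⟩
      have h5 := hh v hv2.1.le (hv2.2.le.trans h2)
      have h6 := hh w hw2.1.le (hw2.2.le.trans h2)
      have h7 := dist_triangle4 (F v) (S h v) (S h w) (F w)
      have h8 := dist_triangle_right (S h v) (S h w) l
      rw [dist_comm (S h w)] at h7
      linarith
    exact CompleteSpace.complete hc

/-- Almost surely uniform limits of adapted càdlàg processes are adapted, and càdlàg for every
`ω`, after modification on a null set, which belongs to the complete filtration. -/
theorem exists_cadlag_limit [CompleteSpace E] {T : ℝ} {ℱ : Filtration ℝ mΩ}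
    (hℱ : IsCompleteFiltration T ℱ μ) {S : ℕ → ℝ → Ω → E} {Y : ℕ → Ω → ℝ≥0∞}
    (hS : ∀ h t, 0 ≤ t → t ≤ T → StronglyMeasurable[ℱ t] (S h t))
    (hae : ∀ᵐ ω ∂μ, (∀ h, ∀ t ∈ Set.Icc 0 T, ‖S h t ω - S (h + 1) t ω‖ₑ ≤ Y h ω) ∧
      (∀ h, IsCadlagOn (fun t => S h t ω) 0 T) ∧ ∑' h, Y h ω ≠ ∞) :
    ∃ I : ℝ → Ω → E, (∀ t, 0 ≤ t → t ≤ T → StronglyMeasurable[ℱ t] (I t)) ∧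
      (∀ ω, IsCadlagOn (fun t => I t ω) 0 T) ∧
      ∀ᵐ ω ∂μ, ∀ h, ∀ t ∈ Set.Icc 0 T, ‖I t ω - S h t ω‖ₑ ≤ ∑' k, Y (h + k) ω := by
  classical
  obtain ⟨G, hG⟩ : ∃ G : Set Ω, G = {ω | (∀ h, ∀ t ∈ Set.Icc 0 T,
      ‖S h t ω - S (h + 1) t ω‖ₑ ≤ Y h ω) ∧ (∀ h, IsCadlagOn (fun t => S h t ω) 0 T) ∧
      ∑' h, Y h ω ≠ ∞} := ⟨_, rfl⟩
  have hGae : ∀ᵐ ω ∂μ, ω ∈ G := by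
    filter_upwards [hae] with ω hω
    rw [hG]; exact hω
  have hG1 : ∀ ω ∈ G, (∀ h, ∀ t ∈ Set.Icc 0 T, ‖S h t ω - S (h + 1) t ω‖ₑ ≤ Y h ω) ∧
      (∀ h, IsCadlagOn (fun t => S h t ω) 0 T) ∧ ∑' h, Y h ω ≠ ∞ := fun ω hω => by
    rw [hG] at hω; exact hω
  -- the exceptional set is null, so it belongs to every `ℱ t`
  have hGm : ∀ t, 0 ≤ t → t ≤ T → MeasurableSet[ℱ t] G := fun t h1 h2 => by
    have : μ Gᶜ = 0 := hGae
    exact MeasurableSet.of_compl (hℱ t h1 h2 _ this)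
  have hconv : ∀ ω, ∀ t, ∃ l, (ω ∉ G → l = 0) ∧ (t ∈ Set.Icc 0 T → ω ∈ G →
      Tendsto (fun h => S h t ω) atTop (𝓝 l)) := fun ω t => by
    by_cases hmem : t ∈ Set.Icc 0 T ∧ ω ∈ G
    · have := cauchySeq_of_edist_le_of_tsum_ne_top (f := fun h => S h t ω) (fun h => Y h ω)
        (fun h => by rw [edist_eq_enorm_sub]; exact (hG1 ω hmem.2).1 h t hmem.1)
        (hG1 ω hmem.2).2.2
      obtain ⟨l, hl⟩ := cauchySeq_tendsto_of_complete this
      exact ⟨l, fun hcon => absurd hmem.2 hcon, fun _ _ => hl⟩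
    · exact ⟨0, fun _ => rfl, fun h1 h2 => absurd ⟨h1, h2⟩ hmem⟩
  choose L hL0 hL using hconv
  have hbound : ∀ ω ∈ G, ∀ h, ∀ t ∈ Set.Icc 0 T, ‖L ω t - S h t ω‖ₑ ≤ ∑' k, Y (h + k) ω :=
    fun ω hω h t ht => by
      rw [← edist_eq_enorm_sub, edist_comm]
      exact edist_le_tsum_of_edist_le_of_tendsto (f := fun h => S h t ω) (fun h => Y h ω)
        (fun h => by rw [edist_eq_enorm_sub]; exact (hG1 ω hω).1 _ t ht) (hL ω t ht hω) h
  refine ⟨fun t ω => L ω t, fun t h1 h2 => ?_, fun ω => ?_, ?_⟩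
  · refine stronglyMeasurable_of_tendsto atTop
      (fun h => (hS h t h1 h2).indicator (hGm t h1 h2)) (tendsto_pi_nhds.2 fun ω => ?_)
    by_cases hω : ω ∈ G
    · simpa [hω] using hL ω t ⟨h1, h2⟩ hω
    · simp [hω, hL0 ω t hω]
  · by_cases hω : ω ∈ G
    · refine IsCadlagOn.of_uniform_limit (hG1 ω hω).2.1 fun ε hε => ?_
      have ht : Tendsto (fun h => ∑' k, Y (k + h) ω) atTop (𝓝 0) :=
        ENNReal.tendsto_sum_nat_add (fun h => Y h ω) (hG1 ω hω).2.2
      obtain ⟨h, hh⟩ := (ht.eventually_lt_const (ENNReal.ofReal_pos.2 hε)).exists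
      refine ⟨h, fun t h1 h2 => ?_⟩
      have h3 := hbound ω hω h t ⟨h1, h2⟩
      rw [← edist_lt_ofReal, edist_eq_enorm_sub]
      simp_rw [add_comm _ h] at hh
      exact h3.trans_lt hh
    · have : (fun t => L ω t) = fun _ => 0 := funext fun t => hL0 ω t hω
      rw [this]
      exact isCadlagOn_zero 0 T
  · filter_upwards [hGae] with ω hω using hbound ω hω

/-- The path `t ↦ Ξ_{u ∧ t, v ∧ t}` vanishes before `u` and is constant after `v`. -/
theorem isCadlagOn_stopped {Ξ : ℝ → ℝ → Ω → E} {ω : Ω} {T u v : ℝ}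
    (hω : ∀ t, 0 ≤ t → t ≤ T → Ξ t t ω = 0) (huv : u ≤ v) (hvT : v ≤ T)
    (hc : u < T → IsCadlagOn (fun t => Ξ u t ω) u T) :
    IsCadlagOn (fun t => Ξ (min u t) (min v t) ω) 0 T := by
  have hlt : ∀ t, 0 ≤ t → t < u → Ξ (min u t) (min v t) ω = 0 := fun t h0 h1 => by
    rw [min_eq_right h1.le, min_eq_right (h1.le.trans huv)]
    exact hω t h0 (h1.le.trans (huv.trans hvT))
  constructor
  · intro t h0 h1
    rcases lt_or_ge t u with h2 | h2
    · have : ∀ᶠ x in 𝓝[>] t, Ξ (min u t) (min v t) ω = Ξ (min u x) (min v x) ω := by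
        filter_upwards [Ioo_mem_nhdsGT h2] with x hx
        rw [hlt t h0 h2, hlt x (h0.trans hx.1.le) hx.2]
      exact tendsto_const_nhds.congr' this
    rcases lt_or_ge t v with h3 | h3
    · have : ∀ᶠ x in 𝓝[>] t, Ξ u x ω = Ξ (min u x) (min v x) ω := by
        filter_upwards [Ioo_mem_nhdsGT h3] with x hx
        rw [min_eq_left (h2.trans hx.1.le), min_eq_right hx.2.le]
      refine Tendsto.congr' this ?_
      beta_reduce
      rw [min_eq_left h2, min_eq_right h3.le]
      exact (hc (h2.trans_lt h1)).1 t h2 h1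
    · have : ∀ᶠ x in 𝓝[>] t, Ξ (min u t) (min v t) ω = Ξ (min u x) (min v x) ω := by
        filter_upwards [Ioo_mem_nhdsGT h1] with x hx
        rw [min_eq_left h2, min_eq_left h3, min_eq_left (h2.trans hx.1.le),
          min_eq_left (h3.trans hx.1.le)]
      exact tendsto_const_nhds.congr' this
  · intro t h0 h1
    rcases le_or_gt t u with h2 | h2
    · refine ⟨0, tendsto_const_nhds.congr' ?_⟩
      filter_upwards [Ioo_mem_nhdsLT h0] with x hx
      rw [hlt x hx.1.le (hx.2.trans_le h2)]
    rcases le_or_gt t v with h3 | h3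
    · obtain ⟨l, hl⟩ := (hc (h2.trans_le h1)).2 t h2 h1
      refine ⟨l, hl.congr' ?_⟩
      filter_upwards [Ioo_mem_nhdsLT h2] with x hx
      rw [min_eq_left hx.1.le, min_eq_right (hx.2.le.trans h3)]
    · refine ⟨Ξ u v ω, tendsto_const_nhds.congr' ?_⟩
      filter_upwards [Ioo_mem_nhdsLT h3] with x hx
      rw [min_eq_left (huv.trans hx.1.le), min_eq_left hx.1.le]

theorem isCadlagOn_stoppedSum {Ξ : ℝ → ℝ → Ω → E} {ω : Ω} {T : ℝ}
    (hω : ∀ t, 0 ≤ t → t ≤ T → Ξ t t ω = 0) {R : Finset ℝ} (hR : IsPartition R 0 T)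
    (hc : ∀ u ∈ R, u < T → IsCadlagOn (fun t => Ξ u t ω) u T) :
    IsCadlagOn (fun t => stoppedSum Ξ R t ω) 0 T := by
  refine IsCadlagOn.sum (f := fun (p : ℝ × ℝ) t => Ξ (min p.1 t) (min p.2 t) ω) fun p hp => ?_
  obtain ⟨h1, h2, h3, -⟩ := mem_intervals.1 hp
  exact isCadlagOn_stopped hω h3.le (hR.2.2 _ h2).2 (hc _ h1)

theorem stronglyMeasurable_stoppedSum {Ξ : ℝ → ℝ → Ω → E} {T : ℝ} {ℱ : Filtration ℝ mΩ}
    (hΞ : ∀ s t, 0 ≤ s → s ≤ t → t ≤ T → StronglyMeasurable[ℱ t] (Ξ s t)) {R : Finset ℝ}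
    (hR : IsPartition R 0 T) {t : ℝ} (h0 : 0 ≤ t) (ht : t ≤ T) :
    StronglyMeasurable[ℱ t] (stoppedSum Ξ R t) := by
  have : stoppedSum Ξ R t = fun ω => ∑ p ∈ intervals R, Ξ (min p.1 t) (min p.2 t) ω := rfl
  rw [this]
  refine Finset.stronglyMeasurable_fun_sum _ fun p hp => ?_
  obtain ⟨h1, h2, h3, -⟩ := mem_intervals.1 hp
  exact (hΞ _ _ (le_min (hR.2.2 _ h1).1 h0) (min_le_min_right _ h3.le)
    ((min_le_right _ _).trans ht)).mono (ℱ.mono (min_le_right _ _))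

end Limits

/-! ### Sewing estimates for limits of Riemann sums -/

section Sewing

variable {Ω : Type*} {mΩ : MeasurableSpace Ω} {E : Type*} [NormedAddCommGroup E]

theorem stoppedSum_image_range {Ξ : ℝ → ℝ → Ω → E} {x : ℕ → ℝ} (hx : Monotone x) (n : ℕ) {ω : Ω}
    {T : ℝ} (h0 : ∀ k, 0 ≤ x k) (hT : ∀ k, x k ≤ T) (hω : ∀ t, 0 ≤ t → t ≤ T → Ξ t t ω = 0) {v : ℝ}
    (hv : 0 ≤ v) : stoppedSum Ξ ((Finset.range (n + 1)).image x) v ω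
      = ∑ k ∈ Finset.range n, Ξ (min (x k) v) (min (x (k + 1)) v) ω := by
  rw [stoppedSum, sum_intervals_image_range hx n (f := fun p => Ξ (min p.1 v) (min p.2 v) ω)]
  exact fun k _ => hω _ (le_min (h0 k) hv) ((min_le_left _ _).trans (hT k))

/-- The increment over `[s,t]` of a stopped Riemann sum is a Riemann sum over `[s,t]`, up to the
defect caused by the interval which contains `s`. -/
theorem StochSewing.IsPartition.exists_stoppedSum_sub_eq {P : Finset ℝ} {T s t : ℝ}
    (hP : IsPartition P 0 T) (hs : 0 ≤ s) (hst : s < t) (htT : t ≤ T) :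
    ∃ R u v, IsPartition R s t ∧ 0 ≤ u ∧ u ≤ s ∧ s < v ∧ v ≤ t ∧ v - s ≤ mesh P ∧
      ∀ (Ξ : ℝ → ℝ → Ω → E) (ω : Ω), (∀ t, 0 ≤ t → t ≤ T → Ξ t t ω = 0) →
        stoppedSum Ξ P t ω - stoppedSum Ξ P s ω = riemannSum Ξ R ω + delta Ξ u s v ω := by
  obtain ⟨n, x, hx, hx0, hxT, himg⟩ := hP.exists_chain
  have h0 : ∀ k, 0 ≤ x k := fun k => by rw [← hx0]; exact hx (Nat.zero_le k)
  have hT : ∀ k, x k ≤ T := fun k => by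
    rw [← hxT (max k n) (le_max_right _ _)]; exact hx (le_max_left _ _)
  set j := Nat.findGreatest (fun k => x k ≤ s) n with hj
  have hj1 : x j ≤ s := Nat.findGreatest_spec (P := fun k => x k ≤ s) (Nat.zero_le _)
    (by rw [hx0]; exact hs)
  have hjn : j < n := by
    refine lt_of_le_of_ne (Nat.findGreatest_le _) fun hcon => ?_
    rw [hxT j hcon.ge] at hj1
    linarith
  have hj2 : s < x (j + 1) := not_le.1 (Nat.findGreatest_is_greatest (Nat.lt_succ_self j) hjn)
  set y : ℕ → ℝ := fun k => max s (min (x k) t) with hy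
  have hym : Monotone y := fun a b hab => max_le_max le_rfl (min_le_min (hx hab) le_rfl)
  have hys : ∀ k, s ≤ y k := fun k => le_max_left _ _
  have hyt : ∀ k, y k ≤ t := fun k => max_le hst.le (min_le_right _ _)
  have hylow : ∀ k ≤ j, y k = s := fun k hk =>
    max_eq_left ((min_le_left _ _).trans ((hx hk).trans hj1))
  have hyhigh : ∀ k, j < k → y k = min (x k) t := fun k hk =>
    max_eq_right (le_min (hj2.le.trans (hx hk)) hst.le)
  refine ⟨(Finset.range (n + 1)).image y, x j, min (x (j + 1)) t, ⟨?_, ?_, ?_⟩, h0 j, hj1,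
    lt_min hj2 hst, min_le_right _ _, ?_, ?_⟩
  · exact Finset.mem_image.2 ⟨0, by simp, hylow 0 (Nat.zero_le _)⟩
  · refine Finset.mem_image.2 ⟨n, by simp, ?_⟩
    rw [hyhigh n hjn, hxT n le_rfl, min_eq_right htT]
  · intro z hz
    obtain ⟨k, _, rfl⟩ := Finset.mem_image.1 hz
    exact ⟨hys k, hyt k⟩
  · have hmem : (x j, x (j + 1)) ∈ intervals P := by
      rw [← himg, intervals_image_range hx]
      exact Finset.mem_image.2 ⟨j, Finset.mem_filter.2 ⟨Finset.mem_range.2 hjn,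
        hj1.trans_lt hj2⟩, rfl⟩
    have h1 := dist_le_mesh hmem
    have h2 := min_le_left (x (j + 1)) t
    linarith
  · intro Ξ ω hω
    have hself : ∀ k < n, Ξ (y k) (y k) ω = 0 := fun k _ => hω _ (hs.trans (hys k))
      ((hyt k).trans htT)
    rw [← himg, stoppedSum_image_range hx n h0 hT hω (hs.trans hst.le),
      stoppedSum_image_range hx n h0 hT hω hs, riemannSum,
      sum_intervals_image_range hym n (f := fun p => Ξ p.1 p.2 ω) hself, ← Finset.sum_sub_distrib,
      ← sub_eq_iff_eq_add', ← Finset.sum_sub_distrib]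
    rw [Finset.sum_eq_single_of_mem j (Finset.mem_range.2 hjn)]
    · rw [hylow j le_rfl, hyhigh (j + 1) (Nat.lt_succ_self j), min_eq_left (hj1.trans hst.le),
        min_eq_left hj1, min_eq_right hj2.le, delta]
    · intro k _ hk
      rcases lt_or_gt_of_ne hk with h1 | h1
      · have h2 : x (k + 1) ≤ s := (hx h1).trans hj1
        have h3 : x k ≤ s := (hx (Nat.le_succ k)).trans h2
        rw [hylow k h1.le, hylow (k + 1) h1, min_eq_left h2, min_eq_left h3,
          min_eq_left (h2.trans hst.le), min_eq_left (h3.trans hst.le),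
          hω s hs (hst.le.trans htT)]
        simp
      · have h2 : s ≤ x k := hj2.le.trans (hx h1)
        rw [hyhigh k h1, hyhigh (k + 1) (h1.trans (Nat.lt_succ_self k)), min_eq_right h2,
          min_eq_right (h2.trans (hx (Nat.le_succ k))), hω s hs (hst.le.trans htT)]
        simp

variable [NormedSpace ℝ E]

/-- The hypotheses of stochastic sewing with respect to the norms `‖·‖_{q,r,s}`, expressed through
test densities, with two-point bounds `A` and `B`, and with a bound `ρ(p,v)` of `δΞ_{u,p,v}` which
is small when `v` is close to `p`. -/
structure IsSewable (q : ℝ) (r : ℝ≥0∞) (T : ℝ) (ℱ : Filtration ℝ mΩ) (P : Measure Ω)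
    (Ξ : ℝ → ℝ → Ω → E) (A B ρ : ℝ → ℝ → ℝ) : Prop where
  germ : ∀ {s g}, 0 ≤ s → s ≤ T → IsTestDensity r (ℱ s) P g →
    IsLqGerm q T s ℱ (weighted P g) Ξ A B
  remainder : ∀ {u p v g}, 0 ≤ u → u ≤ p → p ≤ v → v ≤ T → IsTestDensity r (ℱ u) P g →
    eLpNorm (delta Ξ u p v) (ENNReal.ofReal q) (weighted P g) ≤ ENNReal.ofReal (ρ p v)
  tendsto_remainder : ∀ p, 0 ≤ p → p < T → Tendsto (ρ p) (𝓝[>] p) (𝓝 0)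

variable {q T : ℝ} {r : ℝ≥0∞} {ℱ : Filtration ℝ mΩ} {P : Measure Ω} {Ξ : ℝ → ℝ → Ω → E}
  {A B ρ Γ : ℝ → ℝ → ℝ} {K L η κ C : ℝ} [IsProbabilityMeasure P] [CompleteSpace E]

theorem eLpNorm_le_of_tendsto {F : Type*} [NormedAddCommGroup F] {μ : Measure Ω} {p b : ℝ≥0∞}
    (hp : 1 ≤ p) {f : Ω → F} {f' : ℕ → Ω → F}
    (hf' : ∀ n, AEStronglyMeasurable (f' n) μ) (hf : AEStronglyMeasurable f μ)
    (hb : ∀ n, eLpNorm (f' n) p μ ≤ b)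
    (hlim : Tendsto (fun n => eLpNorm (f - f' n) p μ) atTop (𝓝 0)) : eLpNorm f p μ ≤ b := by
  have h1 : ∀ n, eLpNorm f p μ ≤ b + eLpNorm (f - f' n) p μ := fun n => by
    have : f = f' n + (f - f' n) := by abel
    conv_lhs => rw [this]
    exact (eLpNorm_add_le (hf' n) (hf.sub (hf' n)) hp).trans (by gcongr; exact hb n)
  have h2 : Tendsto (fun n => b + eLpNorm (f - f' n) p μ) atTop (𝓝 (b + 0)) :=
    tendsto_const_nhds.add hlim
  rw [add_zero] at h2
  exact ge_of_tendsto h2 (Eventually.of_forall h1)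

/-- A process which is approximated in `L^q(P)` by stopped Riemann sums of vanishing mesh satisfies
the sewing estimates, because these hold uniformly for Riemann sums. -/
theorem IsSewable.isSewing (hq : 2 ≤ q) (hr : 1 ≤ r)
    (hκ : ∀ μ : Measure Ω, IsFiniteMeasure μ → IsMaximalConst q E κ μ) (hκ0 : 0 ≤ κ)
    (hΞ : IsSewable q r T ℱ P Ξ A B ρ) (hG : IsGauge q T L K η A B Γ) (hK : 0 < K) (hη : 0 < η)
    (hT : 0 < T) {I : ℝ → Ω → E} (hI : ∀ t, 0 ≤ t → t ≤ T → StronglyMeasurable[ℱ t] (I t))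
    {R : ℕ → Finset ℝ} (hR : ∀ h, IsPartition (R h) 0 T)
    (hmesh : Tendsto (fun h => mesh (R h)) atTop (𝓝 0))
    (hlim : ∀ t, 0 ≤ t → t ≤ T → Tendsto (fun h =>
      eLpNorm (I t - stoppedSum Ξ (R h) t) (ENNReal.ofReal q) P) atTop (𝓝 0)) :
    IsSewing q r T ℱ P Ξ A B (sewConst κ K η) I := by
  have hq1 := one_le_ofReal_of_two_le hq
  have hq0 : 0 < q := by linarith
  have hone : ∀ s, IsTestDensity r (ℱ s) P 1 := fun s => isTestDensity_one hr
  have hgermP := hΞ.germ le_rfl hT.le (hone 0)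
  rw [weighted_one] at hgermP
  have hSm : ∀ h t, 0 ≤ t → t ≤ T → AEStronglyMeasurable (stoppedSum Ξ (R h) t) P :=
    fun h t h1 h2 => ((stronglyMeasurable_stoppedSum (fun s t => hgermP.adapted) (hR h) h1
      h2).mono (ℱ.le t)).aestronglyMeasurable
  have hIm : ∀ t, 0 ≤ t → t ≤ T → AEStronglyMeasurable (I t) P := fun t h1 h2 =>
    ((hI t h1 h2).mono (ℱ.le t)).aestronglyMeasurable
  have hΞm : ∀ s t, 0 ≤ s → s ≤ t → t ≤ T → AEStronglyMeasurable (Ξ s t) P :=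
    fun s t h0 h1 h2 => ((hgermP.adapted h0 h1 h2).mono (ℱ.le t)).aestronglyMeasurable
  have hDm : ∀ s t, 0 ≤ s → s ≤ t → t ≤ T →
      AEStronglyMeasurable (fun ω => I t ω - I s ω - Ξ s t ω) P := fun s t h0 h1 h2 =>
    ((hIm t (h0.trans h1) h2).sub (hIm s h0 (h1.trans h2))).sub (hΞm s t h0 h1 h2)
  -- for `s < t`, pass to the limit in the estimates for the Riemann sums of `[s,t]`
  have main : ∀ s t, 0 ≤ s → s < t → t ≤ T →
      MemLp (fun ω => I t ω - I s ω - Ξ s t ω) (ENNReal.ofReal q) P ∧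
      ∀ g, IsTestDensity r (ℱ s) P g →
        eLpNorm ((weighted P g)[fun ω => I t ω - I s ω - Ξ s t ω|ℱ s]) (ENNReal.ofReal q)
          (weighted P g) ≤ ENNReal.ofReal (sewConst κ K η * A s t) ∧
        eLpNorm (fun ω => I t ω - I s ω - Ξ s t ω) (ENNReal.ofReal q) (weighted P g)
          ≤ ENNReal.ofReal (sewConst κ K η * (A s t + B s t)) := by
    intro s t hs hst ht
    have hsT := hst.le.trans ht
    have ht0 := hs.trans hst.le
    choose R' u v hR' hu0 hus hsv hvt hvmesh hsub using fun h =>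
      (hR h).exists_stoppedSum_sub_eq (Ω := Ω) (E := E) hs hst ht
    set D : Ω → E := fun ω => I t ω - I s ω - Ξ s t ω with hD
    set D' : ℕ → Ω → E := fun h ω => riemannSum Ξ (R' h) ω - Ξ s t ω with hD'
    have hbd : ∀ g, IsTestDensity r (ℱ s) P g → ∀ h, _ := fun g hg h => by
      have := hg.isFiniteMeasure
      exact (hΞ.germ hs hsT hg).riemannSum_bounds hq (hκ _ this) hκ0 hG hK hη hs le_rfl hst ht
        (hR' h)
    have hD'P : ∀ h, MemLp (D' h) (ENNReal.ofReal q) P := fun h => by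
      have := (hbd 1 (hone s) h).1
      rwa [weighted_one] at this
    -- the remainders vanish in `L^q(P)` since the mesh tends to zero
    have hcorr : Tendsto (fun h => eLpNorm (delta Ξ (u h) s (v h)) (ENNReal.ofReal q) P) atTop
        (𝓝 0) := by
      have h1 : Tendsto v atTop (𝓝[>] s) := by
        refine tendsto_nhdsWithin_iff.2 ⟨?_, Eventually.of_forall hsv⟩
        refine tendsto_of_tendsto_of_tendsto_of_le_of_le (g := fun _ => s)
          (h := fun h => s + (mesh (R h) : ℝ)) tendsto_const_nhds ?_ (fun h => (hsv h).le)
          fun h => by linarith [hvmesh h]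
        have := (NNReal.tendsto_coe.2 hmesh).const_add s
        simpa using this
      have h2 : Tendsto (fun h => ENNReal.ofReal (ρ s (v h))) atTop (𝓝 0) := by
        have := ENNReal.tendsto_ofReal
          ((hΞ.tendsto_remainder s hs (hst.trans_le ht)).comp h1)
        simpa using this
      refine tendsto_of_tendsto_of_tendsto_of_le_of_le tendsto_const_nhds h2
        (fun _ => zero_le) fun h => ?_
      have := hΞ.remainder (hu0 h) (hus h) (hsv h).le ((hvt h).trans ht) (hone (u h))
      rwa [weighted_one] at this
    have hdm : ∀ h, AEStronglyMeasurable (delta Ξ (u h) s (v h)) P := fun h =>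
      ((delta_stronglyMeasurable hgermP.adapted (hu0 h) (hus h) (hsv h).le
        ((hvt h).trans ht)).mono (ℱ.le _)).aestronglyMeasurable
    -- convergence in `L^q(P)`, which bounded densities transfer to `L^q(g P)`
    have hlimP : Tendsto (fun h => eLpNorm (D - D' h) (ENNReal.ofReal q) P) atTop (𝓝 0) := by
      have hsum := ((hlim t ht0 ht).add (hlim s hs hsT)).add hcorr
      simp only [add_zero] at hsum
      refine tendsto_of_tendsto_of_tendsto_of_le_of_le tendsto_const_nhds hsum
        (fun _ => zero_le) fun h => ?_
      have e : D - D' h =ᵐ[P] (I t - stoppedSum Ξ (R h) t) - (I s - stoppedSum Ξ (R h) s)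
          + delta Ξ (u h) s (v h) := by
        filter_upwards [hgermP.self] with ω hω
        have := hsub h Ξ ω hω
        simp only [hD, hD', Pi.sub_apply, Pi.add_apply]
        rw [eq_sub_of_add_eq' this.symm]
        abel
      rw [eLpNorm_congr_ae e]
      have m1 := (hIm t ht0 ht).sub (hSm h t ht0 ht)
      have m2 := (hIm s hs hsT).sub (hSm h s hs hsT)
      refine (eLpNorm_add_le (m1.sub m2) (hdm h) hq1).trans ?_
      gcongr
      exact eLpNorm_sub_le m1 m2 hq1
    have hmem : MemLp D (ENNReal.ofReal q) P := by
      obtain ⟨h, hh⟩ := (hlimP.eventually_lt_const ENNReal.zero_lt_top).exists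
      have h1 : MemLp (D - D' h) (ENNReal.ofReal q) P :=
        ⟨(hDm s t hs hst.le ht).sub (hD'P h).1, hh⟩
      have := h1.add (hD'P h)
      rwa [sub_add_cancel] at this
    refine ⟨hmem, fun g hg => ?_⟩
    have hfin := hg.isFiniteMeasure
    obtain ⟨c, hc⟩ := hg.bounded
    have hgle : ∀ f : Ω → E, eLpNorm f (ENNReal.ofReal q) (weighted P g)
        ≤ (c : ℝ≥0∞) ^ (1 / ENNReal.ofReal q).toReal * eLpNorm f (ENNReal.ofReal q) P :=
      fun f => eLpNorm_weighted_le hc ENNReal.ofReal_ne_top f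
    have hcq : (c : ℝ≥0∞) ^ (1 / ENNReal.ofReal q).toReal ≠ ∞ :=
      ENNReal.rpow_ne_top_of_nonneg ENNReal.toReal_nonneg ENNReal.coe_ne_top
    have hmemg : ∀ {f : Ω → E}, MemLp f (ENNReal.ofReal q) P →
        MemLp f (ENNReal.ofReal q) (weighted P g) := fun hf =>
      ⟨hf.1.mono_ac weighted_absolutelyContinuous,
        (hgle _).trans_lt (ENNReal.mul_lt_top hcq.lt_top hf.2)⟩
    have hlimg : Tendsto (fun h => eLpNorm (D - D' h) (ENNReal.ofReal q) (weighted P g)) atTop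
        (𝓝 0) := by
      have := ENNReal.Tendsto.const_mul hlimP (Or.inr hcq)
      rw [mul_zero] at this
      exact tendsto_of_tendsto_of_tendsto_of_le_of_le tendsto_const_nhds this
        (fun _ => zero_le) fun h => hgle _
    constructor
    · have hcm : ∀ f : Ω → E, AEStronglyMeasurable ((weighted P g)[f|ℱ s]) (weighted P g) :=
        fun f => (stronglyMeasurable_condExp.mono (ℱ.le s)).aestronglyMeasurable
      refine eLpNorm_le_of_tendsto hq1 (fun h => hcm (D' h)) (hcm _)
        (fun h => (hbd g hg h).2.1) ?_
      refine tendsto_of_tendsto_of_tendsto_of_le_of_le tendsto_const_nhds hlimg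
        (fun _ => zero_le) fun h => ?_
      have e := condExp_sub ((hmemg hmem).integrable hq1) ((hmemg (hD'P h)).integrable hq1) (ℱ s)
      refine (eLpNorm_congr_ae e).symm.le.trans ?_
      exact eLpNorm_condExp_le_of_memLp (ℱ.le s) (by linarith) (hmemg (hmem.sub (hD'P h)))
    · exact eLpNorm_le_of_tendsto hq1 (fun h => (hmemg (hD'P h)).1) (hmemg hmem).1
        (fun h => (hbd g hg h).2.2) hlimg
  have hzero : ∀ t, 0 ≤ t → t ≤ T → (fun ω => I t ω - I t ω - Ξ t t ω) =ᵐ[P] 0 :=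
    fun t h1 h2 => by
      filter_upwards [hgermP.self] with ω hω
      simp [hω t h1 h2]
  refine ⟨hI, ?_, fun s t hs hst ht => ?_, fun s t hs hst ht => ?_⟩
  · have h0 : ∀ h, stoppedSum Ξ (R h) 0 =ᵐ[P] 0 := fun h => by
      filter_upwards [hgermP.self] with ω hω
      rw [stoppedSum, Pi.zero_apply]
      refine Finset.sum_eq_zero fun p hp => ?_
      obtain ⟨h1, h2, -⟩ := mem_intervals.1 hp
      rw [min_eq_right ((hR h).2.2 _ h1).1, min_eq_right ((hR h).2.2 _ h2).1]
      exact hω 0 le_rfl hT.le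
    have h1 : eLpNorm (I 0) (ENNReal.ofReal q) P = 0 := by
      refine tendsto_nhds_unique ?_ (hlim 0 le_rfl hT.le)
      refine tendsto_const_nhds.congr fun h => eLpNorm_congr_ae ?_
      filter_upwards [h0 h] with ω hω
      rw [Pi.sub_apply, hω]
      simp
    exact (eLpNorm_eq_zero_iff (hIm 0 le_rfl hT.le) (by simpa using hq0)).1 h1
  · rcases hst.eq_or_lt with rfl | hlt
    · have e := condExp_congr_ae (m := ℱ s) (hzero s hs ht)
      rw [condExp_zero] at e
      rw [eLpNorm_congr_ae e, eLpNorm_zero]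
      exact zero_le
    · obtain ⟨h1, h2⟩ := main s t hs hlt ht
      exact (eLpNorm_condExp_le_iff (ℱ.le s) hr hq0 (h1.integrable hq1)).2 fun g hg => (h2 g hg).1
  · rw [condNorm_le_iff (ℱ.le s) hr hq0 (hDm s t hs hst ht).enorm]
    intro g hg
    rw [eLpNorm_enorm]
    rcases hst.eq_or_lt with rfl | hlt
    · rw [eLpNorm_congr_ae (weighted_absolutelyContinuous (hzero s hs ht)), eLpNorm_zero]
      exact zero_le
    · exact ((main s t hs hlt ht).2 g hg).2

end Sewing

/-! ### Uniqueness and convergence along all partitions -/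

section Consequences

variable {Ω : Type*} {mΩ : MeasurableSpace Ω} {E : Type*} [NormedAddCommGroup E] [NormedSpace ℝ E]
  {q T : ℝ} {r : ℝ≥0∞} {ℱ : Filtration ℝ mΩ} {P : Measure Ω} {Ξ : ℝ → ℝ → Ω → E}
  {A B ρ Γ : ℝ → ℝ → ℝ} {K L η κ C : ℝ} [IsProbabilityMeasure P] [CompleteSpace E]

/-- The sewing estimates with respect to test densities. -/
theorem StochSewing.IsSewing.bounds {I : ℝ → Ω → E} (hq : 2 ≤ q) (hr : 1 ≤ r)
    (hI : IsSewing q r T ℱ P Ξ A B C I) {s t : ℝ} (hs : 0 ≤ s) (hst : s ≤ t) (ht : t ≤ T)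
    (hΞ : StronglyMeasurable[ℱ t] (Ξ s t)) {g : Ω → ℝ≥0} (hg : IsTestDensity r (ℱ s) P g) :
    StronglyMeasurable[ℱ t] (fun ω => I t ω - I s ω - Ξ s t ω) ∧
    MemLp (fun ω => I t ω - I s ω - Ξ s t ω) (ENNReal.ofReal q) (weighted P g) ∧
    eLpNorm ((weighted P g)[fun ω => I t ω - I s ω - Ξ s t ω|ℱ s]) (ENNReal.ofReal q)
      (weighted P g) ≤ ENNReal.ofReal (C * A s t) ∧
    eLpNorm (fun ω => I t ω - I s ω - Ξ s t ω) (ENNReal.ofReal q) (weighted P g)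
      ≤ ENNReal.ofReal (C * (A s t + B s t)) := by
  have hq0 : 0 < q := by linarith
  have hm : StronglyMeasurable[ℱ t] (fun ω => I t ω - I s ω - Ξ s t ω) :=
    ((hI.adapted t (hs.trans hst) ht).sub ((hI.adapted s hs (hst.trans ht)).mono
      (ℱ.mono hst))).sub hΞ
  have hm' : AEStronglyMeasurable (fun ω => I t ω - I s ω - Ξ s t ω) P :=
    (hm.mono (ℱ.le t)).aestronglyMeasurable
  have hn := (condNorm_le_iff (ℱ.le s) hr hq0 hm'.enorm).1 (hI.condNorm_le s t hs hst ht)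
  simp only [eLpNorm_enorm] at hn
  have h1 := hn 1 (isTestDensity_one hr)
  rw [weighted_one] at h1
  have hint := (memLp_of_eLpNorm_le hm' h1).integrable (one_le_ofReal_of_two_le hq)
  exact ⟨hm, memLp_of_eLpNorm_le (hm'.mono_ac weighted_absolutelyContinuous) (hn g hg),
    (eLpNorm_condExp_le_iff (ℱ.le s) hr hq0 hint).1 (hI.condExp_le s t hs hst ht) g hg, hn g hg⟩

/-- The difference of two sewn processes is a sum of differences of local errors along arbitrarily
fine partitions, and these sums vanish in the limit. -/
theorem StochSewing.IsSewing.ae_eq (hq : 2 ≤ q) (hr : 1 ≤ r) (hκ : IsMaximalConst q E κ P)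
    (hκ0 : 0 ≤ κ) (hΞ : ∀ s t, 0 ≤ s → s ≤ t → t ≤ T → StronglyMeasurable[ℱ t] (Ξ s t))
    (hG : IsGauge q T L K η A B Γ) (hη : 0 < η) {I J : ℝ → Ω → E} {c : ℝ}
    (hI : IsSewing q r T ℱ P Ξ A B C I) (hJ : IsSewing q r T ℱ P Ξ A B c J) {t : ℝ} (h0t : 0 ≤ t)
    (htT : t ≤ T) : J t =ᵐ[P] I t := by
  have hq1 := one_le_ofReal_of_two_le hq
  have hq0 : 0 < q := by linarith
  rcases h0t.eq_or_lt with rfl | ht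
  · filter_upwards [hI.zero, hJ.zero] with ω h1 h2
    rw [h1, h2]
  obtain ⟨W, x, hx, -, hlev⟩ := hG.exists_chain le_rfl ht htT isClosed_Icc
    (Set.left_mem_Icc.2 h0t) (Set.right_mem_Icc.2 h0t) subset_rfl
  set D : Ω → E := fun ω => (J t ω - J 0 ω) - (I t ω - I 0 ω) with hD
  set c' : ℝ := |c| + |C| with hc'
  have hbd : ∀ h, eLpNorm D (ENNReal.ofReal q) P
      ≤ ENNReal.ofReal (c' * (1 + 2 * κ) * (K * (A 0 t + B 0 t)) * ((1 / 2) ^ η) ^ h) := by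
    intro h
    obtain ⟨S, hS, hin, h1, h2, -⟩ := hlev h
    -- the differences of the local errors, in which `Ξ` cancels
    set Z : ℕ → Ω → E := fun k ω => (J (x h (k + 1)) ω - J (x h k) ω)
      - (I (x h (k + 1)) ω - I (x h k) ω) with hZ
    have hA0 : ∀ k, 0 ≤ A (x h k) (x h (k + 1)) := fun k => hG.A_nonneg (hx.left_le h k)
      (hx.mono h (Nat.le_succ k)) ((hx.le_right h _).trans htT)
    have hB0 : ∀ k, 0 ≤ B (x h k) (x h (k + 1)) := fun k => hG.B_nonneg (hx.left_le h k)
      (hx.mono h (Nat.le_succ k)) ((hx.le_right h _).trans htT)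
    have hloc : ∀ k, StronglyMeasurable[ℱ (x h (k + 1))] (Z k) ∧
        eLpNorm (P[Z k|ℱ (x h k)]) (ENNReal.ofReal q) P
          ≤ ENNReal.ofReal (c' * A (x h k) (x h (k + 1))) ∧
        eLpNorm (Z k) (ENNReal.ofReal q) P
          ≤ ENNReal.ofReal (c' * (A (x h k) (x h (k + 1)) + B (x h k) (x h (k + 1)))) := by
      intro k
      have hu := hx.left_le h k
      have huv := hx.mono h (Nat.le_succ k)
      have hv := (hx.le_right h (k + 1)).trans htT
      have bI := hI.bounds hq hr hu huv hv (hΞ _ _ hu huv hv) (isTestDensity_one hr)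
      have bJ := hJ.bounds hq hr hu huv hv (hΞ _ _ hu huv hv) (isTestDensity_one hr)
      rw [weighted_one] at bI bJ
      obtain ⟨i1, i2, i3, i4⟩ := bI
      obtain ⟨j1, j2, j3, j4⟩ := bJ
      have e : Z k = (fun ω => J (x h (k + 1)) ω - J (x h k) ω - Ξ (x h k) (x h (k + 1)) ω)
          - fun ω => I (x h (k + 1)) ω - I (x h k) ω - Ξ (x h k) (x h (k + 1)) ω := by
        funext ω
        simp only [hZ, Pi.sub_apply]
        abel
      have hadd : ∀ {a y : ℝ}, 0 ≤ y → ENNReal.ofReal (a * y) ≤ ENNReal.ofReal (|a| * y) :=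
        fun hy => ENNReal.ofReal_le_ofReal (mul_le_mul_of_nonneg_right (le_abs_self _) hy)
      rw [e]
      refine ⟨j1.sub i1, ?_, ?_⟩
      · rw [eLpNorm_congr_ae (condExp_sub (j2.integrable hq1) (i2.integrable hq1) _)]
        refine (eLpNorm_sub_le (stronglyMeasurable_condExp.mono (ℱ.le _)).aestronglyMeasurable
          (stronglyMeasurable_condExp.mono (ℱ.le _)).aestronglyMeasurable hq1).trans ?_
        rw [hc', add_mul, ENNReal.ofReal_add (mul_nonneg (abs_nonneg _) (hA0 k))
          (mul_nonneg (abs_nonneg _) (hA0 k))]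
        exact add_le_add (j3.trans (hadd (hA0 k))) (i3.trans (hadd (hA0 k)))
      · have hAB := add_nonneg (hA0 k) (hB0 k)
        refine (eLpNorm_sub_le j2.1 i2.1 hq1).trans ?_
        rw [hc', add_mul, ENNReal.ofReal_add (mul_nonneg (abs_nonneg _) hAB)
          (mul_nonneg (abs_nonneg _) hAB)]
        exact add_le_add (j4.trans (hadd hAB)) (i4.trans (hadd hAB))
    have hz : ∀ k < 3 ^ h, k ∉ S → Z k =ᵐ[P] 0 := fun k hk hkS => by
      have huv : x h k = x h (k + 1) := by
        by_contra hne
        obtain ⟨y, hy⟩ := exists_between (lt_of_le_of_ne (hx.mono h (Nat.le_succ k)) hne)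
        exact hin k hk hkS y ⟨(hx.left_le h k).trans hy.1.le, hy.2.le.trans (hx.le_right h _)⟩ hy
      refine Eventually.of_forall fun ω => ?_
      simp [hZ, ← huv]
    have hmax := hκ.eLpNorm_maxPartialSum_le hκ0 (hx.mono h) hS (Z := Z) (ℱ := ℱ) (c := c')
      (by positivity) (fun k _ => hA0 k) (fun k _ => hB0 k) (fun k _ => (hloc k).1)
      (fun k _ => (hloc k).2.1) (fun k _ => (hloc k).2.2) hz h1 h2
    refine le_trans (eLpNorm_mono_enorm fun ω => ?_) (hmax.trans_eq (by congr 1; ring))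
    have e : D ω = ∑ k ∈ Finset.range (3 ^ h), Z k ω := by
      simp only [hZ, hD]
      rw [Finset.sum_sub_distrib, Finset.sum_range_sub (fun k => J (x h k) ω),
        Finset.sum_range_sub (fun k => I (x h k) ω), hx.left, hx.right h _ le_rfl]
    rw [enorm_eq_self, e]
    exact enorm_sum_le_maxPartialSum _ le_rfl ω
  have hzero : eLpNorm D (ENNReal.ofReal q) P = 0 := by
    have h1 : Tendsto (fun h : ℕ => ENNReal.ofReal
        (c' * (1 + 2 * κ) * (K * (A 0 t + B 0 t)) * ((1 / 2) ^ η) ^ h)) atTop (𝓝 0) := by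
      have := ENNReal.tendsto_ofReal ((tendsto_pow_atTop_nhds_zero_of_lt_one
        (r := (1 / 2 : ℝ) ^ η) (by positivity) (half_rpow_lt_one hη)).const_mul
        (c' * (1 + 2 * κ) * (K * (A 0 t + B 0 t))))
      simpa using this
    exact le_antisymm (ge_of_tendsto h1 (Eventually.of_forall hbd)) zero_le
  have hDm : AEStronglyMeasurable D P :=
    (((((hJ.adapted t h0t htT).mono (ℱ.le _)).sub
      ((hJ.adapted 0 le_rfl (h0t.trans htT)).mono (ℱ.le _))).sub
      (((hI.adapted t h0t htT).mono (ℱ.le _)).sub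
      ((hI.adapted 0 le_rfl (h0t.trans htT)).mono (ℱ.le _))))).aestronglyMeasurable
  filter_upwards [(eLpNorm_eq_zero_iff hDm (by simpa using hq0)).1 hzero, hI.zero, hJ.zero]
    with ω h1 h2 h3
  simp only [hD, h2, h3, sub_zero, Pi.zero_apply] at h1
  exact sub_eq_zero.1 h1

omit [NormedSpace ℝ E] [CompleteSpace E] [IsProbabilityMeasure P] in
theorem stronglyMeasurable_riemannSum {s₀ s t : ℝ}
    (hΞ : ∀ {s t}, s₀ ≤ s → s ≤ t → t ≤ T → StronglyMeasurable[ℱ t] (Ξ s t)) (hs : s₀ ≤ s)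
    (ht : t ≤ T) {R : Finset ℝ} (hR : IsPartition R s t) : StronglyMeasurable (riemannSum Ξ R) := by
  have : riemannSum Ξ R = fun ω => ∑ p ∈ intervals R, Ξ p.1 p.2 ω := rfl
  rw [this]
  refine Finset.stronglyMeasurable_fun_sum _ fun p hp => ?_
  obtain ⟨h1, h2, h3, -⟩ := mem_intervals.1 hp
  exact (hΞ (hs.trans (hR.2.2 _ h1).1) h3.le ((hR.2.2 _ h2).2.trans ht)).mono (ℱ.le _)

omit [IsProbabilityMeasure P] [CompleteSpace E] in
/-- Inserting finitely many points into a fine partition changes the Riemann sum only slightly. -/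
theorem IsSewable.eLpNorm_riemannSum_union_sub_le (hq : 2 ≤ q)
    (hΞ : IsSewable q r T ℱ P Ξ A B ρ) {s t : ℝ} (hs : 0 ≤ s) (hst : s ≤ t) (ht : t ≤ T)
    {g : Ω → ℝ≥0} (hg : IsTestDensity r (ℱ s) P g) {R : Finset ℝ} (hR : IsPartition R s t)
    {ε : ℝ} (hε : 0 ≤ ε) {d : ℝ≥0} (hd : mesh R < d) (F : Finset ℝ) (hF : ∀ p ∈ F, s ≤ p ∧ p ≤ t)
    (hρ : ∀ p ∈ F, p < T → ∀ v, p < v → v < p + d → ρ p v ≤ ε) :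
    IsPartition (R ∪ F) s t ∧ mesh (R ∪ F) ≤ mesh R ∧
      eLpNorm (riemannSum Ξ (R ∪ F) - riemannSum Ξ R) (ENNReal.ofReal q) (weighted P g)
        ≤ ENNReal.ofReal (F.card * ε) := by
  classical
  have hq1 := one_le_ofReal_of_two_le hq
  have hgerm := hΞ.germ hs (hst.trans ht) hg
  induction F using Finset.induction_on with
  | empty => simp [hR]
  | insert a F ha ih =>
    obtain ⟨h1, h2, h3⟩ := ih (fun p hp => hF p (Finset.mem_insert_of_mem hp))
      fun p hp => hρ p (Finset.mem_insert_of_mem hp)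
    obtain ⟨hsa, hat⟩ := hF a (Finset.mem_insert_self _ _)
    have hcard : ENNReal.ofReal ((insert a F).card * ε)
        = ENNReal.ofReal (F.card * ε) + ENNReal.ofReal ε := by
      rw [Finset.card_insert_of_notMem ha, ← ENNReal.ofReal_add (by positivity) hε]
      congr 1; push_cast; ring
    rw [Finset.union_insert]
    refine ⟨h1.insert hsa hat, (mesh_insert_le h1 hsa hat).trans h2, ?_⟩
    rw [hcard]
    by_cases hmem : a ∈ R ∪ F
    · rw [Finset.insert_eq_of_mem hmem]
      exact h3.trans le_self_add
    obtain ⟨u, v, huv, hua, hav, hsum⟩ := exists_sum_intervals_insert (M := E) h1 hsa hat hmem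
    obtain ⟨hu, hv, -, -⟩ := mem_intervals.1 huv
    have hsu := (h1.2.2 u hu).1
    have hvt := (h1.2.2 v hv).2
    have hsmall : ρ a v ≤ ε := by
      refine hρ a (Finset.mem_insert_self _ _) (hav.trans_le (hvt.trans ht)) v hav ?_
      have h4 := dist_le_mesh huv
      have h5 : (mesh (R ∪ F) : ℝ) < d := NNReal.coe_lt_coe.2 (h2.trans_lt hd)
      linarith
    have e : riemannSum Ξ (insert a (R ∪ F)) - riemannSum Ξ R
        = (riemannSum Ξ (R ∪ F) - riemannSum Ξ R) - delta Ξ u a v := by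
      funext ω
      have := hsum fun p => Ξ p.1 p.2 ω
      simp only [Pi.sub_apply, riemannSum, delta]
      rw [this]
      abel
    rw [e]
    refine (eLpNorm_sub_le ((stronglyMeasurable_riemannSum hgerm.adapted le_rfl ht h1).sub
      (stronglyMeasurable_riemannSum hgerm.adapted le_rfl ht hR)).aestronglyMeasurable
      (hgerm.delta_memLp hsu hua.le hav.le (hvt.trans ht)).1 hq1).trans (add_le_add h3 ?_)
    exact (hΞ.remainder (hs.trans hsu) hua.le hav.le (hvt.trans ht)
      (hg.mono (ℱ.mono hsu))).trans (ENNReal.ofReal_le_ofReal hsmall)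

/-- The Riemann sums converge to the sewn process as the mesh tends to zero. A fine partition is
compared with its union with a fixed level of a refining chain. -/
theorem IsSewable.exists_mesh (hq : 2 ≤ q) (hr : 1 ≤ r)
    (hκ : ∀ μ : Measure Ω, IsFiniteMeasure μ → IsMaximalConst q E κ μ) (hκ0 : 0 ≤ κ)
    (hΞ : IsSewable q r T ℱ P Ξ A B ρ) (hG : IsGauge q T L K η A B Γ) (hη : 0 < η) (hC : 0 ≤ C)
    (hT : 0 < T) {I : ℝ → Ω → E} (hI : IsSewing q r T ℱ P Ξ A B C I) {s t : ℝ} (hs : 0 ≤ s)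
    (hst : s ≤ t) (ht : t ≤ T) {ε : ℝ≥0∞} (hε : 0 < ε) :
    ∃ d : ℝ≥0, 0 < d ∧ ∀ R : Finset ℝ, IsPartition R s t → mesh R < d →
      condNorm q r (ℱ s) P (fun ω => ‖I t ω - I s ω - riemannSum Ξ R ω‖ₑ) < ε := by
  classical
  have hq1 := one_le_ofReal_of_two_le hq
  have hq0 : 0 < q := by linarith
  have hgermP := hΞ.germ le_rfl hT.le (isTestDensity_one hr)
  rw [weighted_one] at hgermP
  have hDm : ∀ R : Finset ℝ, IsPartition R s t →
      AEStronglyMeasurable (fun ω => I t ω - I s ω - riemannSum Ξ R ω) P := fun R hR =>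
    ((((hI.adapted t (hs.trans hst) ht).mono (ℱ.le _)).sub
      ((hI.adapted s hs (hst.trans ht)).mono (ℱ.le _))).sub
      (stronglyMeasurable_riemannSum hgermP.adapted hs ht hR)).aestronglyMeasurable
  obtain ⟨e, he0, heε⟩ : ∃ e : ℝ, 0 < e ∧ ENNReal.ofReal e < ε := by
    obtain ⟨e, -, h1, h2⟩ := ENNReal.lt_iff_exists_real_btwn.1 hε
    exact ⟨e, ENNReal.ofReal_pos.1 h1, h2⟩
  suffices h : ∃ d : ℝ≥0, 0 < d ∧ ∀ R : Finset ℝ, IsPartition R s t → mesh R < d →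
      ∀ g, IsTestDensity r (ℱ s) P g → eLpNorm (fun ω => I t ω - I s ω - riemannSum Ξ R ω)
        (ENNReal.ofReal q) (weighted P g) ≤ ENNReal.ofReal e by
    obtain ⟨d, hd, h⟩ := h
    refine ⟨d, hd, fun R hR hm => lt_of_le_of_lt ?_ heε⟩
    refine (condNorm_le_iff (ℱ.le s) hr hq0 (hDm R hR).enorm).2 fun g hg => ?_
    rw [eLpNorm_enorm]
    exact h R hR hm g hg
  rcases hst.eq_or_lt with rfl | hlt
  · refine ⟨1, one_pos, fun R hR _ g _ => ?_⟩
    have h0 : intervals R = ∅ := Finset.eq_empty_of_forall_notMem fun p hp => by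
      obtain ⟨h1, h2, h3, -⟩ := mem_intervals.1 hp
      exact absurd ((hR.2.2 _ h2).2.trans (hR.2.2 _ h1).1) (not_le.2 h3)
    have h1 : (fun ω => I s ω - I s ω - riemannSum Ξ R ω) = 0 := by
      funext ω; simp [riemannSum, h0]
    rw [h1, eLpNorm_zero]
    exact zero_le
  obtain ⟨W, hW, hWL, -, hsum⟩ := hG.exists_control s t hs hlt ht
  have hL0 : 0 ≤ L := (hW.nonneg s t hs hst ht).trans hWL
  obtain ⟨x, hx⟩ := hW.exists_isRefiningChain isClosed_Icc hs hst ht (Set.left_mem_Icc.2 hst)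
    (Set.right_mem_Icc.2 hst) subset_rfl hWL
  -- a level `H` so fine that the local errors over all finer partitions add up to at most `e / 2`
  obtain ⟨H, hH⟩ : ∃ H : ℕ, C * (1 + 2 * κ) * (K * ((1 / 2) ^ H) ^ η * A s t
      + K * ((1 / 2) ^ H) ^ η * B s t) ≤ e / 2 := by
    have h1 : Tendsto (fun H : ℕ => C * (1 + 2 * κ) * (K * ((1 / 2 : ℝ) ^ H) ^ η * A s t
        + K * ((1 / 2 : ℝ) ^ H) ^ η * B s t)) atTop (𝓝 0) := by
      have h2 : Tendsto (fun H : ℕ => ((1 / 2 : ℝ) ^ H) ^ η) atTop (𝓝 0) := by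
        have := (tendsto_pow_atTop_nhds_zero_of_lt_one (r := (1 / 2 : ℝ)) (by norm_num)
          (by norm_num)).rpow_const (p := η) (Or.inr hη.le)
        rwa [Real.zero_rpow hη.ne'] at this
      have := (((h2.const_mul K).mul_const (A s t)).add
        ((h2.const_mul K).mul_const (B s t))).const_mul (C * (1 + 2 * κ))
      simpa using this
    obtain ⟨H, hH⟩ := (h1.eventually_lt_const (half_pos he0)).exists
    exact ⟨H, hH.le⟩
  obtain ⟨F, hF⟩ : ∃ F : Finset ℝ, F = chainPoints x H := ⟨_, rfl⟩
  have hFp : IsPartition F s t := hF ▸ hx.isPartition H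
  obtain ⟨e', he', he'F⟩ : ∃ e' : ℝ, 0 < e' ∧ F.card * e' ≤ e / 2 := by
    refine ⟨e / 2 / (F.card + 1), by positivity, ?_⟩
    rw [mul_div_assoc', div_le_iff₀ (by positivity)]
    nlinarith
  -- a mesh so small that inserting the points of `F` costs at most `e / 2`
  obtain ⟨d, hd0, hd⟩ : ∃ d : ℝ, 0 < d ∧
      ∀ p ∈ F, p < T → ∀ v, p < v → v < p + d → ρ p v ≤ e' := by
    have h1 : ∀ p ∈ F, ∀ᶠ d in 𝓝[>] (0 : ℝ), p < T → ∀ v, p < v → v < p + d → ρ p v ≤ e' := by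
      intro p hp
      by_cases hpT : p < T
      · have h2 := (hΞ.tendsto_remainder p (hs.trans (hFp.2.2 p hp).1) hpT).eventually_le_const he'
        obtain ⟨b, hb, hsub⟩ := (mem_nhdsGT_iff_exists_Ioo_subset).1 h2
        filter_upwards [Ioo_mem_nhdsGT (sub_pos.2 hb)] with d hd _ v h3 h4
        exact hsub ⟨h3, by linarith [hd.2]⟩
      · exact Eventually.of_forall fun d h => absurd h hpT
    have h2 := (eventually_all_finset F).2 h1
    obtain ⟨d, h3, h4⟩ := (h2.and self_mem_nhdsWithin).exists
    exact ⟨d, h4, h3⟩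
  refine ⟨⟨d, hd0.le⟩, hd0, fun R hR hm g hg => ?_⟩
  have hfin := hg.isFiniteMeasure
  obtain ⟨hU, -, hUR⟩ := hΞ.eLpNorm_riemannSum_union_sub_le hq hs hst ht hg hR he'.le hm F
    hFp.2.2 hd
  obtain ⟨n, y, hy, hy0, hyt, himg⟩ := hU.exists_chain
  have hsy : ∀ k, s ≤ y k := fun k => by rw [← hy0]; exact hy (Nat.zero_le k)
  have hyt' : ∀ k, y k ≤ t := fun k => by
    rw [← hyt (max k n) (le_max_right _ _)]; exact hy (le_max_left _ _)
  -- each interval of the union lies in an interval of the chain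
  have hWy : ∀ k ∈ Finset.range n, W (y k) (y (k + 1)) ≤ L * (1 / 2) ^ H := by
    intro k hk
    rcases (hy (Nat.le_succ k)).eq_or_lt with heq | hlt'
    · rw [← heq, hW.self (hs.trans (hsy k)) ((hyt' k).trans ht)]
      positivity
    have hcons : (y k, y (k + 1)) ∈ intervals (R ∪ F) := by
      rw [← himg, intervals_image_range hy]
      exact Finset.mem_image.2 ⟨k, Finset.mem_filter.2 ⟨hk, hlt'⟩, rfl⟩
    obtain ⟨-, -, -, hsep⟩ := mem_intervals.1 hcons
    set j := Nat.findGreatest (fun j => x H j ≤ y k) (3 ^ H) with hj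
    have hj1 : x H j ≤ y k := Nat.findGreatest_spec (P := fun j => x H j ≤ y k) (Nat.zero_le _)
      (by rw [hx.left]; exact hsy k)
    have hjn : j < 3 ^ H := by
      refine lt_of_le_of_ne (Nat.findGreatest_le _) fun hcon => ?_
      rw [hx.right H j hcon.ge] at hj1
      exact absurd (hlt'.trans_le (hyt' _)) (not_lt.2 hj1)
    have hj2 : y k < x H (j + 1) :=
      not_le.1 (Nat.findGreatest_is_greatest (Nat.lt_succ_self j) hjn)
    have hj3 : y (k + 1) ≤ x H (j + 1) := by
      refine (hsep (x H (j + 1)) (Finset.mem_union_right _ ?_)).resolve_left (not_le.2 hj2)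
      rw [hF]
      exact Finset.mem_image.2 ⟨j + 1, Finset.mem_range.2 (by omega), rfl⟩
    have hmono : W (y k) (y (k + 1)) ≤ W (x H j) (x H (j + 1)) :=
      hW.mono (hs.trans (hx.left_le H j)) hj1 hlt'.le hj3 ((hx.le_right H _).trans ht)
    rcases hx.dichotomy H j with h1 | h1
    · exact absurd ⟨hj1.trans_lt (left_lt_add_div_two.2 hlt'),
        (add_div_two_lt_right.2 hlt').trans_le hj3⟩ (h1 ((y k + y (k + 1)) / 2)
        ⟨(hsy k).trans (left_lt_add_div_two.2 hlt').le,
          (add_div_two_lt_right.2 hlt').le.trans (hyt' _)⟩)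
    · exact hmono.trans h1
  obtain ⟨hA, hB, -⟩ := hsum y (Finset.range n) ((1 / 2) ^ H) hy hsy hyt' (by positivity)
    (pow_le_one₀ (by norm_num) (by norm_num)) hWy
  set Z : ℕ → Ω → E := fun k ω => I (y (k + 1)) ω - I (y k) ω - Ξ (y k) (y (k + 1)) ω with hZ
  have hgerm := hΞ.germ hs (hst.trans ht) hg
  have hloc := fun k => hI.bounds hq hr (hs.trans (hsy k)) (hy (Nat.le_succ k))
    ((hyt' (k + 1)).trans ht) (hgerm.adapted (hsy k) (hy (Nat.le_succ k)) ((hyt' _).trans ht))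
    (hg.mono (ℱ.mono (hsy k)))
  have hmax := (hκ _ hfin).eLpNorm_maxPartialSum_le hκ0 hy (Finset.Subset.refl (Finset.range n))
    (Z := Z) (ℱ := ℱ) (c := C) hC
    (fun k _ => hG.A_nonneg (hs.trans (hsy k)) (hy (Nat.le_succ k)) ((hyt' _).trans ht))
    (fun k _ => hG.B_nonneg (hs.trans (hsy k)) (hy (Nat.le_succ k)) ((hyt' _).trans ht))
    (fun k _ => (hloc k).1) (fun k _ => (hloc k).2.2.1) (fun k _ => (hloc k).2.2.2)
    (fun k h1 h2 => absurd (Finset.mem_range.2 h1) h2) hA hB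
  have hUe : eLpNorm (fun ω => I t ω - I s ω - riemannSum Ξ (R ∪ F) ω) (ENNReal.ofReal q)
      (weighted P g) ≤ ENNReal.ofReal (e / 2) := by
    refine le_trans (eLpNorm_mono_enorm_ae ?_) (hmax.trans (ENNReal.ofReal_le_ofReal hH))
    filter_upwards [hgerm.self] with ω hω
    have e1 : I t ω - I s ω - riemannSum Ξ (R ∪ F) ω = ∑ k ∈ Finset.range n, Z k ω := by
      rw [riemannSum, ← himg, sum_intervals_image_range hy n (f := fun p => Ξ p.1 p.2 ω)
        fun k _ => hω _ (hsy k) ((hyt' k).trans ht)]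
      simp only [hZ]
      rw [Finset.sum_sub_distrib, Finset.sum_range_sub (fun k => I (y k) ω), hy0, hyt n le_rfl]
    rw [enorm_eq_self, e1]
    exact enorm_sum_le_maxPartialSum _ le_rfl ω
  have e2 : (fun ω => I t ω - I s ω - riemannSum Ξ R ω)
      = (fun ω => I t ω - I s ω - riemannSum Ξ (R ∪ F) ω)
        + (riemannSum Ξ (R ∪ F) - riemannSum Ξ R) := by
    funext ω
    simp only [Pi.add_apply, Pi.sub_apply]
    abel
  rw [e2]
  refine (eLpNorm_add_le ((hDm _ hU).mono_ac weighted_absolutelyContinuous)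
    ((stronglyMeasurable_riemannSum hgerm.adapted le_rfl ht hU).sub
      (stronglyMeasurable_riemannSum hgerm.adapted le_rfl ht hR)).aestronglyMeasurable hq1).trans ?_
  rw [show e = e / 2 + e / 2 by ring, ENNReal.ofReal_add (by positivity) (by positivity)]
  exact add_le_add hUe (hUR.trans (ENNReal.ofReal_le_ofReal he'F))

end Consequences

/-! ### From controls to the sewn process -/

section Hypotheses

variable {Ω : Type*} {mΩ : MeasurableSpace Ω} {E : Type*} [NormedAddCommGroup E]
  {q T : ℝ} {r : ℝ≥0∞} {ℱ : Filtration ℝ mΩ} {P : Measure Ω} {Ξ : ℝ → ℝ → Ω → E}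

/-- Right-continuity in the first argument and superadditivity make `w(p,v)` small when `v` is close
to `p`. -/
theorem tendsto_control_self {w : ℝ → ℝ → ℝ} (hw : IsControl T w) (hr : RightContFst T w) {p : ℝ}
    (h0 : 0 ≤ p) (hT : p < T) : Tendsto (w p) (𝓝[>] p) (𝓝 0) := by
  have h1 : Tendsto (fun v => w p T - w v T) (𝓝[>] p) (𝓝 0) := by
    have := (tendsto_const_nhds (x := w p T)).sub (hr p T h0 hT le_rfl)
    rwa [sub_self] at this
  refine tendsto_of_tendsto_of_tendsto_of_le_of_le' tendsto_const_nhds h1 ?_ ?_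
  · filter_upwards [Ioo_mem_nhdsGT hT] with v hv using hw.nonneg p v h0 hv.1.le hv.2.le
  · filter_upwards [Ioo_mem_nhdsGT hT] with v hv
    have := hw.superadd p v T h0 hv.1.le hv.2.le le_rfl
    linarith

theorem tendsto_controlSum_zero {n : ℕ} {w₁ w₂ : Fin n → ℝ → ℝ → ℝ} {a b : Fin n → ℝ}
    (hw : ∀ i, IsControl T (w₂ i) ∧ RightContFst T (w₂ i)) (hb : ∀ i, 0 < b i) {p : ℝ}
    (h0 : 0 ≤ p) (hT : p < T) : Tendsto (fun v => controlSum w₁ w₂ a b 0 p v) (𝓝[>] p) (𝓝 0) := by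
  have : Tendsto (fun v => ∑ i, w₁ i 0 p ^ a i * w₂ i p v ^ b i) (𝓝[>] p)
      (𝓝 (∑ i : Fin n, w₁ i 0 p ^ a i * 0)) := by
    refine tendsto_finsetSum _ fun i _ => Tendsto.const_mul _ ?_
    have := (tendsto_control_self (hw i).1 (hw i).2 h0 hT).rpow_const (p := b i)
      (Or.inr (hb i).le)
    rwa [Real.zero_rpow (hb i).ne'] at this
  simpa [controlSum] using this

/-- The bound for `δΞ_{u,p,v}` is at most its value at `u = 0`, which makes it uniform in `u`. -/
theorem controlSum_le_controlSum_zero {n : ℕ} {w₁ w₂ : Fin n → ℝ → ℝ → ℝ} {a b : Fin n → ℝ}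
    (hw₁ : ∀ i, IsControl T (w₁ i)) (hw₂ : ∀ i, IsControl T (w₂ i)) (ha : ∀ i, 0 < a i)
    {s u t : ℝ} (hs : 0 ≤ s) (hsu : s ≤ u) (hut : u ≤ t) (ht : t ≤ T) :
    controlSum w₁ w₂ a b s u t ≤ controlSum w₁ w₂ a b 0 u t := by
  refine Finset.sum_le_sum fun i _ => mul_le_mul_of_nonneg_right ?_
    (Real.rpow_nonneg ((hw₂ i).nonneg u t (hs.trans hsu) hut ht) _)
  exact Real.rpow_le_rpow ((hw₁ i).nonneg s u hs hsu (hut.trans ht))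
    ((hw₁ i).mono le_rfl hs hsu le_rfl (hut.trans ht)) (ha i).le

variable [IsProbabilityMeasure P]

theorem delta_self_ae_eq_zero {μ : Measure Ω}
    (hself : ∀ᵐ ω ∂μ, ∀ t, 0 ≤ t → t ≤ T → Ξ t t ω = 0) {s t : ℝ} (h0 : 0 ≤ t) (ht : t ≤ T) :
    delta Ξ s t t =ᵐ[μ] 0 := by
  filter_upwards [hself] with ω hω
  simp [delta, hω t h0 ht]

/-- The bound on `‖sup_v |δΞ_{s,u,v}|‖_{q,r,s}` in terms of weighted measures. The supremum is
measurable since the paths are right-continuous. -/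
theorem isMaxGerm_weighted {R : ℕ} {wh₁ wh₂ : Fin R → ℝ → ℝ → ℝ} {γ₁ γ₂ : Fin R → ℝ}
    (hq : 2 ≤ q) (hr : 1 ≤ r) (hγ₁ : ∀ k, 0 < γ₁ k) (hγ₂ : ∀ k, 0 < γ₂ k)
    (hΞ : ∀ s t, 0 ≤ s → s ≤ t → t ≤ T → StronglyMeasurable[ℱ t] (Ξ s t))
    (hself : ∀ᵐ ω ∂P, ∀ t, 0 ≤ t → t ≤ T → Ξ t t ω = 0)
    (hcad : ∀ s, 0 ≤ s → s < T → ∀ᵐ ω ∂P, IsCadlagOn (fun t => Ξ s t ω) s T)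
    (hwh₁ : ∀ k, IsControl T (wh₁ k)) (hwh₂ : ∀ k, IsControl T (wh₂ k))
    (hmax : ∀ s u t, 0 ≤ s → s ≤ u → u ≤ t → t ≤ T →
      condNorm q r (ℱ s) P (fun ω => ⨆ v ∈ Set.Icc u t, ‖delta Ξ s u v ω‖ₑ)
        ≤ ENNReal.ofReal (controlSum wh₁ wh₂ γ₁ γ₂ s u t))
    {g : Ω → ℝ≥0} (hg : IsTestDensity r (ℱ 0) P g) :
    IsMaxGerm q T (weighted P g) Ξ (controlSumLeft wh₁ wh₂ γ₁ γ₂) := by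
  have hmeas : ∀ {s u t}, 0 ≤ s → s ≤ u → u ≤ t → t ≤ T →
      AEMeasurable (fun ω => ⨆ v ∈ Set.Icc u t, ‖delta Ξ s u v ω‖ₑ) P := by
    intro s u t hs hsu hut ht
    refine aemeasurable_iSup_Icc hut (f := fun v ω => ‖delta Ξ s u v ω‖ₑ) (fun v h1 h2 => ?_) ?_
    · exact ((((hΞ s v hs (hsu.trans h1) (h2.trans ht)).mono (ℱ.le _)).sub
        ((hΞ s u hs hsu (hut.trans ht)).mono (ℱ.le _))).sub
        ((hΞ u v (hs.trans hsu) h1 (h2.trans ht)).mono (ℱ.le _))).aestronglyMeasurable.enorm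
    · rcases hut.eq_or_lt with rfl | hlt
      · exact Eventually.of_forall fun ω v h1 h2 => absurd h1 (not_le.2 h2)
      filter_upwards [hcad s hs (hsu.trans_lt (hlt.trans_le ht)),
        hcad u (hs.trans hsu) (hlt.trans_le ht)] with ω h1 h2 v h3 h4
      exact (((h1.1 v (hsu.trans h3) (h4.trans_le ht)).sub_const _).sub
        (h2.1 v h3 (h4.trans_le ht))).enorm
  refine ⟨fun hs hsu hut ht => (hmeas hs hsu hut ht).mono_ac weighted_absolutelyContinuous, ?_⟩
  intro s u t hs hsu hut ht
  rcases hut.eq_or_lt with rfl | hlt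
  · have h0 : (fun ω => ⨆ v ∈ Set.Icc u u, ‖delta Ξ s u v ω‖ₑ) =ᵐ[weighted P g] 0 := by
      refine weighted_absolutelyContinuous ?_
      filter_upwards [delta_self_ae_eq_zero (s := s) hself (hs.trans hsu) ht] with ω hω
      simp [hω]
    rw [eLpNorm_congr_ae h0, eLpNorm_zero]
    exact zero_le
  · refine ((condNorm_le_iff (ℱ.le s) hr (by linarith) (hmeas hs hsu hut ht)).1
      (hmax s u t hs hsu hut ht) g (hg.mono (ℱ.mono hs))).trans (ENNReal.ofReal_le_ofReal ?_)
    exact controlSum_le_controlSumLeft hwh₁ hwh₂ hγ₁ hγ₂ hs hsu hlt ht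

variable [NormedSpace ℝ E] [CompleteSpace E]

/-- The three-point bounds of the sewing lemma imply the two-point bounds with left values: if the
last two points coincide, `δΞ` vanishes, and otherwise the left values dominate. -/
theorem isSewable_of_controls {N M : ℕ} {w₁ w₂ : Fin N → ℝ → ℝ → ℝ} {wb₁ wb₂ : Fin M → ℝ → ℝ → ℝ}
    {α₁ α₂ : Fin N → ℝ} {β₁ β₂ : Fin M → ℝ} (hq : 2 ≤ q) (hr : 1 ≤ r)
    (hα₁ : ∀ i, 0 < α₁ i) (hα₂ : ∀ i, 0 < α₂ i) (hβ₁ : ∀ j, 0 < β₁ j) (hβ₂ : ∀ j, 0 < β₂ j)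
    (hΞ : ∀ s t, 0 ≤ s → s ≤ t → t ≤ T → StronglyMeasurable[ℱ t] (Ξ s t))
    (hself : ∀ᵐ ω ∂P, ∀ t, 0 ≤ t → t ≤ T → Ξ t t ω = 0)
    (hw₁ : ∀ i, IsControl T (w₁ i)) (hw₂ : ∀ i, IsControl T (w₂ i))
    (hwb₁ : ∀ j, IsControl T (wb₁ j)) (hwb₂ : ∀ j, IsControl T (wb₂ j) ∧ RightContFst T (wb₂ j))
    (hA : ∀ s u t, 0 ≤ s → s ≤ u → u ≤ t → t ≤ T →
      eLpNorm (condExp (ℱ s) P (delta Ξ s u t)) (ENNReal.ofReal q * r) P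
        ≤ ENNReal.ofReal (controlSum w₁ w₂ α₁ α₂ s u t))
    (hB : ∀ s u t, 0 ≤ s → s ≤ u → u ≤ t → t ≤ T →
      condNorm q r (ℱ s) P (fun ω => ‖delta Ξ s u t ω‖ₑ)
        ≤ ENNReal.ofReal (controlSum wb₁ wb₂ β₁ β₂ s u t)) :
    IsSewable q r T ℱ P Ξ (controlSumLeft w₁ w₂ α₁ α₂) (controlSumLeft wb₁ wb₂ β₁ β₂)
      (fun p v => controlSum wb₁ wb₂ β₁ β₂ 0 p v) := by
  have hq0 : 0 < q := by linarith
  have hm : ∀ {s u t}, 0 ≤ s → s ≤ u → u ≤ t → t ≤ T → AEStronglyMeasurable (delta Ξ s u t) P :=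
    fun hs hsu hut ht => ((delta_stronglyMeasurable (fun h1 h2 h3 => hΞ _ _ h1 h2 h3) hs hsu hut
      ht).mono (ℱ.le _)).aestronglyMeasurable
  have hn : ∀ {s u t g}, 0 ≤ s → s ≤ u → u ≤ t → t ≤ T → IsTestDensity r (ℱ s) P g →
      eLpNorm (delta Ξ s u t) (ENNReal.ofReal q) (weighted P g)
        ≤ ENNReal.ofReal (controlSum wb₁ wb₂ β₁ β₂ s u t) := fun hs hsu hut ht hg => by
    have := (condNorm_le_iff (ℱ.le _) hr hq0 (hm hs hsu hut ht).enorm).1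
      (hB _ _ _ hs hsu hut ht) _ hg
    rwa [eLpNorm_enorm] at this
  have hint : ∀ {s u t}, 0 ≤ s → s ≤ u → u ≤ t → t ≤ T → Integrable (delta Ξ s u t) P :=
    fun hs hsu hut ht => by
      have := hn hs hsu hut ht (isTestDensity_one hr)
      rw [weighted_one] at this
      exact (memLp_of_eLpNorm_le (hm hs hsu hut ht) this).integrable (one_le_ofReal_of_two_le hq)
  have hzero : ∀ {s t g}, 0 ≤ t → t ≤ T → delta Ξ s t t =ᵐ[weighted P g] 0 := fun h0 ht =>
    weighted_absolutelyContinuous (delta_self_ae_eq_zero hself h0 ht)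
  refine ⟨fun {s₀ g} hs₀ _ hg => ⟨fun h1 h2 h3 => hΞ _ _ (hs₀.trans h1) h2 h3, ?_, ?_, ?_⟩, ?_, ?_⟩
  · exact weighted_absolutelyContinuous (by
      filter_upwards [hself] with ω hω t h1 h2 using hω t (hs₀.trans h1) h2)
  · intro s u t hs hsu hut ht
    have hs0 := hs₀.trans hs
    rcases hut.eq_or_lt with rfl | hlt
    · have e := condExp_congr_ae (m := ℱ s) (hzero (s := s) (g := g) (hs0.trans hsu) ht)
      rw [condExp_zero] at e
      rw [eLpNorm_congr_ae e, eLpNorm_zero]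
      exact zero_le
    · exact ((eLpNorm_condExp_le_iff (ℱ.le s) hr hq0 (hint hs0 hsu hut ht)).1
        (hA s u t hs0 hsu hut ht) g (hg.mono (ℱ.mono hs))).trans (ENNReal.ofReal_le_ofReal
        (controlSum_le_controlSumLeft hw₁ hw₂ hα₁ hα₂ hs0 hsu hlt ht))
  · intro s u t hs hsu hut ht
    have hs0 := hs₀.trans hs
    rcases hut.eq_or_lt with rfl | hlt
    · rw [eLpNorm_congr_ae (hzero (hs0.trans hsu) ht), eLpNorm_zero]
      exact zero_le
    · exact (hn hs0 hsu hut ht (hg.mono (ℱ.mono hs))).trans (ENNReal.ofReal_le_ofReal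
        (controlSum_le_controlSumLeft hwb₁ (fun j => (hwb₂ j).1) hβ₁ hβ₂ hs0 hsu hlt ht))
  · intro u p v g hu hup hpv hv hg
    exact (hn hu hup hpv hv hg).trans (ENNReal.ofReal_le_ofReal
      (controlSum_le_controlSum_zero hwb₁ (fun j => (hwb₂ j).1) hβ₁ hu hup hpv hv))
  · exact fun p h0 hT => tendsto_controlSum_zero hwb₂ hβ₂ h0 hT

end Hypotheses

section Maximal

variable {Ω : Type*} {mΩ : MeasurableSpace Ω} {E : Type*} [NormedAddCommGroup E] [NormedSpace ℝ E]
  {q T : ℝ} {r : ℝ≥0∞} {ℱ : Filtration ℝ mΩ} {P : Measure Ω} {Ξ : ℝ → ℝ → Ω → E}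
  {A B ρ Γ : ℝ → ℝ → ℝ} {K L η κ : ℝ} [IsProbabilityMeasure P] [CompleteSpace E]

/-- The constant in the uniform estimate, which dominates the one in the sewing estimates. -/
noncomputable def maxConst (κ K η : ℝ) : ℝ := oscConst κ K * (1 - (1 / 2) ^ η)⁻¹

theorem sewConst_le_maxConst (hK : 0 < K) (hη : 0 < η) : sewConst κ K η ≤ maxConst κ K η := by
  have h1 : 0 < (1 - (1 / 2 : ℝ) ^ η)⁻¹ := inv_pos.2 (by linarith [half_rpow_lt_one hη])
  have h2 : 0 < K * (1 - (1 / 2 : ℝ) ^ η)⁻¹ := mul_pos hK h1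
  rw [sewConst, maxConst, oscConst]
  linarith

omit [IsProbabilityMeasure P] [CompleteSpace E] in
theorem StochSewing.IsSewing.mono_const {C C' : ℝ} {I : ℝ → Ω → E}
    (hG : IsGauge q T L K η A B Γ) (hI : IsSewing q r T ℱ P Ξ A B C I) (h : C ≤ C') :
    IsSewing q r T ℱ P Ξ A B C' I where
  adapted := hI.adapted
  zero := hI.zero
  condExp_le s t hs hst ht := (hI.condExp_le s t hs hst ht).trans (ENNReal.ofReal_le_ofReal
    (mul_le_mul_of_nonneg_right h (hG.A_nonneg hs hst ht)))
  condNorm_le s t hs hst ht := (hI.condNorm_le s t hs hst ht).trans (ENNReal.ofReal_le_ofReal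
    (mul_le_mul_of_nonneg_right h (add_nonneg (hG.A_nonneg hs hst ht) (hG.B_nonneg hs hst ht))))

/-- Construction of the càdlàg sewn process as a uniform limit of stopped Riemann sums along a
refining chain of `[0,T]`. -/
theorem IsSewable.exists_cadlag_sewing (hq : 2 ≤ q) (hr : 1 ≤ r)
    (hκ : ∀ μ : Measure Ω, IsFiniteMeasure μ → IsMaximalConst q E κ μ) (hκ0 : 0 ≤ κ)
    (hΞ : IsSewable q r T ℱ P Ξ A B ρ)
    (hmax : ∀ g, IsTestDensity r (ℱ 0) P g → IsMaxGerm q T (weighted P g) Ξ Γ)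
    (hcad : ∀ s, 0 ≤ s → s < T → ∀ᵐ ω ∂P, IsCadlagOn (fun t => Ξ s t ω) s T)
    (hℱ : IsCompleteFiltration T ℱ P)
    (hG : IsGauge q T L K η A B Γ) (hK : 0 < K) (hη : 0 < η) (hT : 0 < T) :
    ∃ I : ℝ → Ω → E, IsSewing q r T ℱ P Ξ A B (maxConst κ K η) I ∧
      (∀ ω, IsCadlagOn (fun t => I t ω) 0 T) ∧
      ∃ R : ℕ → Finset ℝ, (∀ h, IsPartition (R h) 0 T) ∧ (∀ h, R h ⊆ R (h + 1)) ∧ R 0 = {0, T} ∧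
        Tendsto (fun h => mesh (R h)) atTop (𝓝 0) ∧
        ∀ h : ℕ, condNorm q r (ℱ 0) P
            (fun ω => ⨆ t ∈ Set.Icc (0 : ℝ) T, ‖I t ω - stoppedSum Ξ (R h) t ω‖ₑ)
          ≤ ENNReal.ofReal (maxConst κ K η * (2 : ℝ) ^ (-(η * h)) * (A 0 T + B 0 T + Γ 0 T)) := by
  have hq1 := one_le_ofReal_of_two_le hq
  have hq0 : 0 < q := by linarith
  have hone := isTestDensity_one (P := P) (m := ℱ 0) hr
  have hgermP := hΞ.germ le_rfl hT.le hone
  have hmaxP := hmax 1 hone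
  rw [weighted_one] at hgermP hmaxP
  obtain ⟨W, x, hx, hlen, hlev⟩ := hG.exists_chain le_rfl hT le_rfl isClosed_Icc
    (Set.left_mem_Icc.2 hT.le) (Set.right_mem_Icc.2 hT.le) subset_rfl
  have hmesh := hx.tendsto_mesh (fun u v h1 h2 h3 => hlen u v h1 h2 h3) hT.le
  set Y : ℕ → Ω → ℝ≥0∞ := levelOsc Ξ x with hY
  have hYm : ∀ h, AEMeasurable (Y h) P := fun h =>
    hx.aemeasurable_levelOsc hgermP.adapted hmaxP h
  set θ : ℝ := (1 / 2) ^ η with hθ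
  have hθ0 : 0 ≤ θ := by positivity
  have hθ1 : θ < 1 := half_rpow_lt_one hη
  set b : ℝ := oscConst κ K * (A 0 T + B 0 T + Γ 0 T) with hb
  have hA0 := hG.A_nonneg le_rfl hT.le le_rfl
  have hB0 := hG.B_nonneg le_rfl hT.le le_rfl
  have hΓ0 := hG.Γ_nonneg le_rfl hT.le le_rfl
  have hb0 : 0 ≤ b := by rw [hb, oscConst]; positivity
  have hYb : ∀ g, IsTestDensity r (ℱ 0) P g → ∀ h,
      eLpNorm (Y h) (ENNReal.ofReal q) (weighted P g) ≤ ENNReal.ofReal (b * θ ^ h) := by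
    intro g hg h
    have hfin := hg.isFiniteMeasure
    obtain ⟨S, hS, hin, h1, h2, h3⟩ := hlev h
    refine (hx.eLpNorm_levelOsc_le hq (hκ _ hfin) hκ0 (hΞ.germ le_rfl hT.le hg) hG (hmax g hg) hS
      hin h1 h2 h3).trans (ENNReal.ofReal_le_ofReal ?_)
    have h4 : 0 ≤ K * θ ^ h * (A 0 T + B 0 T) := by positivity
    have h5 : 0 ≤ κ * (K * θ ^ h * Γ 0 T) := by positivity
    have h6 : 0 ≤ K * θ ^ h * Γ 0 T := by positivity
    rw [hb, oscConst]
    nlinarith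
  have htail : ∀ g, IsTestDensity r (ℱ 0) P g → ∀ h,
      eLpNorm (fun ω => ∑' k, Y (h + k) ω) (ENNReal.ofReal q) (weighted P g)
        ≤ ENNReal.ofReal (b * (1 - θ)⁻¹ * θ ^ h) := by
    intro g hg h
    refine (eLpNorm_tsum_le_tsum (by linarith) fun k =>
      (hYm (h + k)).mono_ac weighted_absolutelyContinuous).trans ?_
    refine (ENNReal.tsum_le_tsum fun k => hYb g hg (h + k)).trans_eq ?_
    have hs : Summable fun k : ℕ => b * θ ^ (h + k) := by
      simp_rw [pow_add]
      exact ((summable_geometric_of_lt_one hθ0 hθ1).mul_left _).mul_left _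
    rw [← ENNReal.ofReal_tsum_of_nonneg (fun k => by positivity) hs]
    congr 1
    simp_rw [pow_add]
    rw [tsum_mul_left, tsum_mul_left, tsum_geometric_of_lt_one hθ0 hθ1]
    ring
  have htailP : ∀ h, eLpNorm (fun ω => ∑' k, Y (h + k) ω) (ENNReal.ofReal q) P
      ≤ ENNReal.ofReal (b * (1 - θ)⁻¹ * θ ^ h) := fun h => by
    have := htail 1 hone h
    rwa [weighted_one] at this
  have hfinite : ∀ᵐ ω ∂P, ∑' h, Y h ω ≠ ∞ := by
    have h1 := (lintegral_rpow_le_iff_eLpNorm_le hq0 _ _).2 (htailP 0)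
    have h2 := ae_lt_top' ((AEMeasurable.tsum fun k => hYm (0 + k)).pow_const q)
      (h1.trans_lt (ENNReal.rpow_lt_top_of_nonneg hq0.le ENNReal.ofReal_ne_top)).ne
    filter_upwards [h2] with ω hω
    have := (ENNReal.rpow_lt_top_iff_of_pos hq0).1 hω
    simpa using this.ne
  -- the null sets may depend on `s`, but only countably many times occur in the chain
  have hcad' : ∀ᵐ ω ∂P, ∀ h, ∀ u ∈ chainPoints x h, u < T →
      IsCadlagOn (fun t => Ξ u t ω) u T := by
    have h1 : ∀ᵐ ω ∂P, ∀ h k, x h k < T → IsCadlagOn (fun t => Ξ (x h k) t ω) (x h k) T := by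
      refine ae_all_iff.2 fun h => ae_all_iff.2 fun k => ?_
      by_cases hlt : x h k < T
      · filter_upwards [hcad (x h k) (hx.left_le h k) hlt] with ω hω _ using hω
      · exact Eventually.of_forall fun ω h => absurd h hlt
    filter_upwards [h1] with ω hω h u hu
    obtain ⟨k, -, rfl⟩ := Finset.mem_image.1 hu
    exact hω h k
  obtain ⟨I, hI1, hI2, hI3⟩ := exists_cadlag_limit hℱ
    (S := fun h => stoppedSum Ξ (chainPoints x h)) (Y := Y)
    (fun h t h1 h2 => stronglyMeasurable_stoppedSum (fun s t => hgermP.adapted)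
      (hx.isPartition h) h1 h2) (by
      filter_upwards [hgermP.self, hcad', hfinite] with ω h1 h2 h3
      exact ⟨fun h t ht => hx.enorm_stoppedSum_sub_le h1 h ht,
        fun h => isCadlagOn_stoppedSum h1 (hx.isPartition h) (h2 h), h3⟩)
  have hlim : ∀ t, 0 ≤ t → t ≤ T → Tendsto (fun h =>
      eLpNorm (I t - stoppedSum Ξ (chainPoints x h) t) (ENNReal.ofReal q) P) atTop (𝓝 0) := by
    intro t h0 h1
    have h2 : Tendsto (fun h : ℕ => ENNReal.ofReal (b * (1 - θ)⁻¹ * θ ^ h)) atTop (𝓝 0) := by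
      have := ENNReal.tendsto_ofReal ((tendsto_pow_atTop_nhds_zero_of_lt_one hθ0 hθ1).const_mul
        (b * (1 - θ)⁻¹))
      simpa using this
    refine tendsto_of_tendsto_of_tendsto_of_le_of_le tendsto_const_nhds h2
      (fun _ => zero_le) fun h => le_trans (eLpNorm_mono_enorm_ae ?_) (htailP h)
    filter_upwards [hI3] with ω hω
    rw [enorm_eq_self]
    exact hω h t ⟨h0, h1⟩
  refine ⟨I, (hΞ.isSewing hq hr hκ hκ0 hG hK hη hT hI1 hx.isPartition hmesh hlim).mono_const hG
    (sewConst_le_maxConst hK hη), hI2, chainPoints x, hx.isPartition, hx.chainPoints_subset,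
    hx.chainPoints_zero, hmesh, fun h => ?_⟩
  refine (condNorm_mono (Y := fun ω => ∑' k, Y (h + k) ω) hq0.le ?_).trans ?_
  · filter_upwards [hI3] with ω hω
    exact iSup₂_le fun t ht => hω h t ht
  · refine (condNorm_le_iff (ℱ.le 0) hr hq0
      (AEMeasurable.tsum fun k => hYm (h + k))).2 fun g hg => (htail g hg h).trans_eq ?_
    have e : (2 : ℝ) ^ (-(η * h)) = θ ^ h := by
      rw [hθ, ← Real.rpow_natCast, ← Real.rpow_mul (by norm_num), one_div,
        Real.inv_rpow (by norm_num), Real.rpow_neg (by norm_num)]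
    rw [e, maxConst, ← hθ, hb]
    congr 1
    ring

end Maximal

theorem theorem3p2
    (q : ℝ) (hq : 2 ≤ q) (N M K : ℕ)
    (α₁ α₂ : Fin N → ℝ) (β₁ β₂ : Fin M → ℝ) (γ₁ γ₂ : Fin K → ℝ)
    (hα₁ : ∀ i, 0 < α₁ i) (hα₂ : ∀ i, 0 < α₂ i) (hα : ∀ i, 1 < α₁ i + α₂ i)
    (hβ₁ : ∀ j, 0 < β₁ j) (hβ₂ : ∀ j, 0 < β₂ j) (hβ : ∀ j, 1 / 2 < β₁ j + β₂ j)
    (hγ₁ : ∀ k, 0 < γ₁ k) (hγ₂ : ∀ k, 0 < γ₂ k) (hγ : ∀ k, 1 / q < γ₁ k + γ₂ k) :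
    ∃ η : ℝ, 0 < η ∧
    ∀ (E : Type*) [NormedAddCommGroup E] [NormedSpace ℝ E] [FiniteDimensional ℝ E],
    ∃ C : ℝ, 0 < C ∧
    ∀ (Ω : Type*) (mΩ : MeasurableSpace Ω) (P : Measure Ω) [IsProbabilityMeasure P]
      (T : ℝ) (_ : 0 < T) (ℱ : Filtration ℝ mΩ) (r : ℝ≥0∞) (_ : 1 ≤ r)
      (Ξ : ℝ → ℝ → Ω → E)
      (w₁ w₂ : Fin N → ℝ → ℝ → ℝ) (wb₁ wb₂ : Fin M → ℝ → ℝ → ℝ) (wh₁ wh₂ : Fin K → ℝ → ℝ → ℝ),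
      -- the setting of the stochastic sewing lemma
      (∀ s t, 0 ≤ s → s ≤ t → t ≤ T → StronglyMeasurable[ℱ t] (Ξ s t)) →
      (∀ i, IsControl T (w₁ i) ∧ RightContFst T (w₁ i)) →
      (∀ i, IsControl T (w₂ i) ∧ RightContFst T (w₂ i)) →
      (∀ j, IsControl T (wb₁ j) ∧ RightContFst T (wb₁ j)) →
      (∀ j, IsControl T (wb₂ j) ∧ RightContFst T (wb₂ j)) →
      (∀ s u t, 0 ≤ s → s ≤ u → u ≤ t → t ≤ T →
        eLpNorm (condExp (ℱ s) P (delta Ξ s u t)) (ENNReal.ofReal q * r) P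
          ≤ ENNReal.ofReal (controlSum w₁ w₂ α₁ α₂ s u t)) →
      (∀ s u t, 0 ≤ s → s ≤ u → u ≤ t → t ≤ T →
        condNorm q r (ℱ s) P (fun ω => ‖delta Ξ s u t ω‖ₑ)
          ≤ ENNReal.ofReal (controlSum wb₁ wb₂ β₁ β₂ s u t)) →
      -- the additional assumptions
      IsCompleteFiltration T ℱ P →
      (∀ᵐ ω ∂P, ∀ t, 0 ≤ t → t ≤ T → Ξ t t ω = 0) →
      (∀ s, 0 ≤ s → s < T → ∀ᵐ ω ∂P, IsCadlagOn (fun t => Ξ s t ω) s T) →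
      (∀ i, RightContSnd T (w₁ i) ∨ RightContSnd T (w₂ i)) →
      (∀ j, RightContSnd T (wb₁ j) ∨ RightContSnd T (wb₂ j)) →
      (∀ k, IsControl T (wh₁ k) ∧ RightContFst T (wh₁ k)) →
      (∀ k, IsControl T (wh₂ k) ∧ RightContFst T (wh₂ k)) →
      (∀ s u t, 0 ≤ s → s ≤ u → u ≤ t → t ≤ T →
        condNorm q r (ℱ s) P (fun ω => ⨆ v ∈ Set.Icc u t, ‖delta Ξ s u v ω‖ₑ)
          ≤ ENNReal.ofReal (controlSum wh₁ wh₂ γ₁ γ₂ s u t)) →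
      -- the sewn process, its uniqueness, and its description as a limit of Riemann sums
      ∃ I : ℝ → Ω → E,
        IsSewing q r T ℱ P Ξ (controlSumLeft w₁ w₂ α₁ α₂) (controlSumLeft wb₁ wb₂ β₁ β₂) C I ∧
        (∀ (c : ℝ) (J : ℝ → Ω → E),
          IsSewing q r T ℱ P Ξ (controlSumLeft w₁ w₂ α₁ α₂) (controlSumLeft wb₁ wb₂ β₁ β₂) c J →
          ∀ t, 0 ≤ t → t ≤ T → ∀ᵐ ω ∂P, J t ω = I t ω) ∧
        (∀ s t, 0 ≤ s → s ≤ t → t ≤ T → ∀ ε : ℝ≥0∞, 0 < ε → ∃ d : ℝ≥0, 0 < d ∧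
          ∀ Q : Finset ℝ, IsPartition Q s t → mesh Q < d →
            condNorm q r (ℱ s) P (fun ω => ‖I t ω - I s ω - riemannSum Ξ Q ω‖ₑ) < ε) ∧
        -- the càdlàg version and the uniform estimate
        ∃ I' : ℝ → Ω → E,
          (∀ t, 0 ≤ t → t ≤ T → StronglyMeasurable[ℱ t] (I' t)) ∧
          (∀ t, 0 ≤ t → t ≤ T → ∀ᵐ ω ∂P, I' t ω = I t ω) ∧
          (∀ ω, IsCadlagOn (fun t => I' t ω) 0 T) ∧
          ∃ Q : ℕ → Finset ℝ,
            (∀ h, IsPartition (Q h) 0 T) ∧ (∀ h, Q h ⊆ Q (h + 1)) ∧ Q 0 = {0, T} ∧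
            Tendsto (fun h => mesh (Q h)) atTop (𝓝 0) ∧
            ∀ h : ℕ,
              condNorm q r (ℱ 0) P
                  (fun ω => ⨆ t ∈ Set.Icc (0 : ℝ) T, ‖I' t ω - stoppedSum Ξ (Q h) t ω‖ₑ)
                ≤ ENNReal.ofReal (C * (2 : ℝ) ^ (-(η * h)) *
                    (controlSumLeft w₁ w₂ α₁ α₂ 0 T + controlSumLeft wb₁ wb₂ β₁ β₂ 0 T
                      + controlSumLeft wh₁ wh₂ γ₁ γ₂ 0 T)) := by
  obtain ⟨L, hL, η, hη, R, hR, hgauge⟩ :=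
    exists_isGauge hq hα₁ hα₂ hα hβ₁ hβ₂ hβ hγ₁ hγ₂ hγ
  refine ⟨η, hη, fun E _ _ _ => ?_⟩
  have hcomplete : CompleteSpace E := FiniteDimensional.complete ℝ E
  obtain ⟨κ, hκ0, hκ⟩ := exists_eLpNorm_maxPartialSum_adapted_le hq E
  have hC : 0 < maxConst κ R η := (sewConst_pos hκ0.le hR hη).trans_le (sewConst_le_maxConst hR hη)
  refine ⟨maxConst κ R η, hC, ?_⟩
  intro Ω mΩ P _ T hT ℱ r hr Ξ w₁ w₂ wb₁ wb₂ wh₁ wh₂ hΞ hw₁ hw₂ hwb₁ hwb₂ hA hB hℱ hself hcad _ _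
    hwh₁ hwh₂ hmax
  have hκ' : ∀ μ : Measure Ω, IsFiniteMeasure μ → IsMaximalConst q E κ μ :=
    fun μ _ 𝒢 Z a b n => hκ μ 𝒢 Z a b n
  have hG := hgauge T w₁ w₂ wb₁ wb₂ wh₁ wh₂ hw₁ (fun i => (hw₂ i).1) hwb₁ (fun j => (hwb₂ j).1)
    hwh₁ (fun k => (hwh₂ k).1)
  have hsew := isSewable_of_controls hq hr hα₁ hα₂ hβ₁ hβ₂ hΞ hself (fun i => (hw₁ i).1)
    (fun i => (hw₂ i).1) (fun j => (hwb₁ j).1) hwb₂ hA hB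
  obtain ⟨I, hI, hIc, Q, hQ⟩ := hsew.exists_cadlag_sewing hq hr hκ' hκ0.le
    (fun g hg => isMaxGerm_weighted hq hr hγ₁ hγ₂ hΞ hself hcad (fun k => (hwh₁ k).1)
      (fun k => (hwh₂ k).1) hmax hg) hcad hℱ hG hR hη hT
  refine ⟨I, hI, fun c J hJ t h0 ht => ?_, fun s t hs hst ht ε hε => ?_, I, hI.adapted,
    fun t _ _ => Eventually.of_forall fun ω => rfl, hIc, Q, hQ⟩
  · exact hI.ae_eq hq hr (hκ' P inferInstance) hκ0.le hΞ hG hη hJ h0 ht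
  · exact hsew.exists_mesh hq hr hκ' hκ0.le hG hη hC.le hT hI hs hst ht hε
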